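/- **Setting.** Let $n\ge 0$ and let $I=\{0,\dots,n-1\}$ be partitioned into $I=I^{+}\uplus I^{\sim}\uplus I^{-}$ (good, neutral and bad indices). Let $f:I\to\{0,1\}$ be a randomized function whose probabilities $p_i=\Pr[f(i)=1]$ satisfy $p_i\ge 9/10$ for $i\in I^{+}$ and $p_i<1/10$ for $i\in I^{-}$; for $i\in I^{\sim}$ the value $p_i$ is arbitrary. The function is accessible through a black-box unitary $U_f$ that acts on an index register of $\lceil\log_2 n\rceil$ qubits, one answer qubit, and a workspace of $w\ge 0$ qubits. For every $i\in I$ there are unit vectors $|\psi_{i,1}\rangle,|\psi_{i,0}\rangle$ of the workspace with $$U_f|i\rangle|0\rangle|0^w\rangle=\sqrt{p_i}\,|i\rangle|1\rangle|\psi_{i,1}\rangle+\sqrt{1-p_i}\,|i\rangle|0\rangle|\psi_{i,0}\rangle ;$$ on all other basis states $U_f$ is an arbitrary unitary extension. *Search on Bounded-Error and Neutral Inputs* asks for an output in $I\cup\{\bot\}$. The output is correct if it is some $i\in I^{+}\cup I^{\sim}$, or if it is $\bot$ and $I^{+}=\varnothing$. **Model.** An algorithm is a family of quantum circuits that a computable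 function produces from $n$ and $w$ (and from the precision parameter $\lceil\log_2\delta^{-1}\rceil$ in the second part); the circuits do not depend on $f$, on $U_f$, or on the partition. All qubits start in $|0\rangle$. The gates are the Hadamard gate, the $T$ gate, CNOT, the Toffoli gate, the QRAG gate (which swaps a target qubit with the memory qubit that an address register points to), and the applications of $U_f$ and of $U_f^{-1}$. At the end an output register is measured. The time is the number of gates, where an application of $U_f^{\pm1}$ counts as one gate. **Lemma.** 1. There are an algorithm and constants $C,c$ such that, for all $n$ and $w$, the algorithm makes at most $C\sqrt n$ applications of $U_f^{\pm1}$, runs in time at most $C\,(w+1)\,(1+\log n)^{c}\sqrt n$ (so in $\tilde O(\sqrt n)$ time when the workspace of $U_f$ has at most polylogarithmically many qubits), and, on every instance and every oracle $U_f$ for it, gives a correct output with probability at least $2/3$. 2. There are an algorithm and constants $C,c$ such that, for all $n$ and $w$ and every real $\delta\in(0,1/3)$, the algorithm makes at most $C(\sqrt n\log\delta^{-1}+\log^3\delta^{-1})$ applications of $U_f^{\pm1}$, runs in time at most $C\,(w+1)\,(1+\log n)^{c}\,(\sqrt n\log\delta^{-1}+\log^3\delta^{-1})$, and, on every instance and every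 oracle $U_f$ for it, gives a correct output with probability at least $1-\delta$. Here $\log$ is the natural logarithm, and $\log 0$ is read as $0$ when $n=0$. -/

import Mathlib

/-! Quantum circuits with an oracle, and the search problem on bounded-error and neutral inputs. -/

noncomputable section

namespace QSearch

/-! ### The machine model

Qubits are numbered by `ℕ`; all of them are initially in the state `|0⟩`, and a circuit touches
finitely many of them. A register is a block of consecutive qubits, given by its first qubit. -/

/-- A computational basis state of the qubits. -/
abbrev Config := ℕ → Bool

/-- A state vector: a finite linear combination of computational basis states. -/
abbrev QState := Config →₀ ℂ

/-- The basis state `|x⟩`. -/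
def ket (x : Config) : QState := Finsupp.single x 1

/-- The number written in binary (least significant bit first) in the qubits
`start, …, start + len - 1`. -/
def regValue (x : Config) (start len : ℕ) : ℕ :=
  ∑ j ∈ Finset.range len, if x (start + j) then 2 ^ j else 0

/-- The instructions of a circuit: Hadamard gate, `T` gate, CNOT, Toffoli gate, the gate of a
quantum random access memory of quantum bits (QRAG), and the applications of the oracle and of its
inverse. An oracle instruction names the first qubit `idx` of the index register, the answer
qubit `ans`, and the first qubit `work` of the workspace. -/
inductive Gate where
  | hadamard (q : ℕ)
  | tgate (q : ℕ)
  | cnot (control target : ℕ)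
  | toffoli (control₁ control₂ target : ℕ)
  | qrag (addr addrLen target mem : ℕ)
  | oracle (idx ans work : ℕ)
  | oracleInv (idx ans work : ℕ)

namespace Gate

/-- Gates are finite data: the evident equivalence that makes them codable by numbers. -/
def equivSum : Gate ≃
    (ℕ ⊕ ℕ) ⊕ ((ℕ × ℕ) ⊕ (ℕ × ℕ × ℕ)) ⊕ (ℕ × ℕ × ℕ × ℕ) ⊕ ((ℕ × ℕ × ℕ) ⊕ (ℕ × ℕ × ℕ)) where
  toFun
    | hadamard q => .inl (.inl q)
    | tgate q => .inl (.inr q)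
    | cnot c t => .inr (.inl (.inl (c, t)))
    | toffoli c d t => .inr (.inl (.inr (c, d, t)))
    | qrag a l t m => .inr (.inr (.inl (a, l, t, m)))
    | oracle i a v => .inr (.inr (.inr (.inl (i, a, v))))
    | oracleInv i a v => .inr (.inr (.inr (.inr (i, a, v))))
  invFun
    | .inl (.inl q) => hadamard q
    | .inl (.inr q) => tgate q
    | .inr (.inl (.inl (c, t))) => cnot c t
    | .inr (.inl (.inr (c, d, t))) => toffoli c d t
    | .inr (.inr (.inl (a, l, t, m))) => qrag a l t m
    | .inr (.inr (.inr (.inl (i, a, v)))) => oracle i a v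
    | .inr (.inr (.inr (.inr (i, a, v)))) => oracleInv i a v
  left_inv g := by cases g <;> rfl
  right_inv s := by
    rcases s with (_ | _) | (_ | _) | _ | (_ | _) <;> rfl

instance : Primcodable Gate := Primcodable.ofEquiv _ equivSum

/-- Is the instruction an application of the oracle or of its inverse? -/
def isQuery : Gate → Bool
  | oracle _ _ _ => true
  | oracleInv _ _ _ => true
  | _ => false

/-- The registers of one instruction are pairwise disjoint (for an oracle with an `ℓ`-qubit index
register and a `w`-qubit workspace). -/
def WellFormed (ℓ w : ℕ) : Gate → Prop
  | hadamard _ => True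
  | tgate _ => True
  | cnot c t => c ≠ t
  | toffoli c d t => c ≠ d ∧ c ≠ t ∧ d ≠ t
  | qrag a l t m =>
      (∀ j < l, a + j ≠ t) ∧ (∀ k < 2 ^ l, m + k ≠ t) ∧ (∀ j < l, ∀ k < 2 ^ l, a + j ≠ m + k)
  | oracle i a v => (∀ j < ℓ, i + j ≠ a) ∧ (∀ k < w, v + k ≠ a) ∧ (∀ j < ℓ, ∀ k < w, i + j ≠ v + k)
  | oracleInv i a v =>
      (∀ j < ℓ, i + j ≠ a) ∧ (∀ k < w, v + k ≠ a) ∧ (∀ j < ℓ, ∀ k < w, i + j ≠ v + k)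

end Gate

/-- Basis states of the registers on which the oracle acts:
index register, answer qubit, workspace. -/
abbrev OracleBasis (ℓ w : ℕ) := (Fin ℓ → Bool) × Bool × (Fin w → Bool)

/-- Unitary operators on the oracle's registers. -/
abbrev OracleUnitary (ℓ w : ℕ) := Matrix.unitaryGroup (OracleBasis ℓ w) ℂ

/-- The content of the oracle's registers when they are placed at `i`, `a`, `v`. -/
def readRegs (ℓ w i a v : ℕ) (x : Config) : OracleBasis ℓ w :=
  (fun j => x (i + j), x a, fun k => x (v + k))

/-- Replace the content of the oracle's registers placed at `i`, `a`, `v`. -/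
def writeRegs {ℓ w : ℕ} (i a v : ℕ) (y : OracleBasis ℓ w) (x : Config) : Config := fun q =>
  if h : i ≤ q ∧ q - i < ℓ then y.1 ⟨q - i, h.2⟩
  else if q = a then y.2.1
  else if h : v ≤ q ∧ q - v < w then y.2.2 ⟨q - v, h.2⟩
  else x q

/-- The operator `U` on the registers placed at `i`, `a`, `v`, tensored with the identity. -/
def applyAt {ℓ w : ℕ} (U : OracleUnitary ℓ w) (i a v : ℕ) : QState →ₗ[ℂ] QState :=
  Finsupp.linearCombination ℂ fun x =>
    ∑ y : OracleBasis ℓ w,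
      (U : Matrix (OracleBasis ℓ w) (OracleBasis ℓ w) ℂ) y (readRegs ℓ w i a v x) •
        ket (writeRegs i a v y x)

/-- The linear map that a gate performs, with `U` as the oracle. The QRAG gate swaps the target
qubit with the memory qubit whose number is the content of the address register. -/
def Gate.apply {ℓ w : ℕ} (U : OracleUnitary ℓ w) : Gate → (QState →ₗ[ℂ] QState)
  | .hadamard q => Finsupp.linearCombination ℂ fun x =>
      ((1 / √2 : ℝ) : ℂ) •
        (ket (Function.update x q false) +
          (if x q then (-1 : ℂ) else 1) • ket (Function.update x q true))
  | .tgate q => Finsupp.linearCombination ℂ fun x =>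
      (if x q then Complex.exp (Complex.I * (Real.pi / 4)) else 1) • ket x
  | .cnot c t => Finsupp.linearCombination ℂ fun x =>
      ket (Function.update x t (xor (x t) (x c)))
  | .toffoli c d t => Finsupp.linearCombination ℂ fun x =>
      ket (Function.update x t (xor (x t) (x c && x d)))
  | .qrag a l t m => Finsupp.linearCombination ℂ fun x =>
      ket (x ∘ Equiv.swap t (m + regValue x a l))
  | .oracle i a v => applyAt U i a v
  | .oracleInv i a v => applyAt U⁻¹ i a v

/-- A circuit is a list of gates, performed from left to right. -/
abbrev Circuit := List Gate

namespace Circuit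

/-- Every instruction acts on pairwise disjoint registers, so that it is a unitary operator. -/
def WellFormed (ℓ w : ℕ) (A : Circuit) : Prop := ∀ g ∈ A, g.WellFormed ℓ w

/-- Time: the number of gates, an application of the oracle counting as one. -/
def time (A : Circuit) : ℕ := A.length

/-- The number of applications of the oracle and of its inverse. -/
def queries (A : Circuit) : ℕ := A.countP Gate.isQuery

/-- The final state, when the circuit starts with all qubits in the state `|0⟩`. -/
def finalState {ℓ w : ℕ} (A : Circuit) (U : OracleUnitary ℓ w) : QState :=
  A.foldl (fun ψ g => g.apply U ψ) (ket fun _ => false)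

/-- The output read off from a measured basis state: `none` (the sentinel `⊥`) if qubit `0` is `0`,
and otherwise the number in the qubits `1, …, ℓ`. -/
def output (ℓ : ℕ) (x : Config) : Option ℕ :=
  if x 0 then some (regValue x 1 ℓ) else none

open Classical in
/-- The probability that measuring all qubits at the end gives an output that satisfies `S`. -/
def prob {ℓ w : ℕ} (A : Circuit) (U : OracleUnitary ℓ w) (S : Option ℕ → Prop) : ℝ :=
  (A.finalState U).sum fun x c => if S (output ℓ x) then ‖c‖ ^ 2 else 0

end Circuit

/-! ### The problem -/

/-- The instances of search on bounded-error and neutral inputs: a partition of `{0, …, n - 1}`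
into good, neutral and bad indices, and a randomized function `f` with values in `{0, 1}`. -/
structure Instance (n : ℕ) where
  good : Finset (Fin n)
  neutral : Finset (Fin n)
  bad : Finset (Fin n)
  good_neutral : Disjoint good neutral
  good_bad : Disjoint good bad
  neutral_bad : Disjoint neutral bad
  cover : good ∪ neutral ∪ bad = Finset.univ
  f : Fin n → PMF Bool
  le_of_good : ∀ i ∈ good, 9 / 10 ≤ (f i true).toReal
  lt_of_bad : ∀ i ∈ bad, (f i true).toReal < 1 / 10

namespace Instance

variable {n : ℕ}

/-- `p i` is the probability of `f(i) = 1`. -/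
def p (P : Instance n) (i : Fin n) : ℝ := (P.f i true).toReal

/-- The number of qubits of the index register: the least `ℓ` with `n ≤ 2 ^ ℓ`. -/
abbrev indexBits (n : ℕ) : ℕ := Nat.clog 2 n

/-- The binary representation of an index. -/
def enc (i : Fin n) : Fin (indexBits n) → Bool := fun j => Nat.testBit i j

/-- `U` is an oracle for `f`: for every index `i` there are unit vectors `ψ₁`, `ψ₀` of the
workspace with `U|i⟩|0⟩|0⟩ = √pᵢ |i⟩|1⟩|ψ₁⟩ + √(1 - pᵢ) |i⟩|0⟩|ψ₀⟩`. -/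
def IsOracle {w : ℕ} (P : Instance n) (U : OracleUnitary (indexBits n) w) : Prop :=
  ∀ i : Fin n, ∃ ψ₁ ψ₀ : (Fin w → Bool) → ℂ,
    ∑ z, ‖ψ₁ z‖ ^ 2 = 1 ∧ ∑ z, ‖ψ₀ z‖ ^ 2 = 1 ∧
    ∀ (j : Fin (indexBits n) → Bool) (b : Bool) (z : Fin w → Bool),
      (U : Matrix (OracleBasis (indexBits n) w) (OracleBasis (indexBits n) w) ℂ)
          (j, b, z) (enc i, false, fun _ => false) =
        if j = enc i then
          (if b then ((√(P.p i) : ℝ) : ℂ) * ψ₁ z else ((√(1 - P.p i) : ℝ) : ℂ) * ψ₀ z)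
        else 0

/-- The correct outputs: a good or neutral index, and `⊥` if there is no good index. -/
def IsCorrect (P : Instance n) : Option ℕ → Prop
  | some k => ∃ i ∈ P.good ∪ P.neutral, (i : ℕ) = k
  | none => P.good = ∅

end Instance

end QSearch

end

/-! The algorithm is coherent amplitude amplification interleaved with error reduction. Each
subroutine works on a fresh block of qubits and nothing is measured before the end, so a procedure
is described exactly by the weights W i with which its final state carries a raised flag and the
index i. Three operations act on these weights. Filtering by an independent test that accepts i with
probability q i turns W i into q i * W i. One amplification step turns it into (3 - 4σ)² * W i,
where σ is the total weight; garbage in the workspace is harmless, because the step only rescales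
the flagged part of the state. Running a second procedure if the first fails gives V i + (1 - ΣV) *
W i. These are `IsProc.filter`, `IsProc.amplify` and `IsProc.orElse`.

Tests are NAND trees over independent oracle calls. Two NAND layers map an acceptance probability x
to 1 - (1 - x²)², which has a repelling fixed point at (√5 - 1)/2 ≈ 0.618 and squares the error, up
to constants, on either side. An AND layer at the bottom moves the threshold on p to about 0.786.
The two kinds of tree thus have different thresholds, with 5/8 lying above the lower one and well
below the upper one. This gap is what copes with neutral indices: the filters inside the search
suppress every index with p < 5/8, while the final check keeps every index with p ≥ 5/8 with
probability at least 5/8 and rejects bad ones.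

Level 0 is the filtered uniform superposition, and each later level amplifies the previous one and
filters again. A good index gains almost a factor 9 per level until the total weights of the levels
have added up to 1/4; this must happen once 9^m ≥ 2^ℓ (`one_fourth_le_sum`). Weak indices lose
weight geometrically, as 9/1000 < 1/2 (`sum_levelWeight_le`). Trying all levels in turn hence
succeeds with probability at least 1/5, almost all of it on indices with p ≥ 5/8, and a checked pass
succeeds with probability at least 1/9 (`le_sum_passWeight`). With 6(d + 1) passes, both the
probability of finding nothing and that of returning a bad index are at most 2^(-d-1)
(`le_prob_searchCircuit`).

A level runs its predecessor three times and adds a tree of O(2^j) leaves. As 2 < 3, the filters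
cost only a constant factor: level j uses O(3^j) queries, so a pass uses O(√n) apart from its final
check. That check has 4^h = O(d²) leaves, and O(d) passes give √n * d + d³. -/

namespace QSearch

/-! ### Linear algebra of state vectors -/

/-- Bitwise exclusive or of configurations. -/
def cxor (x y : Config) : Config := fun q => xor (x q) (y q)

/-- The configuration with all qubits `0`. -/
def zeroConfig : Config := fun _ => false

@[simp] theorem zeroConfig_apply (q : ℕ) : zeroConfig q = false := rfl

@[simp] theorem cxor_apply (x y : Config) (q : ℕ) : cxor x y q = xor (x q) (y q) := rfl

@[simp] theorem cxor_zeroConfig (x : Config) : cxor x zeroConfig = x := by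
  ext q; simp

@[simp] theorem zeroConfig_cxor (x : Config) : cxor zeroConfig x = x := by
  ext q; simp

theorem cxor_assoc (x y z : Config) : cxor (cxor x y) z = cxor x (cxor y z) := by
  ext q; simp

theorem cxor_injective (x : Config) : Function.Injective (cxor x) := by
  intro y z h
  ext q
  simpa using congrFun h q

/-- Translation of the basis states by `x`. -/
noncomputable def translate (x : Config) : QState →ₗ[ℂ] QState :=
  Finsupp.lmapDomain ℂ ℂ (cxor x)

@[simp] theorem translate_ket (x y : Config) : translate x (ket y) = ket (cxor x y) := by
  simp [translate, ket]

theorem translate_translate (x y : Config) (φ : QState) :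
    translate x (translate y φ) = translate (cxor x y) φ := by
  simp only [translate, Finsupp.lmapDomain_apply, ← Finsupp.mapDomain_comp]
  congr 1
  ext z
  simp

theorem ket_apply (x y : Config) [Decidable (x = y)] : ket x y = if x = y then 1 else 0 := by
  rw [ket, Finsupp.single_apply]

theorem state_eq_sum (φ : QState) : φ = φ.sum fun x c => c • ket x := by
  simp [ket]

/-- Linear maps that agree on the basis states are equal. -/
theorem linearMap_ext {A B : QState →ₗ[ℂ] QState} (h : ∀ x, A (ket x) = B (ket x)) (φ : QState) :
    A φ = B φ := by
  have : A = B := Finsupp.lhom_ext fun x c => by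
    have := h x
    have e : Finsupp.single x c = c • ket x := by simp [ket]
    rw [e, map_smul, map_smul, this]
  rw [this]

/-- The inner product of state vectors. -/
noncomputable def ip (φ ψ : QState) : ℂ := φ.sum fun x c => (starRingEnd ℂ) c * ψ x

theorem ip_add_left (φ φ' ψ : QState) : ip (φ + φ') ψ = ip φ ψ + ip φ' ψ := by
  unfold ip
  rw [Finsupp.sum_add_index'] <;> intros <;> simp [add_mul]

theorem ip_smul_left (c : ℂ) (φ ψ : QState) : ip (c • φ) ψ = (starRingEnd ℂ) c * ip φ ψ := by
  unfold ip
  rw [Finsupp.sum_smul_index' (by simp), Finsupp.mul_sum]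
  simp [mul_assoc]

theorem ip_add_right (φ ψ ψ' : QState) : ip φ (ψ + ψ') = ip φ ψ + ip φ ψ' := by
  simp [ip, mul_add, Finsupp.sum_add]

theorem ip_smul_right (c : ℂ) (φ ψ : QState) : ip φ (c • ψ) = c * ip φ ψ := by
  unfold ip
  rw [Finsupp.mul_sum]
  refine Finset.sum_congr rfl fun x _ => ?_
  simp; ring

@[simp] theorem ip_ket_left (x : Config) (ψ : QState) : ip (ket x) ψ = ψ x := by
  simp [ip, ket]

@[simp] theorem ip_zero_left (ψ : QState) : ip 0 ψ = 0 := by simp [ip]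

@[simp] theorem ip_zero_right (ψ : QState) : ip ψ 0 = 0 := by simp [ip]

theorem ip_ket_right (φ : QState) (x : Config) : ip φ (ket x) = (starRingEnd ℂ) (φ x) := by
  classical
  unfold ip
  simp only [ket_apply, mul_ite, mul_one, mul_zero, Finsupp.sum]
  rw [Finset.sum_ite_eq]
  split_ifs with h
  · rfl
  · rw [Finsupp.notMem_support_iff.mp h, map_zero]

/-- Two linear maps with adjoint matrices are adjoint to each other. -/
theorem ip_adjoint {A B : QState →ₗ[ℂ] QState}
    (h : ∀ x y, (starRingEnd ℂ) (A (ket x) y) = B (ket y) x) (φ ψ : QState) :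
    ip (A φ) ψ = ip φ (B ψ) := by
  induction φ using Finsupp.induction_linear with
  | zero => simp
  | add f g hf hg => simp [ip_add_left, hf, hg]
  | single x c =>
    have e : Finsupp.single x c = c • ket x := by simp [ket]
    rw [e, map_smul, ip_smul_left, ip_smul_left]
    congr 1
    induction ψ using Finsupp.induction_linear with
    | zero => simp
    | add f g hf hg => simp [ip_add_right, hf, hg]
    | single y d =>
      have e : Finsupp.single y d = d • ket y := by simp [ket]
      rw [e, map_smul, ip_smul_right, ip_smul_right, ip_ket_right, h, ip_ket_left]

/-! ### Weights -/

open Classical in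
/-- The total squared modulus of the amplitudes of the basis states in `S`. -/
noncomputable def wt (φ : QState) (S : Config → Prop) : ℝ :=
  φ.sum fun x c => if S x then ‖c‖ ^ 2 else 0

theorem wt_nonneg (φ : QState) (S : Config → Prop) : 0 ≤ wt φ S :=
  Finset.sum_nonneg fun x _ => by dsimp only; split_ifs <;> positivity

theorem wt_congr {φ : QState} {S T : Config → Prop} (h : ∀ x, φ x ≠ 0 → (S x ↔ T x)) :
    wt φ S = wt φ T := by
  classical
  refine Finset.sum_congr rfl fun x hx => ?_
  simp [h x (Finsupp.mem_support_iff.mp hx)]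

theorem wt_mono {φ : QState} {S T : Config → Prop} (h : ∀ x, φ x ≠ 0 → S x → T x) :
    wt φ S ≤ wt φ T := by
  classical
  refine Finset.sum_le_sum fun x hx => ?_
  by_cases hS : S x
  · simp [hS, h x (Finsupp.mem_support_iff.mp hx) hS]
  · simp only [hS, if_false]; split_ifs <;> positivity

theorem wt_eq_zero {φ : QState} {S : Config → Prop} (h : ∀ x, φ x ≠ 0 → ¬ S x) : wt φ S = 0 := by
  classical
  refine Finset.sum_eq_zero fun x hx => ?_
  simp [h x (Finsupp.mem_support_iff.mp hx)]

theorem wt_add_wt_and_not (φ : QState) (S T : Config → Prop) :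
    (wt φ fun x => S x ∧ T x) + (wt φ fun x => S x ∧ ¬ T x) = wt φ S := by
  classical
  unfold wt
  rw [← Finsupp.sum_add]
  refine Finset.sum_congr rfl fun x _ => ?_
  by_cases h : S x <;> by_cases h' : T x <;> simp [h, h']

theorem wt_add_wt_not (φ : QState) (S : Config → Prop) :
    wt φ S + wt φ (fun x => ¬ S x) = wt φ fun _ => True := by
  classical
  unfold wt
  rw [← Finsupp.sum_add]
  refine Finset.sum_congr rfl fun x _ => ?_
  by_cases h : S x <;> simp [h]

open Classical in
theorem wt_eq_sum_of_subset {φ : QState} {F : Finset Config} (h : φ.support ⊆ F)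
    (S : Config → Prop) : wt φ S = ∑ x ∈ F, if S x then ‖φ x‖ ^ 2 else 0 :=
  Finsupp.sum_of_support_subset φ h _ (by simp)

theorem wt_smul (c : ℂ) (φ : QState) (S : Config → Prop) : wt (c • φ) S = ‖c‖ ^ 2 * wt φ S := by
  classical
  rw [wt_eq_sum_of_subset (Finsupp.support_smul (b := c) (g := φ)), wt, Finsupp.mul_sum]
  refine Finset.sum_congr rfl fun x _ => ?_
  simp [mul_pow]

theorem wt_zero (S : Config → Prop) : wt 0 S = 0 := by simp [wt]

theorem wt_ket (x : Config) (S : Config → Prop) [Decidable (S x)] :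
    wt (ket x) S = if S x then 1 else 0 := by
  simp [wt, ket]

theorem wt_true_eq_ip (φ : QState) : ((wt φ fun _ => True : ℝ) : ℂ) = ip φ φ := by
  simp only [wt, ip, if_true, Finsupp.sum]
  push_cast
  refine Finset.sum_congr rfl fun x _ => ?_
  rw [mul_comm, Complex.mul_conj, Complex.normSq_eq_norm_sq]
  simp

/-- The weights of vectors with disjoint supports add up. -/
theorem wt_add_of_disjoint {φ ψ : QState} (h : ∀ x, φ x ≠ 0 → ψ x ≠ 0 → False)
    (S : Config → Prop) : wt (φ + ψ) S = wt φ S + wt ψ S := by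
  classical
  rw [wt_eq_sum_of_subset Finsupp.support_add,
    wt_eq_sum_of_subset (F := φ.support ∪ ψ.support) Finset.subset_union_left,
    wt_eq_sum_of_subset (F := φ.support ∪ ψ.support) Finset.subset_union_right,
    ← Finset.sum_add_distrib]
  refine Finset.sum_congr rfl fun x _ => ?_
  split_ifs
  · by_cases h1 : φ x = 0
    · simp [h1]
    · have h2 : ψ x = 0 := by_contra fun h2 => h x h1 h2
      simp [h2]
  · simp

theorem wt_sum_of_disjoint {ι : Type*} (F : Finset ι) (f : ι → QState)
    (h : ∀ i ∈ F, ∀ j ∈ F, i ≠ j → ∀ x, f i x ≠ 0 → f j x ≠ 0 → False) (S : Config → Prop) :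
    wt (∑ i ∈ F, f i) S = ∑ i ∈ F, wt (f i) S := by
  classical
  induction F using Finset.induction_on with
  | empty => simp [wt_zero]
  | insert a F ha ih =>
    rw [Finset.sum_insert ha, Finset.sum_insert ha, wt_add_of_disjoint, ih]
    · exact fun i hi j hj => h i (Finset.mem_insert_of_mem hi) j (Finset.mem_insert_of_mem hj)
    · intro x hx hs
      rw [Finsupp.finsetSum_apply] at hs
      obtain ⟨j, hj, hne⟩ := Finset.exists_ne_zero_of_sum_ne_zero hs
      exact h a (Finset.mem_insert_self _ _) j (Finset.mem_insert_of_mem hj)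
        (fun e => ha (e ▸ hj)) x hx hne

theorem wt_mapDomain {f : Config → Config} (hf : Function.Injective f) (φ : QState)
    (S : Config → Prop) : wt (Finsupp.mapDomain f φ) S = wt φ fun x => S (f x) := by
  classical
  unfold wt
  rw [Finsupp.sum_mapDomain_index_inj hf]

theorem wt_translate (x : Config) (φ : QState) (S : Config → Prop) :
    wt (translate x φ) S = wt φ fun y => S (cxor x y) :=
  wt_mapDomain (cxor_injective x) φ S

/-- The weight of a set splits into the weights of its pieces. -/
theorem wt_eq_sum_fiber {ι : Type*} [DecidableEq ι] (F : Finset ι) (φ : QState)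
    (S : Config → Prop) (g : Config → ι) (h : ∀ x, φ x ≠ 0 → S x → g x ∈ F) :
    wt φ S = ∑ i ∈ F, wt φ fun x => S x ∧ g x = i := by
  classical
  unfold wt Finsupp.sum
  rw [Finset.sum_comm]
  refine Finset.sum_congr rfl fun x hx => ?_
  by_cases hS : S x
  · have := h x (Finsupp.mem_support_iff.mp hx) hS
    simp [hS, this]
  · simp [hS]

/-! ### Supports -/

/-- All basis states that occur in `φ` satisfy `P`. -/
def SuppIn (P : Config → Prop) (φ : QState) : Prop := ∀ x, φ x ≠ 0 → P x

namespace SuppIn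

theorem ket {P : Config → Prop} {x : Config} (h : P x) : SuppIn P (ket x) := by
  classical
  intro y hy
  rw [ket_apply] at hy
  by_cases e : x = y
  · exact e ▸ h
  · simp [e] at hy

theorem add {P : Config → Prop} {φ ψ : QState} (h : SuppIn P φ) (h' : SuppIn P ψ) :
    SuppIn P (φ + ψ) := by
  intro x hx
  by_cases h1 : φ x = 0
  · exact h' x fun h2 => hx (by simp [h1, h2])
  · exact h x h1

theorem smul {P : Config → Prop} {φ : QState} (c : ℂ) (h : SuppIn P φ) : SuppIn P (c • φ) :=
  fun x hx => h x fun e => hx (by simp [e])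

theorem sum {P : Config → Prop} {ι : Type*} {F : Finset ι} {f : ι → QState}
    (h : ∀ i ∈ F, SuppIn P (f i)) : SuppIn P (∑ i ∈ F, f i) := by
  intro x hx
  rw [Finsupp.finsetSum_apply] at hx
  obtain ⟨j, hj, hne⟩ := Finset.exists_ne_zero_of_sum_ne_zero hx
  exact h j hj x hne

theorem mono {P Q : Config → Prop} {φ : QState} (h : SuppIn P φ) (hPQ : ∀ x, P x → Q x) :
    SuppIn Q φ := fun x hx => hPQ x (h x hx)

theorem and {P Q : Config → Prop} {φ : QState} (h : SuppIn P φ) (h' : SuppIn Q φ) :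
    SuppIn (fun x => P x ∧ Q x) φ := fun x hx => ⟨h x hx, h' x hx⟩

theorem map {P Q : Config → Prop} {φ : QState} (h : SuppIn P φ) {A : QState →ₗ[ℂ] QState}
    (hA : ∀ x, P x → SuppIn Q (A (QSearch.ket x))) : SuppIn Q (A φ) := by
  rw [state_eq_sum φ, Finsupp.sum, map_sum]
  refine sum fun x hx => ?_
  rw [map_smul]
  exact smul _ (hA x (h x (Finsupp.mem_support_iff.mp hx)))

theorem translate {P Q : Config → Prop} {φ : QState} {x : Config} (h : SuppIn P φ)
    (hPQ : ∀ y, P y → Q (cxor x y)) : SuppIn Q (translate x φ) :=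
  h.map fun y hy => by rw [translate_ket]; exact ket (hPQ y hy)

end SuppIn

/-- Linear maps that agree on the basis states of `φ` agree on `φ`. -/
theorem linearMap_congr {P : Config → Prop} {φ : QState} (hφ : SuppIn P φ)
    {A B : QState →ₗ[ℂ] QState} (h : ∀ x, P x → A (ket x) = B (ket x)) : A φ = B φ := by
  rw [state_eq_sum φ, Finsupp.sum, map_sum, map_sum]
  refine Finset.sum_congr rfl fun x hx => ?_
  rw [map_smul, map_smul, h x (hφ x (Finsupp.mem_support_iff.mp hx))]

theorem map_eq_sum (A : QState →ₗ[ℂ] QState) (φ : QState) :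
    A φ = ∑ x ∈ φ.support, φ x • A (ket x) := by
  conv_lhs => rw [state_eq_sum φ, Finsupp.sum, map_sum]
  simp only [map_smul]

/-- The qubits `s, …, t - 1` are `0`. -/
def Clean (s t : ℕ) (x : Config) : Prop := ∀ q, s ≤ q → q < t → x q = false

/-- All qubits but `s, …, t - 1` are `0`. -/
def Within (s t : ℕ) (x : Config) : Prop := ∀ q, q < s ∨ t ≤ q → x q = false

/-- Inside the block x and x' vanish, outside it y and y' do, so x can be read off from its sum with
y. This is why branches that start in different basis states stay orthogonal when a fresh block is
filled. -/
theorem cxor_inj_of_clean {s t : ℕ} {x x' y y' : Config} (hx : Clean s t x) (hx' : Clean s t x')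
    (hy : Within s t y) (hy' : Within s t y') (h : cxor x y = cxor x' y') : x = x' := by
  ext q
  have := congrFun h q
  simp only [cxor_apply] at this
  by_cases hq : s ≤ q ∧ q < t
  · rw [hx q hq.1 hq.2, hx' q hq.1 hq.2]
  · have hq' : q < s ∨ t ≤ q := by omega
    simpa [hy q hq', hy' q hq'] using this

/-- If every basis state `x` of `φ` gets tensored with a vector `γ x` of a fresh block, weights
multiply. -/
theorem wt_branch {s t : ℕ} {φ : QState} (hφ : SuppIn (Clean s t) φ) {γ : Config → QState}
    (hγ : ∀ x, φ x ≠ 0 → SuppIn (Within s t) (γ x)) (S : Config → Prop) :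
    wt (∑ x ∈ φ.support, φ x • translate x (γ x)) S =
      ∑ x ∈ φ.support, ‖φ x‖ ^ 2 * wt (γ x) fun z => S (cxor x z) := by
  rw [wt_sum_of_disjoint]
  · exact Finset.sum_congr rfl fun x _ => by rw [wt_smul, wt_translate]
  · intro x hx x' hx' hne y hy hy'
    rw [Finsupp.mem_support_iff] at hx hx'
    have h1 : SuppIn (fun y => ∃ z, y = cxor x z ∧ Within s t z) (φ x • translate x (γ x)) :=
      SuppIn.smul _ ((hγ x hx).translate fun z hz => ⟨z, rfl, hz⟩)
    have h2 : SuppIn (fun y => ∃ z, y = cxor x' z ∧ Within s t z) (φ x' • translate x' (γ x')) :=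
      SuppIn.smul _ ((hγ x' hx').translate fun z hz => ⟨z, rfl, hz⟩)
    obtain ⟨z, rfl, hz⟩ := h1 y hy
    obtain ⟨z', e, hz'⟩ := h2 _ hy'
    exact hne (cxor_inj_of_clean (hφ x hx) (hφ x' hx') hz hz' e)

open Classical in
theorem sum_norm_sq_eq_wt (φ : QState) (S : Config → Prop) :
    ∑ x ∈ φ.support, (if S x then ‖φ x‖ ^ 2 else 0) = wt φ S := rfl

end QSearch


/-! ### Unitarity and locality of circuits -/

namespace QSearch

variable {ℓ w : ℕ}

/-! ### The action of the gates on basis states -/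

section apply
variable (U : OracleUnitary ℓ w) (x : Config)

theorem apply_hadamard (q : ℕ) : (Gate.hadamard q).apply U (ket x) =
    ((1 / √2 : ℝ) : ℂ) • (ket (Function.update x q false) +
      (if x q then (-1 : ℂ) else 1) • ket (Function.update x q true)) := by
  rw [Gate.apply, ket, Finsupp.linearCombination_single, one_smul]

theorem apply_tgate (q : ℕ) : (Gate.tgate q).apply U (ket x) =
    (if x q then Complex.exp (Complex.I * (Real.pi / 4)) else 1) • ket x := by
  rw [Gate.apply, ket, Finsupp.linearCombination_single, one_smul]; rfl

theorem apply_cnot (c t : ℕ) : (Gate.cnot c t).apply U (ket x) =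
    ket (Function.update x t (xor (x t) (x c))) := by
  rw [Gate.apply, ket, Finsupp.linearCombination_single, one_smul]

theorem apply_toffoli (c d t : ℕ) : (Gate.toffoli c d t).apply U (ket x) =
    ket (Function.update x t (xor (x t) (x c && x d))) := by
  rw [Gate.apply, ket, Finsupp.linearCombination_single, one_smul]

theorem applyAt_ket (i a v : ℕ) : applyAt U i a v (ket x) =
    ∑ y : OracleBasis ℓ w, (U : Matrix (OracleBasis ℓ w) (OracleBasis ℓ w) ℂ) y
      (readRegs ℓ w i a v x) • ket (writeRegs i a v y x) := by
  rw [applyAt, ket, Finsupp.linearCombination_single, one_smul]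

end apply

/-- The registers of the oracle, placed at `i`, `a`, `v`, are pairwise disjoint. -/
abbrev OracleDisjoint (ℓ w i a v : ℕ) : Prop := (Gate.oracle i a v).WellFormed ℓ w

theorem readRegs_writeRegs {i a v : ℕ} (h : OracleDisjoint ℓ w i a v) (y : OracleBasis ℓ w)
    (x : Config) : readRegs ℓ w i a v (writeRegs i a v y x) = y := by
  obtain ⟨h1, h2, h3⟩ := h
  obtain ⟨y1, y2, y3⟩ := y
  simp only [readRegs, writeRegs, Prod.mk.injEq]
  refine ⟨funext fun j => ?_, ?_, funext fun k => ?_⟩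
  · have : i ≤ i + (j : ℕ) ∧ i + (j : ℕ) - i < ℓ := by omega
    rw [dif_pos this]; congr; omega
  · have : ¬ (i ≤ a ∧ a - i < ℓ) := fun hc => h1 (a - i) hc.2 (by omega)
    rw [dif_neg this]; simp
  · have e1 : ¬ (i ≤ v + (k : ℕ) ∧ v + (k : ℕ) - i < ℓ) := fun hc =>
      h3 (v + k - i) hc.2 k k.2 (by omega)
    have e2 : v ≤ v + (k : ℕ) ∧ v + (k : ℕ) - v < w := by omega
    rw [dif_neg e1, if_neg (h2 k k.2), dif_pos e2]; congr; omega

theorem writeRegs_writeRegs (i a v : ℕ) (y y' : OracleBasis ℓ w) (x : Config) :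
    writeRegs i a v y (writeRegs i a v y' x) = writeRegs i a v y x := by
  ext q; simp only [writeRegs]; split_ifs <;> rfl

theorem writeRegs_readRegs (i a v : ℕ) (x : Config) :
    writeRegs i a v (readRegs ℓ w i a v x) x = x := by
  ext q; simp only [writeRegs, readRegs]
  split_ifs with h1 h2 h3
  · congr 1; omega
  · rw [h2]
  · congr 1; omega
  · rfl

theorem applyAt_ket_apply (U : OracleUnitary ℓ w) {i a v : ℕ} (h : OracleDisjoint ℓ w i a v)
    (x y : Config) [Decidable (writeRegs i a v (readRegs ℓ w i a v y) x = y)] :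
    applyAt U i a v (ket x) y =
      if writeRegs i a v (readRegs ℓ w i a v y) x = y then
        (U : Matrix (OracleBasis ℓ w) (OracleBasis ℓ w) ℂ) (readRegs ℓ w i a v y)
          (readRegs ℓ w i a v x) else 0 := by
  classical
  rw [applyAt_ket, Finsupp.finsetSum_apply, Finset.sum_eq_single (readRegs ℓ w i a v y)]
  · simp [ket_apply]
  · intro z _ hz
    rw [Finsupp.smul_apply, ket_apply, if_neg, smul_zero]
    rintro rfl
    exact hz (readRegs_writeRegs h z x).symm
  · simp

/-- Two basis states are connected by a nonzero entry only if they agree outside the registers,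
which is a symmetric condition; on the registers the inverse of a unitary is its conjugate
transpose. -/
theorem ip_applyAt (U : OracleUnitary ℓ w) {i a v : ℕ} (h : OracleDisjoint ℓ w i a v)
    (φ ψ : QState) : ip (applyAt U i a v φ) ψ = ip φ (applyAt U⁻¹ i a v ψ) := by
  classical
  refine ip_adjoint (fun x y => ?_) φ ψ
  rw [applyAt_ket_apply U h, applyAt_ket_apply U⁻¹ h]
  have e : writeRegs i a v (readRegs ℓ w i a v y) x = y ↔
      writeRegs i a v (readRegs ℓ w i a v x) y = x := by
    constructor
    · intro hx; rw [← hx, writeRegs_writeRegs, writeRegs_readRegs]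
    · intro hx; rw [← hx, writeRegs_writeRegs, writeRegs_readRegs]
  by_cases hx : writeRegs i a v (readRegs ℓ w i a v y) x = y
  · rw [if_pos hx, if_pos (e.mp hx), Matrix.UnitaryGroup.inv_apply, Matrix.star_apply]
    rfl
  · rw [if_neg hx, if_neg (fun h' => hx (e.mpr h')), map_zero]

theorem applyAt_mul (U V : OracleUnitary ℓ w) {i a v : ℕ} (h : OracleDisjoint ℓ w i a v)
    (φ : QState) : applyAt U i a v (applyAt V i a v φ) = applyAt (U * V) i a v φ := by
  refine linearMap_ext (A := applyAt U i a v ∘ₗ applyAt V i a v) (fun x => ?_) φ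
  rw [LinearMap.comp_apply, applyAt_ket, applyAt_ket, map_sum]
  simp only [map_smul, applyAt_ket, readRegs_writeRegs h, writeRegs_writeRegs, Finset.smul_sum,
    smul_smul]
  rw [Finset.sum_comm]
  refine Finset.sum_congr rfl fun y _ => ?_
  rw [← Finset.sum_smul, Matrix.UnitaryGroup.mul_val, Matrix.mul_apply]
  simp only [mul_comm]

theorem applyAt_one (i a v : ℕ) (φ : QState) :
    applyAt (1 : OracleUnitary ℓ w) i a v φ = φ := by
  refine linearMap_ext (B := LinearMap.id) (fun x => ?_) φ
  rw [applyAt_ket, Finset.sum_eq_single (readRegs ℓ w i a v x)]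
  · simp [writeRegs_readRegs]
  · intro y _ hy
    simp [Matrix.one_apply_ne hy]
  · simp

/-! ### Running a circuit -/

/-- The operator that a circuit performs. -/
noncomputable def run (U : OracleUnitary ℓ w) : Circuit → (QState →ₗ[ℂ] QState)
  | [] => LinearMap.id
  | g :: A => run U A ∘ₗ g.apply U

variable (U : OracleUnitary ℓ w)

@[simp] theorem run_nil (φ : QState) : run U [] φ = φ := rfl

@[simp] theorem run_cons (g : Gate) (A : Circuit) (φ : QState) :
    run U (g :: A) φ = run U A (g.apply U φ) := rfl

theorem run_append (A B : Circuit) (φ : QState) : run U (A ++ B) φ = run U B (run U A φ) := by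
  induction A generalizing φ with
  | nil => rfl
  | cons g A ih => simp [ih]

theorem finalState_eq_run (A : Circuit) : A.finalState U = run U A (ket zeroConfig) := by
  unfold Circuit.finalState
  change List.foldl _ (ket zeroConfig) A = _
  generalize ket zeroConfig = φ
  induction A generalizing φ with
  | nil => rfl
  | cons g A ih => simp [ih]

/-- The inverse of a gate other than the `T` gate. -/
def invGate : Gate → Gate
  | .oracle i a v => .oracleInv i a v
  | .oracleInv i a v => .oracle i a v
  | g => g

/-- The inverse of a circuit whose `T` gates come in consecutive quadruples. -/
def invCircuit (A : Circuit) : Circuit := A.reverse.map invGate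

theorem invGate_invGate (g : Gate) : invGate (invGate g) = g := by cases g <;> rfl

@[simp] theorem invCircuit_invCircuit (A : Circuit) : invCircuit (invCircuit A) = A := by
  simp [invCircuit, Function.comp_def, invGate_invGate]

theorem invCircuit_append (A B : Circuit) :
    invCircuit (A ++ B) = invCircuit B ++ invCircuit A := by
  simp [invCircuit]

@[simp] theorem length_invCircuit (A : Circuit) : (invCircuit A).length = A.length := by
  simp [invCircuit]

@[simp] theorem queries_invCircuit (A : Circuit) :
    (invCircuit A).countP Gate.isQuery = A.countP Gate.isQuery := by
  have : Gate.isQuery ∘ invGate = Gate.isQuery := by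
    ext g; cases g <;> rfl
  rw [invCircuit, List.countP_map, this, List.countP_reverse]

/-- `invCircuit A` performs the inverse and the adjoint of the operator that `A` performs. -/
structure Reversible (A : Circuit) : Prop where
  adj : ∀ φ ψ, ip (run U A φ) ψ = ip φ (run U (invCircuit A) ψ)
  left : ∀ φ, run U (invCircuit A) (run U A φ) = φ
  right : ∀ φ, run U A (run U (invCircuit A) φ) = φ

namespace Reversible

variable {U}

theorem nil : Reversible U [] := ⟨fun _ _ => rfl, fun _ => rfl, fun _ => rfl⟩

theorem append {A B : Circuit} (hA : Reversible U A) (hB : Reversible U B) :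
    Reversible U (A ++ B) where
  adj φ ψ := by rw [invCircuit_append, run_append, run_append, hB.adj, hA.adj]
  left φ := by rw [invCircuit_append, run_append, run_append, hB.left, hA.left]
  right φ := by rw [invCircuit_append, run_append, run_append, hA.right, hB.right]

theorem inv {A : Circuit} (hA : Reversible U A) : Reversible U (invCircuit A) where
  adj φ ψ := by
    rw [invCircuit_invCircuit, ← hA.left ψ, ← hA.adj, hA.right, hA.left]
  left φ := by rw [invCircuit_invCircuit, hA.right]
  right φ := by rw [invCircuit_invCircuit, hA.left]

/-- A circuit that is its own inverse. -/
theorem of_involutive {A : Circuit} (h : invCircuit A = A)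
    (hadj : ∀ x y, (starRingEnd ℂ) (run U A (ket x) y) = run U A (ket y) x)
    (hinv : ∀ x, run U A (run U A (ket x)) = ket x) : Reversible U A where
  adj φ ψ := by rw [h]; exact ip_adjoint hadj φ ψ
  left φ := by
    rw [h]; exact linearMap_ext (A := run U A ∘ₗ run U A) (B := LinearMap.id) hinv φ
  right φ := by
    rw [h]; exact linearMap_ext (A := run U A ∘ₗ run U A) (B := LinearMap.id) hinv φ

theorem of_involution {A : Circuit} (h : invCircuit A = A) {c : Config → Config}
    (hc : ∀ x, run U A (ket x) = ket (c x)) (hcc : ∀ x, c (c x) = x) : Reversible U A := by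
  classical
  refine of_involutive h (fun x y => ?_) fun x => by rw [hc, hc, hcc]
  rw [hc, hc, ket_apply, ket_apply]
  have : c x = y ↔ c y = x := ⟨fun e => by rw [← e, hcc], fun e => by rw [← e, hcc]⟩
  by_cases e : c x = y
  · simp [e, this.mp e]
  · simp [e, this.not.mp e]

theorem cnot {c t : ℕ} (h : c ≠ t) : Reversible U [.cnot c t] := by
  refine of_involution rfl (fun x => by rw [run_cons, run_nil, apply_cnot]) fun x => ?_
  ext q
  by_cases hq : q = t
  · subst hq; simp [h]
  · simp [hq]

theorem toffoli {c d t : ℕ} (h : c ≠ t) (h' : d ≠ t) : Reversible U [.toffoli c d t] := by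
  refine of_involution rfl (fun x => by rw [run_cons, run_nil, apply_toffoli]) fun x => ?_
  ext q
  by_cases hq : q = t
  · subst hq; simp [h, h']
  · simp [hq]

theorem oracle {i a v : ℕ} (h : OracleDisjoint ℓ w i a v) : Reversible U [.oracle i a v] where
  adj φ ψ := ip_applyAt U h φ ψ
  left φ := by
    change applyAt U⁻¹ i a v (applyAt U i a v φ) = φ
    rw [applyAt_mul _ _ h, inv_mul_cancel, applyAt_one]
  right φ := by
    change applyAt U i a v (applyAt U⁻¹ i a v φ) = φ
    rw [applyAt_mul _ _ h, mul_inv_cancel, applyAt_one]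

theorem wt_true {A : Circuit} (hA : Reversible U A) (φ : QState) :
    (wt (run U A φ) fun _ => True) = wt φ fun _ => True := by
  have : ((wt (run U A φ) fun _ => True : ℝ) : ℂ) = (wt φ fun _ => True : ℝ) := by
    rw [wt_true_eq_ip, wt_true_eq_ip, hA.adj, hA.left]
  exact_mod_cast this

end Reversible

theorem inv_sqrt_two_mul_self : ((1 / √2 : ℝ) : ℂ) * ((1 / √2 : ℝ) : ℂ) = 1 / 2 := by
  rw [← Complex.ofReal_mul, div_mul_div_comm, Real.mul_self_sqrt (by norm_num)]
  norm_num

theorem reversible_hadamard (q : ℕ) : Reversible U [.hadamard q] := by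
  classical
  refine Reversible.of_involutive rfl (fun x y => ?_) fun x => ?_
  · simp only [run_cons, run_nil, apply_hadamard, Finsupp.smul_apply, Finsupp.add_apply, ket_apply]
    by_cases h : ∀ r, r ≠ q → x r = y r
    · have e : ∀ b, Function.update x q b = y ↔ y q = b := fun b => by
        constructor
        · intro e; rw [← e]; simp
        · intro e; ext r; by_cases hr : r = q
          · subst hr; simp [e]
          · simp [hr, h r hr]
      have e' : ∀ b, Function.update y q b = x ↔ x q = b := fun b => by
        constructor
        · intro e; rw [← e]; simp
        · intro e; ext r; by_cases hr : r = q
          · subst hr; simp [e]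
          · simp [hr, h r hr]
      simp only [e, e']
      cases x q <;> cases y q <;> simp [Complex.conj_ofReal]
    · have e : ∀ b, Function.update x q b ≠ y := fun b e => h fun r hr => by rw [← e]; simp [hr]
      have e' : ∀ b, Function.update y q b ≠ x := fun b e => h fun r hr => by rw [← e]; simp [hr]
      simp [e, e']
  · simp only [run_cons, run_nil, apply_hadamard, map_smul, map_add, Function.update_idem,
      Function.update_self, smul_add, smul_smul, Bool.false_eq_true, if_true, if_false]
    have h2 := inv_sqrt_two_mul_self
    set c := ((1 / √2 : ℝ) : ℂ)
    cases hx : x q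
    · have e : Function.update x q false = x := by rw [← hx]; simp
      simp only [e, Bool.false_eq_true, if_false, mul_one, h2, mul_neg, neg_smul]
      module
    · have e : Function.update x q true = x := by rw [← hx]; simp
      simp only [e, if_true, mul_one, h2, mul_neg, neg_smul, neg_mul]
      module

/-- The `Z` gate. -/
def zBlock (q : ℕ) : Circuit := [.tgate q, .tgate q, .tgate q, .tgate q]

/-- The `X` gate. -/
def xBlock (q : ℕ) : Circuit := [.hadamard q] ++ zBlock q ++ [.hadamard q]

/-- Four eighth-turn phases multiply to exp(iπ) = -1. -/
theorem run_zBlock (q : ℕ) (x : Config) :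
    run U (zBlock q) (ket x) = (if x q then (-1 : ℂ) else 1) • ket x := by
  simp only [zBlock, run_cons, run_nil, apply_tgate, map_smul, smul_smul]
  cases x q
  · simp
  · simp only [if_true, ← Complex.exp_add]
    congr 1
    rw [← Complex.exp_pi_mul_I]
    congr 1; ring

theorem run_xBlock (q : ℕ) (x : Config) :
    run U (xBlock q) (ket x) = ket (Function.update x q (!x q)) := by
  have h2 := inv_sqrt_two_mul_self
  simp only [xBlock, run_append, run_cons, run_nil, apply_hadamard, map_smul, map_add, run_zBlock,
    Function.update_self, Bool.false_eq_true, if_true, if_false, Function.update_idem, smul_add,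
    smul_smul]
  set c := ((1 / √2 : ℝ) : ℂ)
  cases x q
  · simp only [Bool.false_eq_true, if_false, mul_one, h2, mul_neg, neg_smul, Bool.not_false]
    match_scalars
    · linear_combination -h2
    · linear_combination h2
  · simp only [if_true, mul_one, h2, mul_neg, neg_smul, Bool.not_true, neg_neg]
    module

theorem reversible_zBlock (q : ℕ) : Reversible U (zBlock q) := by
  classical
  refine Reversible.of_involutive rfl (fun x y => ?_) fun x => ?_
  · rw [run_zBlock, run_zBlock, Finsupp.smul_apply, Finsupp.smul_apply, ket_apply, ket_apply]
    by_cases h : x = y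
    · subst h; cases x q <;> simp
    · simp [h, Ne.symm h]
  · rw [run_zBlock, map_smul, run_zBlock, smul_smul]
    cases x q <;> simp

theorem reversible_xBlock (q : ℕ) : Reversible U (xBlock q) :=
  Reversible.of_involution rfl (run_xBlock U q) fun x => by simp

/-! ### Locality -/

/-- The qubits that a gate acts on. -/
def Touches (ℓ w : ℕ) : Gate → ℕ → Prop
  | .hadamard p, q => q = p
  | .tgate p, q => q = p
  | .cnot c t, q => q = c ∨ q = t
  | .toffoli c d t, q => q = c ∨ q = d ∨ q = t
  -- A crude value suffices here: the search circuits contain no QRAG gate.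
  | .qrag _ _ _ _, _ => True
  | .oracle i a v, q => (i ≤ q ∧ q < i + ℓ) ∨ q = a ∨ (v ≤ q ∧ q < v + w)
  | .oracleInv i a v, q => (i ≤ q ∧ q < i + ℓ) ∨ q = a ∨ (v ≤ q ∧ q < v + w)

/-- All gates of `A` act on qubits in `B`. -/
def LocalIn (ℓ w : ℕ) (B : ℕ → Prop) (A : Circuit) : Prop := ∀ g ∈ A, ∀ q, Touches ℓ w g q → B q

theorem LocalIn.append {B : ℕ → Prop} {A A' : Circuit} (h : LocalIn ℓ w B A)
    (h' : LocalIn ℓ w B A') : LocalIn ℓ w B (A ++ A') := by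
  intro g hg
  rcases List.mem_append.mp hg with hg | hg
  exacts [h g hg, h' g hg]

theorem LocalIn.mono {B B' : ℕ → Prop} {A : Circuit} (h : LocalIn ℓ w B A)
    (hB : ∀ q, B q → B' q) : LocalIn ℓ w B' A := fun g hg q hq => hB q (h g hg q hq)

theorem LocalIn.inv {B : ℕ → Prop} {A : Circuit} (h : LocalIn ℓ w B A) :
    LocalIn ℓ w B (invCircuit A) := by
  intro g hg q hq
  simp only [invCircuit, List.mem_map, List.mem_reverse] at hg
  obtain ⟨g', hg', rfl⟩ := hg
  exact h g' hg' q (by cases g' <;> exact hq)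

theorem update_cxor (x y : Config) {q : ℕ} (hq : x q = false) (b : Bool) :
    Function.update (cxor x y) q b = cxor x (Function.update y q b) := by
  ext r
  by_cases hr : r = q
  · subst hr; simp [hq]
  · simp [hr]

theorem readRegs_cxor {i a v : ℕ} {x : Config}
    (hx : ∀ q, Touches ℓ w (.oracle i a v) q → x q = false) (y : Config) :
    readRegs ℓ w i a v (cxor x y) = readRegs ℓ w i a v y := by
  have h1 : ∀ j : Fin ℓ, x (i + j) = false := fun j => hx _ (Or.inl ⟨by omega, by omega⟩)
  have h2 : x a = false := hx _ (Or.inr (Or.inl rfl))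
  have h3 : ∀ j : Fin w, x (v + j) = false := fun j => hx _ (Or.inr (Or.inr ⟨by omega, by omega⟩))
  simp [readRegs, h1, h2, h3]

theorem writeRegs_cxor {i a v : ℕ} {x : Config}
    (hx : ∀ q, Touches ℓ w (.oracle i a v) q → x q = false) (z : OracleBasis ℓ w) (y : Config) :
    writeRegs i a v z (cxor x y) = cxor x (writeRegs i a v z y) := by
  ext q
  simp only [writeRegs, cxor_apply]
  split_ifs with h1 h2 h3
  · rw [hx q (Or.inl (by omega))]; simp
  · rw [hx q (Or.inr (Or.inl h2))]; simp
  · rw [hx q (Or.inr (Or.inr (by omega)))]; simp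
  · rfl

theorem applyAt_translate {i a v : ℕ} {x : Config}
    (hx : ∀ q, Touches ℓ w (.oracle i a v) q → x q = false) (y : Config) :
    applyAt U i a v (ket (cxor x y)) = translate x (applyAt U i a v (ket y)) := by
  simp only [applyAt_ket, map_sum, map_smul, translate_ket, readRegs_cxor hx, writeRegs_cxor hx]

/-- The gate reads and writes only qubits on which x is 0, so adding x commutes with it.
Translations thereby play the role of tensoring with idle qubits. -/
theorem apply_translate (g : Gate) {x : Config} (hx : ∀ q, Touches ℓ w g q → x q = false)
    (y : Config) : g.apply U (ket (cxor x y)) = translate x (g.apply U (ket y)) := by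
  cases g with
  | hadamard q =>
    have := hx q rfl
    simp only [apply_hadamard, map_smul, map_add, translate_ket, update_cxor _ _ this, cxor_apply,
      this, Bool.false_xor]
  | tgate q =>
    have := hx q rfl
    simp only [apply_tgate, map_smul, translate_ket, cxor_apply, this, Bool.false_xor]
  | cnot c t =>
    have h1 := hx c (Or.inl rfl)
    have h2 := hx t (Or.inr rfl)
    simp only [apply_cnot, translate_ket, cxor_apply, update_cxor _ _ h2, h1, h2, Bool.false_xor]
  | toffoli c d t =>
    have h1 := hx c (Or.inl rfl)
    have h2 := hx d (Or.inr (Or.inl rfl))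
    have h3 := hx t (Or.inr (Or.inr rfl))
    simp only [apply_toffoli, translate_ket, cxor_apply, update_cxor _ _ h3, h1, h2, h3,
      Bool.false_xor]
  | qrag a l t m =>
    have : x = zeroConfig := funext fun q => hx q trivial
    subst this
    rw [zeroConfig_cxor]
    refine (linearMap_ext (A := translate zeroConfig) (B := LinearMap.id) (fun z => ?_) _).symm
    simp
  | oracle i a v => exact applyAt_translate U hx y
  | oracleInv i a v => exact applyAt_translate U⁻¹ hx y

/-- A circuit does not see the qubits outside the set that it acts on. -/
theorem run_translate {A : Circuit} {B : ℕ → Prop} (hA : LocalIn ℓ w B A) {x : Config}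
    (hx : ∀ q, B q → x q = false) (φ : QState) :
    run U A (translate x φ) = translate x (run U A φ) := by
  induction A generalizing φ with
  | nil => rfl
  | cons g A ih =>
    have hg : ∀ φ, g.apply U (translate x φ) = translate x (g.apply U φ) := fun φ =>
      linearMap_ext (A := g.apply U ∘ₗ translate x) (B := translate x ∘ₗ g.apply U) (fun y => by
        simp only [LinearMap.comp_apply, translate_ket]
        exact apply_translate U g (fun q hq => hx q (hA g (by simp) q hq)) y) φ
    rw [run_cons, hg, ih (fun g' hg' => hA g' (by simp [hg']))]
    rfl

theorem run_ket_eq_translate {A : Circuit} {B : ℕ → Prop} (hA : LocalIn ℓ w B A) {x : Config}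
    (hx : ∀ q, B q → x q = false) :
    run U A (ket x) = translate x (run U A (ket zeroConfig)) := by
  rw [← run_translate U hA hx, translate_ket, cxor_zeroConfig]

theorem suppIn_update {x : Config} {p q : ℕ} (hpq : q ≠ p) (b : Bool) :
    SuppIn (fun z => z q = x q) (ket (Function.update x p b)) :=
  SuppIn.ket (by simp [hpq])

theorem suppIn_applyAt {i a v q : ℕ} (hq : ¬ Touches ℓ w (.oracle i a v) q) (x : Config) :
    SuppIn (fun z => z q = x q) (applyAt U i a v (ket x)) := by
  rw [applyAt_ket]
  refine SuppIn.sum fun y _ => SuppIn.smul _ (SuppIn.ket ?_)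
  simp only [Touches, not_or] at hq
  simp only [writeRegs]
  rw [dif_neg (by omega), if_neg hq.2.1, dif_neg (by omega)]

theorem suppIn_apply (g : Gate) {q : ℕ} (hq : ¬ Touches ℓ w g q) (x : Config) :
    SuppIn (fun z => z q = x q) (g.apply U (ket x)) := by
  cases g with
  | hadamard p =>
    rw [apply_hadamard]
    exact SuppIn.smul _ ((suppIn_update hq _).add (SuppIn.smul _ (suppIn_update hq _)))
  | tgate p => rw [apply_tgate]; exact SuppIn.smul _ (SuppIn.ket rfl)
  | cnot c t =>
    rw [apply_cnot]; exact suppIn_update (fun h => hq (Or.inr h)) _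
  | toffoli c d t =>
    rw [apply_toffoli]; exact suppIn_update (fun h => hq (Or.inr (Or.inr h))) _
  | qrag a l t m => exact absurd trivial hq
  | oracle i a v => exact suppIn_applyAt U hq x
  | oracleInv i a v => exact suppIn_applyAt U⁻¹ hq x

/-- A circuit does not change the qubits outside the set that it acts on. -/
theorem suppIn_run {A : Circuit} {B : ℕ → Prop} (hA : LocalIn ℓ w B A) {q : ℕ} (hq : ¬ B q)
    {b : Bool} {φ : QState} (hφ : SuppIn (fun z => z q = b) φ) :
    SuppIn (fun z => z q = b) (run U A φ) := by
  induction A generalizing φ with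
  | nil => exact hφ
  | cons g A ih =>
    rw [run_cons]
    refine ih (fun g' hg' => hA g' (by simp [hg'])) (hφ.map fun x hx => ?_)
    rw [← hx]
    exact suppIn_apply U g (fun h => hq (hA g (by simp) q h)) x

theorem suppIn_run_ket {A : Circuit} {B : ℕ → Prop} (hA : LocalIn ℓ w B A) (x : Config) :
    SuppIn (fun z => ∀ q, ¬ B q → z q = x q) (run U A (ket x)) := fun z hz _ hq =>
  suppIn_run U hA hq (φ := ket x) (SuppIn.ket rfl) z hz

theorem suppIn_run_within {A : Circuit} {s t : ℕ} (hA : LocalIn ℓ w (fun q => s ≤ q ∧ q < t) A)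
    {φ : QState} (hφ : SuppIn (Within s t) φ) : SuppIn (Within s t) (run U A φ) := by
  refine hφ.map fun x hx z hz q hq => ?_
  rw [suppIn_run_ket U hA x z hz q (by omega), hx q hq]

end QSearch


/-! ### Circuit bookkeeping and reversible arithmetic -/

namespace QSearch

variable {ℓ w : ℕ} {U : OracleUnitary ℓ w}

/-! ### Well-formed reversible circuits on a set of qubits -/

/-- `A` is a well-formed and reversible circuit on the qubits in `B`. -/
structure CircuitOn (U : OracleUnitary ℓ w) (B : ℕ → Prop) (A : Circuit) : Prop where
  wf : A.WellFormed ℓ w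
  loc : LocalIn ℓ w B A
  rev : Reversible U A

namespace CircuitOn

variable {B B' : ℕ → Prop} {A A' : Circuit}

theorem nil : CircuitOn U B [] :=
  ⟨fun _ h => by simp at h, fun _ h => by simp at h, Reversible.nil⟩

theorem append (h : CircuitOn U B A) (h' : CircuitOn U B A') : CircuitOn U B (A ++ A') where
  wf g hg := by
    rcases List.mem_append.mp hg with hg | hg
    exacts [h.wf g hg, h'.wf g hg]
  loc := h.loc.append h'.loc
  rev := h.rev.append h'.rev

theorem mono (h : CircuitOn U B A) (hB : ∀ q, B q → B' q) : CircuitOn U B' A :=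
  ⟨h.wf, h.loc.mono hB, h.rev⟩

theorem inv (h : CircuitOn U B A) : CircuitOn U B (invCircuit A) where
  wf g hg := by
    simp only [invCircuit, List.mem_map, List.mem_reverse] at hg
    obtain ⟨g', hg', rfl⟩ := hg
    have := h.wf g' hg'
    cases g' <;> exact this
  loc := h.loc.inv
  rev := h.rev.inv

theorem hadamard {q : ℕ} (hq : B q) : CircuitOn U B [.hadamard q] where
  wf g hg := by simp only [List.mem_singleton] at hg; subst hg; trivial
  loc g hg p hp := by simp only [List.mem_singleton] at hg; subst hg; exact hp ▸ hq
  rev := reversible_hadamard U q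

theorem zBlock {q : ℕ} (hq : B q) : CircuitOn U B (zBlock q) where
  wf g hg := by
    simp only [QSearch.zBlock, List.mem_cons, List.not_mem_nil, or_false, or_self] at hg
    subst hg; trivial
  loc g hg p hp := by
    simp only [QSearch.zBlock, List.mem_cons, List.not_mem_nil, or_false, or_self] at hg
    subst hg; exact hp ▸ hq
  rev := reversible_zBlock U q

theorem xBlock {q : ℕ} (hq : B q) : CircuitOn U B (xBlock q) where
  wf := (((hadamard (U := U) hq).append (zBlock hq)).append (hadamard hq)).wf
  loc := (((hadamard (U := U) hq).append (zBlock hq)).append (hadamard hq)).loc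
  rev := reversible_xBlock U q

theorem cnot {c t : ℕ} (hc : B c) (ht : B t) (h : c ≠ t) : CircuitOn U B [.cnot c t] where
  wf g hg := by simp only [List.mem_singleton] at hg; subst hg; exact h
  loc g hg p hp := by
    simp only [List.mem_singleton] at hg; subst hg
    rcases hp with rfl | rfl
    exacts [hc, ht]
  rev := Reversible.cnot h

theorem toffoli {c d t : ℕ} (hc : B c) (hd : B d) (ht : B t) (h1 : c ≠ d) (h2 : c ≠ t)
    (h3 : d ≠ t) : CircuitOn U B [.toffoli c d t] where
  wf g hg := by simp only [List.mem_singleton] at hg; subst hg; exact ⟨h1, h2, h3⟩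
  loc g hg p hp := by
    simp only [List.mem_singleton] at hg; subst hg
    rcases hp with rfl | rfl | rfl
    exacts [hc, hd, ht]
  rev := Reversible.toffoli h2 h3

theorem oracle {i a v : ℕ} (h : OracleDisjoint ℓ w i a v)
    (hB : ∀ q, Touches ℓ w (.oracle i a v) q → B q) : CircuitOn U B [.oracle i a v] where
  wf g hg := by simp only [List.mem_singleton] at hg; subst hg; exact h
  loc g hg p hp := by simp only [List.mem_singleton] at hg; subst hg; exact hB p hp
  rev := Reversible.oracle h

end CircuitOn

/-! ### Classical reversible circuits -/

/-- On basis states, `A` performs the map `c`. -/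
def Computes (U : OracleUnitary ℓ w) (A : Circuit) (c : Config → Config) : Prop :=
  ∀ x, run U A (ket x) = ket (c x)

namespace Computes

theorem nil : Computes U [] id := fun _ => rfl

theorem append {A A' : Circuit} {c c' : Config → Config} (h : Computes U A c)
    (h' : Computes U A' c') : Computes U (A ++ A') fun x => c' (c x) := fun x => by
  rw [run_append, h, h']

theorem xBlock (q : ℕ) : Computes U (xBlock q) fun x => Function.update x q (!x q) :=
  run_xBlock U q

theorem cnot (c t : ℕ) : Computes U [.cnot c t] fun x => Function.update x t (xor (x t) (x c)) :=
  fun x => by rw [run_cons, run_nil, apply_cnot]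

theorem toffoli (c d t : ℕ) :
    Computes U [.toffoli c d t] fun x => Function.update x t (xor (x t) (x c && x d)) :=
  fun x => by rw [run_cons, run_nil, apply_toffoli]

theorem suppIn {A : Circuit} {c : Config → Config} (h : Computes U A c) {P Q : Config → Prop}
    {φ : QState} (hφ : SuppIn P φ) (hPQ : ∀ x, P x → Q (c x)) : SuppIn Q (run U A φ) :=
  hφ.map fun x hx => by rw [h x]; exact SuppIn.ket (hPQ x hx)

theorem injective {A : Circuit} {c : Config → Config} (h : Computes U A c)
    (hr : Reversible U A) : Function.Injective c := by
  intro x y e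
  have : ket x = ket y := by rw [← hr.left (ket x), ← hr.left (ket y), h, h, e]
  exact Finsupp.single_left_injective one_ne_zero this

/-- An injective relabelling of basis states leaves the amplitudes alone, so events are pulled back
along c. -/
theorem wt_run {A : Circuit} {c : Config → Config} (h : Computes U A c)
    (hr : Reversible U A) (φ : QState) (S : Config → Prop) :
    wt (run U A φ) S = wt φ fun x => S (c x) := by
  rw [← wt_mapDomain (h.injective hr)]
  congr 1
  exact linearMap_ext (B := Finsupp.lmapDomain ℂ ℂ c) (fun x => by rw [h x]; simp [ket]) φ

end Computes

/-! ### Registers -/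

theorem regValue_succ (x : Config) (s m : ℕ) :
    regValue x s (m + 1) = regValue x s m + if x (s + m) then 2 ^ m else 0 := by
  rw [regValue, Finset.sum_range_succ]; rfl

theorem regValue_lt (x : Config) (s m : ℕ) : regValue x s m < 2 ^ m := by
  induction m with
  | zero => simp [regValue]
  | succ m ih => rw [regValue_succ, pow_succ]; split_ifs <;> omega

theorem regValue_congr {x y : Config} {s t m : ℕ} (h : ∀ j < m, x (s + j) = y (t + j)) :
    regValue x s m = regValue y t m :=
  Finset.sum_congr rfl fun j hj => by rw [h j (Finset.mem_range.mp hj)]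

theorem testBit_regValue (x : Config) (s m j : ℕ) (hj : j < m) :
    (regValue x s m).testBit j = x (s + j) := by
  induction m with
  | zero => omega
  | succ m ih =>
    have hlt := regValue_lt x s m
    rw [regValue_succ]
    rcases Nat.lt_succ_iff_lt_or_eq.mp hj with h | rfl
    · split_ifs
      · rw [Nat.add_comm, Nat.testBit_two_pow_add_gt h, ih h]
      · rw [Nat.add_zero, ih h]
    · split_ifs with h
      · rw [Nat.add_comm, Nat.testBit_two_pow_add_eq, Nat.testBit_lt_two_pow hlt]
        simp [h]
      · rw [Nat.add_zero, Nat.testBit_lt_two_pow hlt]; simpa using h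

/-- Compares the number in the qubits `s, …, s + m - 1` with `k`; the result is written to the
qubit `b + m`. -/
def compareCircuit (k s b : ℕ) : ℕ → Circuit
  | 0 => []
  | m + 1 => compareCircuit k s b m ++
      if k.testBit m then
        xBlock (b + m) ++ ([.toffoli (s + m) (b + m) (b + m + 1)] ++
          (xBlock (b + m) ++ xBlock (b + m + 1)))
      else xBlock (s + m) ++ ([.toffoli (s + m) (b + m) (b + m + 1)] ++ xBlock (s + m))

theorem compareCircuit_on {k s b m : ℕ} (h : s + m ≤ b) :
    CircuitOn U (fun q => (s ≤ q ∧ q < s + m) ∨ (b ≤ q ∧ q ≤ b + m)) (compareCircuit k s b m) := by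
  induction m with
  | zero => exact CircuitOn.nil
  | succ m ih =>
    refine ((ih (by omega)).mono fun q hq => by omega).append ?_
    have ht : CircuitOn U (fun q => (s ≤ q ∧ q < s + (m + 1)) ∨ (b ≤ q ∧ q ≤ b + (m + 1)))
        [.toffoli (s + m) (b + m) (b + m + 1)] := by
      apply CircuitOn.toffoli <;> omega
    split_ifs
    · exact (CircuitOn.xBlock (by omega)).append
        (ht.append ((CircuitOn.xBlock (by omega)).append (CircuitOn.xBlock (by omega))))
    · exact (CircuitOn.xBlock (by omega)).append (ht.append (CircuitOn.xBlock (by omega)))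

/-- The top bits decide the comparison unless they are equal, and then the lower bits decide. The
two cases are written so that each is one Toffoli gate up to negations. -/
theorem regValue_lt_mod_succ (x : Config) (k s m : ℕ) :
    decide (regValue x s (m + 1) < k % 2 ^ (m + 1)) =
      if k.testBit m then !(x (s + m) && !decide (regValue x s m < k % 2 ^ m))
      else (!x (s + m) && decide (regValue x s m < k % 2 ^ m)) := by
  have h1 := regValue_lt x s m
  have h2 : k % 2 ^ m < 2 ^ m := Nat.mod_lt _ (by positivity)
  have h3 : k % 2 ^ (m + 1) = k % 2 ^ m + if k.testBit m then 2 ^ m else 0 := by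
    rw [Nat.mod_pow_succ, Nat.testBit_eq_decide_div_mod_eq]
    rcases Nat.mod_two_eq_zero_or_one (k / 2 ^ m) with h | h <;> simp [h]
  rw [regValue_succ, h3]
  cases x (s + m) <;> cases k.testBit m <;> simp <;> omega

theorem compareCircuit_computes {k s b m : ℕ} (h : s + m ≤ b) :
    ∃ c, Computes U (compareCircuit k s b m) c ∧ ∀ x, Clean b (b + m + 1) x →
      c x (b + m) = decide (regValue x s m < k % 2 ^ m) ∧
      ∀ q, q < b ∨ b + m < q → c x q = x q := by
  induction m with
  | zero =>
    -- Modulo 2^0 the bound is 0 and nothing lies below it, so a clean qubit already holds the right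
    -- answer.
    refine ⟨id, Computes.nil, fun x hx => ⟨?_, fun q _ => rfl⟩⟩
    rw [id, hx _ (by omega) (by omega)]
    simp [Nat.mod_one]
  | succ m ih =>
    obtain ⟨c, hc, hcx⟩ := ih (by omega)
    by_cases hk : k.testBit m
    -- The update of qubit b + m by its own value is redundant; it reflects that this qubit is
    -- flipped twice.
    · refine ⟨fun x => Function.update (Function.update (c x) (b + m) (c x (b + m))) (b + m + 1)
        (!xor (c x (b + m + 1)) (c x (s + m) && !c x (b + m))), ?_, ?_⟩
      · rw [compareCircuit, if_pos hk]
        refine fun x => (((hc.append ((Computes.xBlock _).append ((Computes.toffoli _ _ _).append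
          ((Computes.xBlock _).append (Computes.xBlock _))))) x).trans ?_)
        congr 1
        have e1 : s + m ≠ b + m := by omega
        have e2 : s + m ≠ b + m + 1 := by omega
        have e3 : b + m ≠ b + m + 1 := by omega
        generalize c x = y, b + m + 1 = k at *
        generalize s + m = i, b + m = j at *
        ext q
        simp only [Function.update_self, Function.update_of_ne e1, Function.update_of_ne e3,
          Function.update_of_ne e3.symm, Bool.not_not]
        simp only [Function.update_apply]
        split_ifs <;> simp_all
      · intro x hx
        obtain ⟨h1, h2⟩ := hcx x fun q hq hq' => hx q hq (by omega)
        have h3 : c x (b + m + 1) = false := by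
          rw [h2 _ (by omega)]; exact hx _ (by omega) (by omega)
        have h4 : c x (s + m) = x (s + m) := h2 _ (by omega)
        constructor
        · dsimp only
          rw [regValue_lt_mod_succ, if_pos hk, ← h1, ← h4, ← add_assoc, Function.update_self, h3,
            Bool.false_xor]
        · intro q hq
          have e1 : q ≠ b + m := by omega
          have e2 : q ≠ b + m + 1 := by omega
          simp only [Function.update_of_ne e1, Function.update_of_ne e2]
          exact h2 q (by omega)
    · refine ⟨fun x => Function.update (Function.update (c x) (b + m + 1)
        (xor (c x (b + m + 1)) (!c x (s + m) && c x (b + m)))) (s + m) (c x (s + m)), ?_, ?_⟩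
      · rw [compareCircuit, if_neg hk]
        refine fun x => (((hc.append ((Computes.xBlock _).append ((Computes.toffoli _ _ _).append
          (Computes.xBlock _)))) x).trans ?_)
        congr 1
        have e1 : s + m ≠ b + m := by omega
        have e2 : s + m ≠ b + m + 1 := by omega
        have e3 : b + m ≠ b + m + 1 := by omega
        generalize c x = y, b + m + 1 = k at *
        generalize s + m = i, b + m = j at *
        ext q
        simp only [Function.update_self, Function.update_of_ne e2, Function.update_of_ne e1.symm,
          Function.update_of_ne e2.symm, Bool.not_not]
        simp only [Function.update_apply]
        split_ifs <;> simp_all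
      · intro x hx
        obtain ⟨h1, h2⟩ := hcx x fun q hq hq' => hx q hq (by omega)
        have h3 : c x (b + m + 1) = false := by
          rw [h2 _ (by omega)]; exact hx _ (by omega) (by omega)
        have h4 : c x (s + m) = x (s + m) := h2 _ (by omega)
        constructor
        · have e2 : b + m + 1 ≠ s + m := by omega
          dsimp only
          rw [regValue_lt_mod_succ, if_neg hk, ← h1, ← h4, ← add_assoc, Function.update_of_ne e2,
            Function.update_self, h3, Bool.false_xor]
        · intro q hq
          have e2 : q ≠ b + m + 1 := by omega
          by_cases e1 : q = s + m
          · rw [e1]; simp [h4]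
          · simp only [Function.update_of_ne e1, Function.update_of_ne e2]
            exact h2 q (by omega)

/-- Adds the `m` qubits from `src` on to those from `dst` on, if the qubit `c` is `1`. -/
def copyCircuit (c src dst : ℕ) : ℕ → Circuit
  | 0 => []
  | m + 1 => copyCircuit c src dst m ++ [.toffoli c (src + m) (dst + m)]

theorem copyCircuit_on {B : ℕ → Prop} {c src dst m : ℕ} (hc : B c) (hs : ∀ j < m, B (src + j))
    (hd : ∀ j < m, B (dst + j)) (h1 : c < src ∨ src + m ≤ c) (h2 : c < dst ∨ dst + m ≤ c)
    (h3 : src + m ≤ dst ∨ dst + m ≤ src) : CircuitOn U B (copyCircuit c src dst m) := by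
  induction m with
  | zero => exact CircuitOn.nil
  | succ m ih =>
    refine (ih (fun j hj => hs j (by omega)) (fun j hj => hd j (by omega)) (by omega) (by omega)
      (by omega)).append ?_
    exact CircuitOn.toffoli hc (hs m (by omega)) (hd m (by omega)) (by omega) (by omega) (by omega)

theorem copyCircuit_computes {c src dst m : ℕ} (h2 : c < dst ∨ dst + m ≤ c)
    (h3 : src + m ≤ dst ∨ dst + m ≤ src) :
    ∃ f, Computes U (copyCircuit c src dst m) f ∧ ∀ x,
      (∀ j < m, f x (dst + j) = xor (x (dst + j)) (x c && x (src + j))) ∧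
      ∀ q, q < dst ∨ dst + m ≤ q → f x q = x q := by
  induction m with
  | zero => exact ⟨id, Computes.nil, fun x => ⟨fun j hj => by omega, fun _ _ => rfl⟩⟩
  | succ m ih =>
    obtain ⟨f, hf, hfx⟩ := ih (by omega) (by omega)
    refine ⟨_, hf.append (Computes.toffoli c (src + m) (dst + m)), fun x => ⟨fun j hj => ?_,
      fun q hq => ?_⟩⟩
    · obtain ⟨e1, e2⟩ := hfx x
      rcases Nat.lt_succ_iff_lt_or_eq.mp hj with hj' | rfl
      · rw [Function.update_of_ne (by omega), e1 j hj']
      · rw [Function.update_self, e2 (dst + j) (by omega), e2 c (by omega), e2 (src + j) (by omega)]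
    · rw [Function.update_of_ne (by omega)]
      exact (hfx x).2 q (by omega)

end QSearch


/-! ### Randomized tests built from the oracle -/

namespace QSearch

variable {ℓ w : ℕ} {U : OracleUnitary ℓ w}

/-! ### Gadgets: randomized tests of an index -/

/-- `A` is a test on the fresh block `s, …, t - 1` of the index (below `n`) in the register at `idx`.
It leaves the index alone, and the qubit `ans` is `1` with probability `q i` for the index `i`. -/
structure IsGadget (U : OracleUnitary ℓ w) (n idx s : ℕ) (A : Circuit) (ans t : ℕ) (q : ℕ → ℝ) :
    Prop where
  idx_le : idx + ℓ ≤ s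
  le_ans : s ≤ ans
  ans_lt : ans < t
  on : CircuitOn U (fun p => (idx ≤ p ∧ p < idx + ℓ) ∨ (s ≤ p ∧ p < t)) A
  spec : ∀ i < n, ∃ γ : QState, SuppIn (Within s t) γ ∧ (wt γ fun _ => True) = 1 ∧
    (wt γ fun x => x ans = true) = q i ∧
    ∀ x, Clean s t x → regValue x idx ℓ = i → run U A (ket x) = translate x γ

theorem regValue_cxor_of_within {x z : Config} {s t idx m : ℕ} (hz : Within s t z)
    (h : idx + m ≤ s) : regValue (cxor x z) idx m = regValue x idx m :=
  regValue_congr fun j hj => by simp [hz (idx + j) (Or.inl (by omega))]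

theorem Clean.mono {s t s' t' : ℕ} {x : Config} (h : Clean s t x) (hs : s ≤ s') (ht : t' ≤ t) :
    Clean s' t' x := fun q h1 h2 => h q (by omega) (by omega)

theorem Within.mono {s t s' t' : ℕ} {x : Config} (h : Within s t x) (hs : s' ≤ s) (ht : t ≤ t') :
    Within s' t' x := fun q hq => h q (by omega)

theorem Within.clean {s t s' t' : ℕ} {x : Config} (h : Within s t x) (hd : t ≤ s' ∨ t' ≤ s) :
    Clean s' t' x := fun q h1 h2 => h q (by omega)

theorem Within.cxor {s t : ℕ} {x y : Config} (hx : Within s t x) (hy : Within s t y) :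
    Within s t (cxor x y) := fun q hq => by simp [hx q hq, hy q hq]

theorem Clean.cxor {s t : ℕ} {x y : Config} (hx : Clean s t x) (hy : Clean s t y) :
    Clean s t (cxor x y) := fun q h1 h2 => by simp [hx q h1 h2, hy q h1 h2]

theorem within_zeroConfig {s t : ℕ} : Within s t zeroConfig := fun _ _ => rfl

/-- The tensor product of vectors on two blocks. -/
noncomputable def tensor (γ δ : QState) : QState := ∑ x ∈ γ.support, γ x • translate x δ

theorem wt_tensor {s t s' t' : ℕ} {γ δ : QState} (hγ : SuppIn (Within s t) γ)
    (hδ : SuppIn (Within s' t') δ) (hd : t ≤ s' ∨ t' ≤ s) (S : Config → Prop) :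
    wt (tensor γ δ) S = ∑ x ∈ γ.support, ‖γ x‖ ^ 2 * wt δ fun z => S (cxor x z) :=
  wt_branch (s := s') (t := t') (hγ.mono fun _ h => h.clean hd) (γ := fun _ => δ)
    (fun _ _ => hδ) S

open Classical in
/-- Weights of events in the two blocks multiply. -/
theorem wt_tensor_and {s t s' t' : ℕ} {γ δ : QState} (hγ : SuppIn (Within s t) γ)
    (hδ : SuppIn (Within s' t') δ) (hd : t ≤ s' ∨ t' ≤ s) {S T T' : Config → Prop}
    (h : ∀ x z, Within s t x → Within s' t' z → (S (cxor x z) ↔ T x ∧ T' z)) :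
    wt (tensor γ δ) S = wt γ T * wt δ T' := by
  rw [wt_tensor hγ hδ hd, ← sum_norm_sq_eq_wt γ T, Finset.sum_mul]
  refine Finset.sum_congr rfl fun x hx => ?_
  have hx := hγ x (Finsupp.mem_support_iff.mp hx)
  by_cases hT : T x
  · rw [if_pos hT, wt_congr (T := T')]
    intro z hz
    simp [h x z hx (hδ z hz), hT]
  · rw [if_neg hT, zero_mul, wt_eq_zero, mul_zero]
    intro z hz
    simp [h x z hx (hδ z hz), hT]

theorem SuppIn.tensor {P Q R : Config → Prop} {γ δ : QState} (hγ : SuppIn P γ)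
    (hδ : SuppIn Q δ) (h : ∀ x z, P x → Q z → R (QSearch.cxor x z)) : SuppIn R (tensor γ δ) :=
  SuppIn.sum fun x hx => SuppIn.smul _ (hδ.translate fun z hz =>
    h x z (hγ x (Finsupp.mem_support_iff.mp hx)) hz)

theorem suppIn_tensor {s t : ℕ} {γ δ : QState} (hγ : SuppIn (Within s t) γ)
    (hδ : SuppIn (Within s t) δ) : SuppIn (Within s t) (tensor γ δ) :=
  hγ.tensor hδ fun _ _ hx hz => hx.cxor hz

theorem translate_tensor (x : Config) (γ δ : QState) : translate x (tensor γ δ) =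
    ∑ z ∈ γ.support, γ z • translate (cxor x z) δ := by
  simp only [tensor, map_sum, map_smul, translate_translate]

/-- The conjunction of two tests, or its negation. -/
def nodeCircuit (neg : Bool) (a₁ a₂ t : ℕ) : Circuit :=
  (if neg then xBlock t else []) ++ [.toffoli a₁ a₂ t]

theorem nodeCircuit_on {B : ℕ → Prop} {neg : Bool} {a₁ a₂ t : ℕ} (h₁ : B a₁) (h₂ : B a₂) (ht : B t)
    (h : a₁ < a₂) (h' : a₂ < t) : CircuitOn U B (nodeCircuit neg a₁ a₂ t) := by
  refine CircuitOn.append ?_ (CircuitOn.toffoli h₁ h₂ ht (by omega) (by omega) (by omega))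
  split_ifs
  exacts [CircuitOn.xBlock ht, CircuitOn.nil]

theorem nodeCircuit_computes {neg : Bool} {a₁ a₂ t : ℕ} (h₁ : a₁ ≠ t) (h₂ : a₂ ≠ t) :
    Computes U (nodeCircuit neg a₁ a₂ t) fun x =>
      Function.update x t (xor (xor (x t) neg) (x a₁ && x a₂)) := by
  intro x
  cases neg
  · exact (Computes.nil.append (Computes.toffoli a₁ a₂ t) x).trans (by simp)
  · exact ((Computes.xBlock t).append (Computes.toffoli a₁ a₂ t) x).trans (by simp [h₁, h₂])

/-- The two tests share the index register, which neither changes, but use disjoint blocks. For a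
fixed index the joint state is therefore a tensor product and the answers are independent, so
nothing needs to be uncomputed. -/
theorem IsGadget.node {n idx s ans₁ t₁ ans₂ t₂ : ℕ} {A₁ A₂ : Circuit} {q₁ q₂ : ℕ → ℝ}
    (h₁ : IsGadget U n idx s A₁ ans₁ t₁ q₁) (h₂ : IsGadget U n idx t₁ A₂ ans₂ t₂ q₂) (neg : Bool) :
    IsGadget U n idx s (A₁ ++ (A₂ ++ nodeCircuit neg ans₁ ans₂ t₂)) t₂ (t₂ + 1)
      fun i => if neg then 1 - q₁ i * q₂ i else q₁ i * q₂ i := by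
  have o1 := h₁.idx_le; have o2 := h₁.le_ans; have o3 := h₁.ans_lt
  have o4 := h₂.le_ans; have o5 := h₂.ans_lt
  have hD : ∀ B : ℕ → Prop, (∀ p, s ≤ p → p < t₂ + 1 → B p) →
      CircuitOn U B (nodeCircuit neg ans₁ ans₂ t₂) := fun B hB =>
    nodeCircuit_on (hB _ (by omega) (by omega)) (hB _ (by omega) (by omega))
      (hB _ (by omega) (by omega)) (by omega) (by omega)
  refine ⟨o1, by omega, by omega, ?_, fun i hi => ?_⟩
  · exact (h₁.on.mono fun p hp => by omega).append ((h₂.on.mono fun p hp => by omega).append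
      (hD _ fun p h h' => Or.inr ⟨h, h'⟩))
  obtain ⟨γ, hγ, hγ1, hγq, hγx⟩ := h₁.spec i hi
  obtain ⟨δ, hδ, hδ1, hδq, hδx⟩ := h₂.spec i hi
  have hT : SuppIn (Within s t₂) (tensor γ δ) :=
    suppIn_tensor (hγ.mono fun _ h => h.mono (by omega) (by omega))
      (hδ.mono fun _ h => h.mono (by omega) (by omega))
  have hDs := hD (fun p => s ≤ p ∧ p < t₂ + 1) fun p h h' => ⟨h, h'⟩
  have htot : (wt (tensor γ δ) fun _ => True) = 1 := by
    rw [wt_tensor_and hγ hδ (by omega) (T := fun _ => True) (T' := fun _ => True)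
      fun _ _ _ _ => by simp, hγ1, hδ1, one_mul]
  have hand : (wt (tensor γ δ) fun x => (x ans₁ && x ans₂) = true) = q₁ i * q₂ i := by
    rw [wt_tensor_and hγ hδ (by omega) (T := fun x => x ans₁ = true) (T' := fun x => x ans₂ = true),
      hγq, hδq]
    intro x z hx hz
    simp [hx ans₂ (by omega), hz ans₁ (by omega)]
  have hcomp : Computes U (nodeCircuit neg ans₁ ans₂ t₂) _ :=
    nodeCircuit_computes (by omega) (by omega)
  refine ⟨run U (nodeCircuit neg ans₁ ans₂ t₂) (tensor γ δ), ?_, ?_, ?_, ?_⟩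
  · exact suppIn_run_within U hDs.loc (hT.mono fun _ h => h.mono le_rfl (by omega))
  · rw [hDs.rev.wt_true, htot]
  · rw [hcomp.wt_run hDs.rev]
    cases neg
    · rw [if_neg (by simp), ← hand]
      refine wt_congr fun x hx => ?_
      simp [hT x hx t₂ (by omega)]
    · rw [if_pos rfl, ← hand, ← htot, ← wt_add_wt_not _ fun x => (x ans₁ && x ans₂) = true,
        add_sub_cancel_left]
      refine wt_congr fun x hx => ?_
      cases h : x ans₁ <;> simp [hT x hx t₂ (by omega)]
  · intro x hx hxi
    rw [run_append, run_append, hγx x (hx.mono le_rfl (by omega)) hxi,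
      map_eq_sum (translate x) γ, map_sum]
    have : ∀ z ∈ γ.support, run U A₂ (γ z • translate x (ket z)) =
        γ z • translate (cxor x z) δ := by
      intro z hz
      have hz := hγ z (Finsupp.mem_support_iff.mp hz)
      rw [map_smul, translate_ket, hδx]
      · exact (hx.mono (by omega) (by omega)).cxor (hz.clean (by omega))
      · rw [regValue_cxor_of_within hz o1, hxi]
    rw [Finset.sum_congr rfl this, ← translate_tensor]
    exact run_translate U hDs.loc (fun q hq => hx q hq.1 hq.2) _

/-! ### The oracle as a gadget -/

theorem writeRegs_apply_ans {i a v : ℕ} (h : OracleDisjoint ℓ w i a v) (y : OracleBasis ℓ w)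
    (x : Config) : writeRegs i a v y x a = y.2.1 :=
  congrArg (fun z => z.2.1) (readRegs_writeRegs h y x)

open Classical in
theorem wt_applyAt_ket (U : OracleUnitary ℓ w) {i a v : ℕ} (h : OracleDisjoint ℓ w i a v)
    (x : Config) (S : Config → Prop) : wt (applyAt U i a v (ket x)) S =
      ∑ y : OracleBasis ℓ w, ‖(U : Matrix (OracleBasis ℓ w) (OracleBasis ℓ w) ℂ) y
        (readRegs ℓ w i a v x)‖ ^ 2 * if S (writeRegs i a v y x) then 1 else 0 := by
  rw [applyAt_ket, wt_sum_of_disjoint]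
  · exact Finset.sum_congr rfl fun y _ => by rw [wt_smul, wt_ket]
  · intro y _ y' _ hne z hz hz'
    have e1 : writeRegs i a v y x = z := by
      by_contra e; exact hz (by simp [ket_apply, e])
    have e2 : writeRegs i a v y' x = z := by
      by_contra e; exact hz' (by simp [ket_apply, e])
    exact hne (by rw [← readRegs_writeRegs h y x, ← readRegs_writeRegs h y' x, e1, e2])

/-- The probability of `f(i) = 1`, for a natural number `i`. -/
noncomputable def Instance.prob {n : ℕ} (P : Instance n) (i : ℕ) : ℝ :=
  if h : i < n then P.p ⟨i, h⟩ else 0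

theorem Instance.p_le_one {n : ℕ} (P : Instance n) (i : Fin n) : P.p i ≤ 1 :=
  ENNReal.toReal_le_of_le_ofReal zero_le_one (by simpa using (P.f i).coe_le_one true)

theorem Instance.p_nonneg {n : ℕ} (P : Instance n) (i : Fin n) : 0 ≤ P.p i :=
  ENNReal.toReal_nonneg

theorem Instance.prob_nonneg {n : ℕ} (P : Instance n) (i : ℕ) : 0 ≤ P.prob i := by
  unfold Instance.prob; split_ifs
  exacts [P.p_nonneg _, le_rfl]

theorem Instance.prob_le_one {n : ℕ} (P : Instance n) (i : ℕ) : P.prob i ≤ 1 := by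
  unfold Instance.prob; split_ifs
  exacts [P.p_le_one _, zero_le_one]

theorem lt_two_pow_indexBits {n i : ℕ} (h : i < n) : i < 2 ^ Instance.indexBits n :=
  h.trans_le (Nat.le_pow_clog one_lt_two n)

/-- The defining property of the oracle at the basis state of i with clean answer and workspace
gives the vector γ; the moduli of ψ₁ sum to 1, so the answer has weight p. -/
theorem isGadget_oracle {n : ℕ} (P : Instance n) {U : OracleUnitary (Instance.indexBits n) w}
    (hU : P.IsOracle U) {idx s : ℕ} (hidx : idx + Instance.indexBits n ≤ s) :
    IsGadget U n idx s [.oracle idx (s + w) s] (s + w) (s + w + 1) P.prob := by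
  classical
  have hd : OracleDisjoint (Instance.indexBits n) w idx (s + w) s :=
    ⟨fun j hj => by omega, fun k hk => by omega, fun j hj k hk => by omega⟩
  have hon : CircuitOn U (fun p => (idx ≤ p ∧ p < idx + Instance.indexBits n) ∨
      (s ≤ p ∧ p < s + w + 1)) [.oracle idx (s + w) s] :=
    CircuitOn.oracle hd fun q hq => by
      rcases hq with h | h | h
      exacts [Or.inl h, Or.inr (by omega), Or.inr (by omega)]
  refine ⟨hidx, by omega, by omega, hon, fun i hi => ?_⟩
  -- The basis state holding i in the index register and 0 elsewhere. Translating the image of e by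
  -- e erases the index and leaves a vector of the fresh block alone.
  set e : Config := fun q => if idx ≤ q ∧ q < idx + Instance.indexBits n then i.testBit (q - idx)
    else false with he
  have hi2 := lt_two_pow_indexBits hi
  obtain ⟨ψ₁, ψ₀, h1, h0, hψ⟩ := hU ⟨i, hi⟩
  have hread : readRegs (Instance.indexBits n) w idx (s + w) s e =
      (Instance.enc ⟨i, hi⟩, false, fun _ => false) := by
    simp only [readRegs, he, Prod.mk.injEq]
    refine ⟨funext fun j => ?_, if_neg (by omega), funext fun k => if_neg (by omega)⟩
    rw [if_pos (by omega), Nat.add_sub_cancel_left]; rfl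
  have hwt : ∀ S : Config → Prop, wt (applyAt U idx (s + w) s (ket e)) S =
      ∑ b : Bool, ∑ z : Fin w → Bool, (if b then P.prob i * ‖ψ₁ z‖ ^ 2 else
        (1 - P.prob i) * ‖ψ₀ z‖ ^ 2) *
        if S (writeRegs idx (s + w) s (Instance.enc ⟨i, hi⟩, b, z) e) then 1 else 0 := by
    intro S
    rw [wt_applyAt_ket U hd, hread, Fintype.sum_prod_type, Finset.sum_eq_single
      (Instance.enc ⟨i, hi⟩), Fintype.sum_prod_type]
    · refine Finset.sum_congr rfl fun b _ => Finset.sum_congr rfl fun z _ => ?_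
      have hp : P.prob i = P.p ⟨i, hi⟩ := dif_pos hi
      rw [hψ, if_pos rfl, hp]
      congr 1
      cases b
      · simp only [Bool.false_eq_true, if_false, norm_mul, Complex.norm_real, mul_pow,
          Real.norm_eq_abs, sq_abs]
        rw [Real.sq_sqrt (sub_nonneg.mpr (P.p_le_one _))]
      · simp only [if_true, norm_mul, Complex.norm_real, mul_pow, Real.norm_eq_abs, sq_abs]
        rw [Real.sq_sqrt (P.p_nonneg _)]
    · intro j _ hj
      refine Finset.sum_eq_zero fun y _ => ?_
      obtain ⟨b, z⟩ := y
      rw [hψ, if_neg hj]; simp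
    · simp
  -- Only outcomes with the same index i have nonzero amplitude, so adding e clears the index
  -- register.
  have hsupp : SuppIn (fun x => Within s (s + w + 1) (cxor e x))
      (applyAt U idx (s + w) s (ket e)) := by
    intro x hx q hq
    have hloc := suppIn_run_ket U hon.loc e x hx
    by_cases hq' : idx ≤ q ∧ q < idx + Instance.indexBits n
    · have hreg : readRegs (Instance.indexBits n) w idx (s + w) s x =
          (Instance.enc ⟨i, hi⟩, (readRegs (Instance.indexBits n) w idx (s + w) s x).2) := by
        by_contra hne
        refine hx ?_
        rw [applyAt_ket_apply U hd]
        split_ifs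
        · rw [hread]
          rcases hr : readRegs (Instance.indexBits n) w idx (s + w) s x with ⟨j, b, z⟩
          rw [hr] at hne
          rw [hψ, if_neg]
          rintro rfl
          exact hne rfl
        · rfl
      have := congrFun (congrArg Prod.fst hreg) ⟨q - idx, by omega⟩
      simp only [readRegs, Instance.enc] at this
      rw [show idx + (q - idx) = q by omega] at this
      simp [he, hq', this]
    · have : x q = e q := hloc q (by omega)
      simp [this]
  refine ⟨translate e (applyAt U idx (s + w) s (ket e)), hsupp.translate fun y hy => hy, ?_, ?_, ?_⟩
  · rw [wt_translate, hwt]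
    simp only [if_true, mul_one, Fintype.sum_bool, Bool.false_eq_true, if_false]
    rw [← Finset.mul_sum, ← Finset.mul_sum, h1, h0]; ring
  · rw [wt_translate, hwt]
    have hea : e (s + w) = false := if_neg (by omega)
    simp only [cxor_apply, hea, Bool.false_xor, writeRegs_apply_ans hd, Fintype.sum_bool, if_true,
      mul_one, Bool.false_eq_true, if_false, mul_zero, Finset.sum_const_zero, add_zero]
    rw [← Finset.mul_sum, h1, mul_one]
  · intro x hx hxi
    -- Write x as the sum of e and x ⊕ e. The latter vanishes on all registers of the oracle, so the
    -- call passes through the translation by it.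
    rw [translate_translate]
    have hz : ∀ q, Touches (Instance.indexBits n) w (.oracle idx (s + w) s) q →
        cxor x e q = false := by
      intro q hq
      by_cases hq' : idx ≤ q ∧ q < idx + Instance.indexBits n
      · have := testBit_regValue x idx (Instance.indexBits n) (q - idx) (by omega)
        rw [hxi, show idx + (q - idx) = q by omega] at this
        simp [he, hq', this]
      · rcases hq with h | h | h
        · exact absurd h hq'
        · simp [he, hq', hx q (by omega) (by omega)]
        · simp [he, hq', hx q (by omega) (by omega)]
    have := apply_translate U (.oracle idx (s + w) s) hz e
    rw [cxor_assoc] at this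
    have hee : cxor e e = zeroConfig := by ext q; simp
    rw [hee, cxor_zeroConfig] at this
    exact this

/-! ### Trees of tests -/

/-- The answer qubit of a tree of depth `k` on a block from `s` on is `s + treeSize w k`. -/
def treeSize (w : ℕ) : ℕ → ℕ
  | 0 => w
  | k + 1 => 2 * (treeSize w k + 1)

/-- A complete binary tree of depth `k` whose leaves are applications of the oracle and whose inner
nodes are NAND gates, except for AND gates at the bottom when `c` is false. -/
def treeCircuit (c : Bool) (w idx : ℕ) : ℕ → ℕ → Circuit
  | 0, s => [.oracle idx (s + w) s]
  | k + 1, s => treeCircuit c w idx k s ++ (treeCircuit c w idx k (s + treeSize w k + 1) ++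
      nodeCircuit (c || k != 0) (s + treeSize w k) (s + treeSize w k + 1 + treeSize w k)
        (s + treeSize w (k + 1)))

/-- The acceptance probability of `treeCircuit` when the leaves accept with probability `p`. -/
noncomputable def treeProb (c : Bool) (p : ℝ) : ℕ → ℝ
  | 0 => p
  | k + 1 => if c || k != 0 then 1 - treeProb c p k * treeProb c p k
      else treeProb c p k * treeProb c p k

/-- Each of the two subtrees has its own block, so `IsGadget.node` applies at every inner node. -/
theorem isGadget_tree {n : ℕ} (P : Instance n) {U : OracleUnitary (Instance.indexBits n) w}
    (hU : P.IsOracle U) (c : Bool) (k : ℕ) {idx s : ℕ} (hidx : idx + Instance.indexBits n ≤ s) :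
    IsGadget U n idx s (treeCircuit c w idx k s) (s + treeSize w k) (s + treeSize w k + 1)
      fun i => treeProb c (P.prob i) k := by
  induction k generalizing s with
  | zero => exact isGadget_oracle P hU hidx
  | succ k ih =>
    have := (ih hidx).node (ih (s := s + treeSize w k + 1) (by omega)) (c || k != 0)
    have e : s + treeSize w k + 1 + treeSize w k + 1 = s + treeSize w (k + 1) := by
      simp only [treeSize]; ring
    rw [e] at this
    exact this

end QSearch


/-! ### Search procedures and their alternatives -/

namespace QSearch

variable {ℓ w : ℕ} {U : OracleUnitary ℓ w}

/-! ### Search procedures -/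

/-- A search procedure: a circuit, the position of the register with the index found, the position
of the flag that tells whether an index has been found, and the first unused qubit. -/
abbrev Proc := Circuit × ℕ × ℕ × ℕ

namespace Proc

/-- The circuit of a search procedure. -/
abbrev code (p : Proc) : Circuit := p.1

/-- The position of the index register. -/
abbrev idx (p : Proc) : ℕ := p.2.1

/-- The position of the flag. -/
abbrev flag (p : Proc) : ℕ := p.2.2.1

/-- The first unused qubit. -/
abbrev top (p : Proc) : ℕ := p.2.2.2

end Proc

/-- The final state of a search procedure. -/
noncomputable def Proc.state (U : OracleUnitary ℓ w) (p : Proc) : QState :=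
  run U p.code (ket zeroConfig)

/-- On the fresh block from `s` on, the procedure `p` finds `i < n` with probability `W i`. -/
structure IsProc (U : OracleUnitary ℓ w) (n s : ℕ) (p : Proc) (W : ℕ → ℝ) : Prop where
  le_flag : s ≤ p.flag
  flag_lt : p.flag < p.top
  le_idx : s ≤ p.idx
  idx_le : p.idx + ℓ ≤ p.top
  flag_idx : p.flag < p.idx ∨ p.idx + ℓ ≤ p.flag
  on : CircuitOn U (fun q => s ≤ q ∧ q < p.top) p.code
  valid : SuppIn (fun x => x p.flag = true → regValue x p.idx ℓ < n) (p.state U)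
  weight : ∀ i < n, (wt (p.state U) fun x => x p.flag = true ∧ regValue x p.idx ℓ = i) = W i

namespace IsProc

variable {n s : ℕ} {p : Proc} {W : ℕ → ℝ}

theorem suppIn (h : IsProc U n s p W) : SuppIn (Within s p.top) (p.state U) :=
  suppIn_run_within U h.on.loc (SuppIn.ket within_zeroConfig)

theorem wt_true (h : IsProc U n s p W) : (wt (p.state U) fun _ => True) = 1 := by
  classical
  rw [Proc.state, h.on.rev.wt_true, wt_ket, if_pos trivial]

theorem wt_flag (h : IsProc U n s p W) :
    (wt (p.state U) fun x => x p.flag = true) = ∑ i ∈ Finset.range n, W i := by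
  rw [wt_eq_sum_fiber (Finset.range n) _ _ (fun x => regValue x p.idx ℓ)
    fun x hx hf => Finset.mem_range.mpr (h.valid x hx hf)]
  exact Finset.sum_congr rfl fun i hi => h.weight i (Finset.mem_range.mp hi)

theorem nonneg (h : IsProc U n s p W) {i : ℕ} (hi : i < n) : 0 ≤ W i := by
  rw [← h.weight i hi]; exact wt_nonneg _ _

theorem sum_le_one (h : IsProc U n s p W) : ∑ i ∈ Finset.range n, W i ≤ 1 := by
  rw [← h.wt_flag, ← h.wt_true]
  exact wt_mono fun _ _ _ => trivial

end IsProc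

/-! ### The empty procedure and combinations -/

/-- The procedure that finds nothing. -/
def emptyProc (ℓ s : ℕ) : Proc := ([], s + 1, s, s + 1 + ℓ)

theorem isProc_empty (U : OracleUnitary ℓ w) (n s : ℕ) :
    IsProc U n s (emptyProc ℓ s) fun _ => 0 where
  le_flag := le_rfl
  flag_lt := by simp only [emptyProc, Proc.flag, Proc.top]; omega
  le_idx := Nat.le_succ s
  idx_le := le_rfl
  flag_idx := Or.inl (Nat.lt_succ_self s)
  on := CircuitOn.nil
  valid := SuppIn.ket fun h => by simp at h
  weight i _ := by
    refine wt_eq_zero fun x hx h => ?_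
    rw [SuppIn.ket (P := fun x => x = zeroConfig) rfl x hx] at h
    simp at h

/-- The circuit that combines the results of two procedures. -/
def muxCircuit (ℓ f₁ i₁ f₂ i₂ t : ℕ) : Circuit :=
  xBlock f₁ ++ ([.toffoli f₁ f₂ (t + 1)] ++ (xBlock f₁ ++ ([.cnot f₁ t] ++ ([.cnot (t + 1) t] ++
    (copyCircuit f₁ i₁ (t + 2) ℓ ++ copyCircuit (t + 1) i₂ (t + 2) ℓ)))))

theorem muxCircuit_on {f₁ i₁ f₂ i₂ t₁ t s : ℕ} (h1 : s ≤ f₁ ∧ f₁ < t₁)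
    (h2 : s ≤ i₁ ∧ i₁ + ℓ ≤ t₁) (h3 : f₁ < i₁ ∨ i₁ + ℓ ≤ f₁) (h4 : t₁ ≤ f₂ ∧ f₂ < t)
    (h5 : t₁ ≤ i₂ ∧ i₂ + ℓ ≤ t) :
    CircuitOn U (fun q => s ≤ q ∧ q < t + 2 + ℓ) (muxCircuit ℓ f₁ i₁ f₂ i₂ t) := by
  have hx : CircuitOn U (fun q => s ≤ q ∧ q < t + 2 + ℓ) (xBlock f₁) :=
    CircuitOn.xBlock ⟨by omega, by omega⟩
  refine hx.append (CircuitOn.append ?_ (hx.append (CircuitOn.append ?_ (CircuitOn.append ?_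
    (CircuitOn.append ?_ ?_)))))
  · exact CircuitOn.toffoli ⟨by omega, by omega⟩ ⟨by omega, by omega⟩ ⟨by omega, by omega⟩
      (by omega) (by omega) (by omega)
  · exact CircuitOn.cnot ⟨by omega, by omega⟩ ⟨by omega, by omega⟩ (by omega)
  · exact CircuitOn.cnot ⟨by omega, by omega⟩ ⟨by omega, by omega⟩ (by omega)
  · exact copyCircuit_on ⟨by omega, by omega⟩ (fun j hj => ⟨by omega, by omega⟩)
      (fun j hj => ⟨by omega, by omega⟩) (by omega) (by omega) (by omega)
  · exact copyCircuit_on ⟨by omega, by omega⟩ (fun j hj => ⟨by omega, by omega⟩)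
      (fun j hj => ⟨by omega, by omega⟩) (by omega) (by omega) (by omega)

theorem muxCircuit_computes {f₁ i₁ f₂ i₂ t₁ t : ℕ} (h1 : f₁ < t₁)
    (h2 : i₁ + ℓ ≤ t₁) (h4 : t₁ ≤ f₂ ∧ f₂ < t) (h5 : t₁ ≤ i₂ ∧ i₂ + ℓ ≤ t) :
    ∃ c, Computes U (muxCircuit ℓ f₁ i₁ f₂ i₂ t) c ∧ ∀ x, Clean t (t + 2 + ℓ) x →
      c x t = (x f₁ || x f₂) ∧
      (x f₁ = true → regValue (c x) (t + 2) ℓ = regValue x i₁ ℓ) ∧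
      (x f₁ = false → x f₂ = true → regValue (c x) (t + 2) ℓ = regValue x i₂ ℓ) := by
  obtain ⟨g₁, hg₁, hg₁x⟩ := copyCircuit_computes (U := U) (c := f₁) (src := i₁) (dst := t + 2)
    (m := ℓ) (by omega) (by omega)
  obtain ⟨g₂, hg₂, hg₂x⟩ := copyCircuit_computes (U := U) (c := t + 1) (src := i₂) (dst := t + 2)
    (m := ℓ) (by omega) (by omega)
  refine ⟨_, (Computes.xBlock f₁).append ((Computes.toffoli f₁ f₂ (t + 1)).append
    ((Computes.xBlock f₁).append ((Computes.cnot f₁ t).append ((Computes.cnot (t + 1) t).append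
      (hg₁.append hg₂))))), fun x hx => ?_⟩
  have e1 : f₁ ≠ t + 1 := by omega
  have e2 : f₁ ≠ t := by omega
  have e3 : f₁ ≠ f₂ := by omega
  have e4 : f₂ ≠ t := by omega
  have e5 : f₂ ≠ t + 1 := by omega
  have c1 : x t = false := hx t le_rfl (by omega)
  have c2 : x (t + 1) = false := hx (t + 1) (by omega) (by omega)
  -- The state before the two controlled copies: qubit t + 1 says that only the second procedure
  -- succeeded, qubit t that at least one did, and the flag f₁ is restored.
  set y := Function.update (Function.update x (t + 1) (!x f₁ && x f₂)) t (x f₁ || x f₂) with hy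
  have hyy : Function.update (Function.update (Function.update (Function.update (Function.update x
      f₁ (!x f₁)) (t + 1) (xor (Function.update x f₁ (!x f₁) (t + 1))
        (Function.update x f₁ (!x f₁) f₁ && Function.update x f₁ (!x f₁) f₂))) f₁
      (!Function.update (Function.update x f₁ (!x f₁)) (t + 1)
        (xor (Function.update x f₁ (!x f₁) (t + 1))
        (Function.update x f₁ (!x f₁) f₁ && Function.update x f₁ (!x f₁) f₂)) f₁)) t (x f₁)) t
          (xor (x f₁) (!x f₁ && x f₂)) = y := by
    funext q
    simp only [hy, Function.update_self, Function.update_of_ne e1, Function.update_of_ne e1.symm,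
      Function.update_of_ne e3.symm, c2, Bool.false_xor, Bool.not_not, Function.update_apply]
    split_ifs <;> simp_all
    cases x f₁ <;> simp
  have hfin : ∀ z, z = y → g₂ (g₁ z) t = (x f₁ || x f₂) ∧
      (x f₁ = true → regValue (g₂ (g₁ z)) (t + 2) ℓ = regValue x i₁ ℓ) ∧
      (x f₁ = false → x f₂ = true → regValue (g₂ (g₁ z)) (t + 2) ℓ = regValue x i₂ ℓ) := by
    rintro z rfl
    have hyf : y f₁ = x f₁ := by simp [hy, e1, e2]
    have hyt : y (t + 1) = (!x f₁ && x f₂) := by simp [hy]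
    have hbit : ∀ j < ℓ, g₂ (g₁ y) (t + 2 + j) =
        xor (x f₁ && x (i₁ + j)) ((!x f₁ && x f₂) && x (i₂ + j)) := by
      intro j hj
      rw [(hg₂x _).1 j hj, (hg₁x _).1 j hj, (hg₁x _).2 (t + 1) (by omega),
        (hg₁x _).2 (i₂ + j) (by omega), hyf, hyt]
      have a1 : y (t + 2 + j) = false := by
        rw [hy, Function.update_of_ne (by omega), Function.update_of_ne (by omega)]
        exact hx _ (by omega) (by omega)
      have a2 : y (i₁ + j) = x (i₁ + j) := by
        rw [hy, Function.update_of_ne (by omega), Function.update_of_ne (by omega)]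
      have a3 : y (i₂ + j) = x (i₂ + j) := by
        rw [hy, Function.update_of_ne (by omega), Function.update_of_ne (by omega)]
      rw [a1, a2, a3, Bool.false_xor]
    refine ⟨?_, fun hf => regValue_congr fun j hj => ?_, fun hf hf' => regValue_congr fun j hj => ?_⟩
    · rw [(hg₂x _).2 t (by omega), (hg₁x _).2 t (by omega), hy, Function.update_self]
    · rw [hbit j hj, hf]; simp
    · rw [hbit j hj, hf, hf']; simp
  refine hfin _ ?_
  rw [← hyy]
  have e6 : t ≠ t + 1 := by omega
  simp [c1, c2, e1, e3.symm, e1.symm, e2.symm]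

/-- Take the index that `p` finds, or else the one that `q` finds. -/
def orElse (ℓ : ℕ) (p q : Proc) : Proc :=
  (p.code ++ (q.code ++ muxCircuit ℓ p.flag p.idx q.flag q.idx q.top),
    q.top + 2, q.top, q.top + 2 + ℓ)

/-- The procedures run on disjoint blocks, so their results are independent. Index i is output
either because the first finds it, or because the first fails, with weight 1 - ΣV, and the second
finds it. -/
theorem IsProc.orElse {n s : ℕ} {p q : Proc} {V W : ℕ → ℝ} (hp : IsProc U n s p V)
    (hq : IsProc U n p.top q W) : IsProc U n s (orElse ℓ p q) fun i =>
      V i + (1 - ∑ j ∈ Finset.range n, V j) * W i := by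
  have p1 := hp.le_flag; have p2 := hp.flag_lt; have p3 := hp.le_idx; have p4 := hp.idx_le
  have p5 := hp.flag_idx
  have q1 := hq.le_flag; have q2 := hq.flag_lt; have q3 := hq.le_idx; have q4 := hq.idx_le
  have hmux : CircuitOn U (fun r => s ≤ r ∧ r < q.top + 2 + ℓ)
      (muxCircuit ℓ p.flag p.idx q.flag q.idx q.top) :=
    muxCircuit_on ⟨p1, p2⟩ ⟨p3, p4⟩ p5 ⟨q1, q2⟩ ⟨q3, q4⟩
  obtain ⟨c, hc, hcx⟩ := muxCircuit_computes (U := U) p2 p4 ⟨q1, q2⟩ ⟨q3, q4⟩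
  have hst : (QSearch.orElse ℓ p q).state U =
      run U (muxCircuit ℓ p.flag p.idx q.flag q.idx q.top) (tensor (p.state U) (q.state U)) := by
    change run U (p.code ++ (q.code ++ _)) _ = _
    rw [run_append, run_append]
    congr 1
    rw [map_eq_sum, tensor]
    refine Finset.sum_congr rfl fun x hx => ?_
    rw [run_ket_eq_translate U hq.on.loc]
    · rfl
    intro r hr
    exact (hp.suppIn x (Finsupp.mem_support_iff.mp hx)).clean (Or.inl le_rfl) r hr.1 hr.2
  have hT : SuppIn (Within s q.top) (tensor (p.state U) (q.state U)) :=
    suppIn_tensor (hp.suppIn.mono fun _ h => h.mono le_rfl (by omega))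
      (hq.suppIn.mono fun _ h => h.mono (by omega) le_rfl)
  have hread : ∀ x z, Within s p.top x → Within p.top q.top z →
      cxor x z p.flag = x p.flag ∧ cxor x z q.flag = z q.flag ∧
      regValue (cxor x z) p.idx ℓ = regValue x p.idx ℓ ∧
      regValue (cxor x z) q.idx ℓ = regValue z q.idx ℓ := by
    intro x z hx hz
    refine ⟨by simp [hz p.flag (by omega)], by simp [hx q.flag (by omega)],
      regValue_cxor_of_within hz p4, regValue_congr fun j hj => by simp [hx (q.idx + j) (by omega)]⟩
  have hweight : ∀ i < n, wt ((QSearch.orElse ℓ p q).state U)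
      (fun x => x q.top = true ∧ regValue x (q.top + 2) ℓ = i) =
        V i + (1 - ∑ j ∈ Finset.range n, V j) * W i := by
    intro i hi
    rw [hst, hc.wt_run hmux.rev, ← wt_add_wt_and_not _ _ (fun x => x p.flag = true)]
    congr 1
    · rw [wt_congr (T := fun x => x p.flag = true ∧ regValue x p.idx ℓ = i)]
      · rw [wt_tensor_and hp.suppIn hq.suppIn (by omega)
          (T := fun x => x p.flag = true ∧ regValue x p.idx ℓ = i) (T' := fun _ => True),
          hp.weight i hi, hq.wt_true, mul_one]
        intro x z hx hz
        obtain ⟨a, b, c, d⟩ := hread x z hx hz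
        simp [a, c, -cxor_apply]
      · intro x hx
        obtain ⟨a, b, _⟩ := hcx x ((hT x hx).clean (by omega))
        constructor
        · rintro ⟨⟨-, h⟩, hf⟩
          exact ⟨hf, by rw [← b hf, h]⟩
        · rintro ⟨hf, h⟩
          exact ⟨⟨by simp [a, hf], by rw [b hf, h]⟩, hf⟩
    · rw [wt_congr (T := fun x => ¬ x p.flag = true ∧ (x q.flag = true ∧ regValue x q.idx ℓ = i))]
      · rw [wt_tensor_and hp.suppIn hq.suppIn (by omega)
          (T := fun x => ¬ x p.flag = true)
          (T' := fun x => x q.flag = true ∧ regValue x q.idx ℓ = i),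
          hq.weight i hi, ← hp.wt_flag, ← hp.wt_true,
          ← wt_add_wt_not _ fun x => x p.flag = true, add_sub_cancel_left]
        intro x z hx hz
        obtain ⟨a, b, c, d⟩ := hread x z hx hz
        simp [a, b, d, -cxor_apply]
      · intro x hx
        obtain ⟨a, _, b⟩ := hcx x ((hT x hx).clean (by omega))
        constructor
        · rintro ⟨⟨h1, h⟩, hf⟩
          have hf' := hf
          rw [Bool.not_eq_true] at hf
          rw [a, hf, Bool.false_or] at h1
          exact ⟨hf', h1, by rw [← b hf h1, h]⟩
        · rintro ⟨hf, h1, h⟩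
          have hf' := hf
          rw [Bool.not_eq_true] at hf
          exact ⟨⟨by simp [a, h1], by rw [b hf h1, h]⟩, hf'⟩
  refine ⟨?_, ?_, ?_, ?_, ?_, ?_, ?_, hweight⟩
  · simp only [QSearch.orElse, Proc.flag] at *; omega
  · simp only [QSearch.orElse, Proc.flag, Proc.top] at *; omega
  · simp only [QSearch.orElse, Proc.idx] at *; omega
  · simp only [QSearch.orElse, Proc.idx, Proc.top]; omega
  · simp only [QSearch.orElse, Proc.idx, Proc.flag]; omega
  · refine (hp.on.mono ?_).append ((hq.on.mono ?_).append hmux)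
    · intro r hr; simp only [QSearch.orElse, Proc.top] at *; omega
    · intro r hr; simp only [QSearch.orElse, Proc.top] at *; omega
  · rw [hst]
    refine hc.suppIn ((hp.suppIn.and hp.valid).tensor (hq.suppIn.and hq.valid)
      (R := fun y => Within s q.top y ∧ (y p.flag = true → regValue y p.idx ℓ < n) ∧
        (y q.flag = true → regValue y q.idx ℓ < n)) fun x z hx hz => ?_) fun y hy hf => ?_
    · obtain ⟨a, b, c, d⟩ := hread x z hx.1 hz.1
      rw [a, b, c, d]
      exact ⟨(hx.1.mono le_rfl (by omega)).cxor (hz.1.mono (by omega) le_rfl), hx.2, hz.2⟩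
    · obtain ⟨a, b, d⟩ := hcx y (hy.1.clean (by omega))
      change c y q.top = true at hf
      change regValue (c y) (q.top + 2) ℓ < n
      cases h : y p.flag
      · rw [a, h, Bool.false_or] at hf
        rw [d h hf]; exact hy.2.2 hf
      · rw [b h]; exact hy.2.1 h

end QSearch


/-! ### Filtering, amplification, preparation and readout -/

namespace QSearch

variable {ℓ w : ℕ} {U : OracleUnitary ℓ w}

/-! ### Filtering by a test -/

theorem wt_filter (φ : QState) (P S : Config → Prop) [DecidablePred P] :
    wt (φ.filter P) S = wt φ fun x => P x ∧ S x := by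
  classical
  unfold wt Finsupp.sum
  rw [Finsupp.support_filter, Finset.sum_filter]
  refine Finset.sum_congr rfl fun x _ => ?_
  by_cases h : P x <;> simp [h]

/-- Keep the index that `p` finds only if the test `A` accepts it. -/
def filterProc (p : Proc) (A : Circuit) (ans t : ℕ) : Proc :=
  (p.code ++ (A ++ [.toffoli p.flag ans t]), p.idx, t, t + 1)

/-- For every flagged basis state the test answers with its own acceptance weight in a fresh block,
and the new flag is the conjunction of the old one with that answer. The garbage of the test
remains. -/
theorem IsProc.filter {n s : ℕ} {p : Proc} {W : ℕ → ℝ} (hp : IsProc U n s p W) {A : Circuit}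
    {ans t : ℕ} {q : ℕ → ℝ} (hA : IsGadget U n p.idx p.top A ans t q) :
    IsProc U n s (filterProc p A ans t) fun i => q i * W i := by
  classical
  have p1 := hp.le_flag; have p2 := hp.flag_lt; have p3 := hp.le_idx; have p4 := hp.idx_le
  have p5 := hp.flag_idx; have a1 := hA.le_ans; have a2 := hA.ans_lt
  have hAB : CircuitOn U (fun r => s ≤ r ∧ r < t) A := hA.on.mono fun r hr => by omega
  have hT : CircuitOn U (fun r => s ≤ r ∧ r < t + 1) [.toffoli p.flag ans t] :=
    CircuitOn.toffoli ⟨by omega, by omega⟩ ⟨by omega, by omega⟩ ⟨by omega, by omega⟩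
      (by omega) (by omega) (by omega)
  have hTc : Computes U [.toffoli p.flag ans t] _ := Computes.toffoli p.flag ans t
  set φ := p.state U with hφ
  set ψ := run U A φ with hψ
  have hst : (filterProc p A ans t).state U = run U [.toffoli p.flag ans t] ψ := by
    change run U (p.code ++ (A ++ _)) _ = _
    rw [run_append, run_append]; rfl
  have hψs : SuppIn (Within s t) ψ :=
    suppIn_run_within U hAB.loc (hp.suppIn.mono fun _ h => h.mono le_rfl (by omega))
  have hnB : ¬ ((p.idx ≤ p.flag ∧ p.flag < p.idx + ℓ) ∨ (p.top ≤ p.flag ∧ p.flag < t)) := by omega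
  choose γ hγ using hA.spec
  -- The value 0 is never used: flagged states hold an index below n.
  set Γ : ℕ → QState := fun i => if h : i < n then γ i h else 0 with hΓ
  -- Nothing is known about the test on unflagged states, whose register may hold a number outside
  -- the range. The test does not touch the flag, so that part stays unflagged and contributes
  -- nothing to the weights in question.
  set φ₁ := φ.filter fun x => x p.flag = true with hφ₁
  set φ₀ := φ.filter fun x => ¬ x p.flag = true with hφ₀
  have hsplit : ψ = run U A φ₁ + run U A φ₀ := by
    rw [← map_add, hφ₁, hφ₀, Finsupp.filter_add_filter_not]
  have hφ₁x : ∀ x, φ₁ x ≠ 0 → x p.flag = true ∧ φ x ≠ 0 := by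
    intro x hx
    rw [hφ₁, Finsupp.filter_apply] at hx
    split_ifs at hx with h
    · exact ⟨h, hx⟩
    · exact absurd rfl hx
  have h₁ : SuppIn (fun x => x p.flag = true) (run U A φ₁) :=
    suppIn_run U hA.on.loc hnB fun x hx => (hφ₁x x hx).1
  have h₀ : SuppIn (fun x => x p.flag = false) (run U A φ₀) := by
    refine suppIn_run U hA.on.loc hnB fun x hx => ?_
    rw [hφ₀, Finsupp.filter_apply] at hx
    split_ifs at hx with h
    · exact absurd rfl hx
    · simpa using h
  have hrun : run U A φ₁ = ∑ x ∈ φ₁.support, φ₁ x • translate x (Γ (regValue x p.idx ℓ)) := by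
    rw [map_eq_sum]
    refine Finset.sum_congr rfl fun x hx => ?_
    obtain ⟨hf, hx⟩ := hφ₁x x (Finsupp.mem_support_iff.mp hx)
    have hlt := hp.valid x hx hf
    simp only [hΓ, dif_pos hlt]
    rw [(hγ _ hlt).2.2.2 x ((hp.suppIn x hx).clean (by omega)) rfl]
  have hwt : ∀ S : Config → Prop, (∀ x, S x → x p.flag = true) → wt ψ S =
      ∑ x ∈ φ₁.support, ‖φ₁ x‖ ^ 2 *
        wt (Γ (regValue x p.idx ℓ)) fun z => S (cxor x z) := by
    intro S hS
    rw [hsplit, wt_add_of_disjoint, wt_eq_zero (φ := run U A φ₀), add_zero, hrun, wt_branch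
      (s := p.top) (t := t) (γ := fun x => Γ (regValue x p.idx ℓ))]
    · exact fun x hx => (hp.suppIn x (hφ₁x x hx).2).clean (by omega)
    · intro x hx
      obtain ⟨hf, hx⟩ := hφ₁x x hx
      have hlt := hp.valid x hx hf
      simp only [hΓ, dif_pos hlt]
      exact (hγ _ hlt).1
    · intro x hx hSx
      have : x p.flag = false := h₀ x hx
      rw [hS x hSx] at this
      exact absurd this (by simp)
    · intro x hx hx'
      have : x p.flag = false := h₀ x hx'
      rw [h₁ x hx] at this
      exact absurd this (by simp)
  have hcx : ∀ x, Within s t x → Function.update x t (xor (x t) (x p.flag && x ans)) t =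
      (x p.flag && x ans) ∧ regValue (Function.update x t (xor (x t) (x p.flag && x ans))) p.idx ℓ =
        regValue x p.idx ℓ := by
    intro x hx
    refine ⟨by simp [hx t (by omega)], regValue_congr fun j hj => ?_⟩
    rw [Function.update_of_ne (by omega)]
  refine ⟨?_, ?_, p3, ?_, ?_, ?_, ?_, fun i hi => ?_⟩
  · simp only [filterProc, Proc.flag] at *; omega
  · simp only [filterProc, Proc.flag, Proc.top]; omega
  · simp only [filterProc, Proc.idx, Proc.top] at *; omega
  · simp only [filterProc, Proc.idx, Proc.flag, Proc.top] at *; omega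
  · refine (hp.on.mono ?_).append ((hAB.mono ?_).append hT)
    · intro r hr; simp only [filterProc, Proc.top] at *; omega
    · intro r hr; simp only [filterProc, Proc.top] at *; omega
  · rw [hst]
    have hv : SuppIn (fun x => x p.flag = true → regValue x p.idx ℓ < n) ψ := by
      rw [hsplit]
      refine SuppIn.add ?_ fun x hx hf => ?_
      · rw [hrun]
        refine SuppIn.sum fun x hx => SuppIn.smul _ ?_
        obtain ⟨hf, hx⟩ := hφ₁x x (Finsupp.mem_support_iff.mp hx)
        have hlt := hp.valid x hx hf
        refine SuppIn.translate (P := Within p.top t) ?_ fun z hz _ => ?_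
        · simp only [hΓ, dif_pos hlt]; exact (hγ _ hlt).1
        · rwa [regValue_cxor_of_within hz p4]
      · rw [h₀ x hx] at hf; exact absurd hf (by simp)
    refine hTc.suppIn (hψs.and hv) fun x hx hf => ?_
    obtain ⟨a, b⟩ := hcx x hx.1
    change Function.update x t (xor (x t) (x p.flag && x ans)) t = true at hf
    rw [a, Bool.and_eq_true] at hf
    change regValue (Function.update x t (xor (x t) (x p.flag && x ans))) p.idx ℓ < n
    rw [b]
    exact hx.2 hf.1
  · rw [hst, hTc.wt_run hT.rev]
    change (wt ψ fun x => Function.update x t (xor (x t) (x p.flag && x ans)) t = true ∧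
      regValue (Function.update x t (xor (x t) (x p.flag && x ans))) p.idx ℓ = i) = _
    rw [wt_congr (T := fun x => x p.flag = true ∧ x ans = true ∧ regValue x p.idx ℓ = i), hwt _
      fun x hx => hx.1, ← hp.weight i hi, ← wt_filter, ← sum_norm_sq_eq_wt, Finset.mul_sum]
    · refine Finset.sum_congr rfl fun x hx => ?_
      obtain ⟨hf, hx⟩ := hφ₁x x (Finsupp.mem_support_iff.mp hx)
      have hlt := hp.valid x hx hf
      obtain ⟨g1, g2, g3, -⟩ := hγ _ hlt
      simp only [hΓ, dif_pos hlt]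
      by_cases e : regValue x p.idx ℓ = i
      · rw [if_pos e, wt_congr (T := fun z => z ans = true), g3, e, mul_comm]
        intro z hz
        rw [regValue_cxor_of_within (g1 z hz) p4]
        have e1 := g1 z hz p.flag (by omega)
        have e2 := hp.suppIn x hx ans (by omega)
        simp [e, e1, e2, hf]
      · rw [if_neg e, wt_eq_zero, mul_zero, mul_zero]
        intro z hz
        rw [regValue_cxor_of_within (g1 z hz) p4]
        exact fun h => e h.2.2
    · intro x hx
      obtain ⟨a, b⟩ := hcx x (hψs x hx)
      rw [a, b, Bool.and_eq_true, and_assoc]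

/-! ### Amplitude amplification -/

/-- The reflection about the zero state of the `m` qubits from `s` on. -/
def reflectCircuit (s b m : ℕ) : Circuit :=
  compareCircuit 1 s b m ++ (zBlock (b + m) ++ invCircuit (compareCircuit 1 s b m))

theorem reflectCircuit_on {s b m : ℕ} (h : s + m ≤ b) :
    CircuitOn U (fun q => s ≤ q ∧ q < b + m + 1) (reflectCircuit s b m) := by
  have : CircuitOn U (fun q => s ≤ q ∧ q < b + m + 1) (compareCircuit 1 s b m) :=
    (compareCircuit_on h).mono fun q hq => by omega
  exact this.append ((CircuitOn.zBlock ⟨by omega, by omega⟩).append this.inv)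

/-- A block is zero exactly if the number in it is less than 1. The comparison is computed, turned
into a phase and uncomputed. -/
theorem run_reflectCircuit {s b m : ℕ} (h : s + m = b) (hm : 0 < m) {x : Config}
    (hx : Within s b x) [Decidable (x = zeroConfig)] :
    run U (reflectCircuit s b m) (ket x) = (if x = zeroConfig then (-1 : ℂ) else 1) • ket x := by
  obtain ⟨c, hc, hcx⟩ := compareCircuit_computes (U := U) (k := 1) (s := s) (b := b) (m := m) h.le
  have hrev := (compareCircuit_on (U := U) (k := 1) (s := s) (b := b) (m := m) h.le).rev
  have h1 := (hcx x (hx.clean (Or.inl le_rfl))).1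
  -- The comparison is with 1 modulo 2^m, so the block must be nonempty.
  have h2 : 1 % 2 ^ m = 1 := Nat.mod_eq_of_lt (Nat.one_lt_two_pow hm.ne')
  have h3 : regValue x s m < 1 ↔ x = zeroConfig := by
    constructor
    · intro h0
      ext q
      by_cases hq : q < s ∨ b ≤ q
      · exact hx q hq
      · have := testBit_regValue x s m (q - s) (by omega)
        rw [Nat.lt_one_iff.mp h0, Nat.zero_testBit, show s + (q - s) = q by omega] at this
        exact this.symm
    · rintro rfl
      simp [regValue]
  rw [reflectCircuit, run_append, run_append, hc x, run_zBlock, map_smul, ← hc x, hrev.left, h1, h2]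
  simp only [decide_eq_true_eq, h3]

/-- One step of amplitude amplification for the procedure `p` on the block from `s` on. -/
def amplify (s : ℕ) (p : Proc) : Proc :=
  (p.code ++ (zBlock p.flag ++ (invCircuit p.code ++ (reflectCircuit s p.top (p.top - s) ++
    p.code))), p.idx, p.flag, p.top + (p.top - s) + 1)

theorem run_zBlock_apply (q : ℕ) (φ : QState) (x : Config) :
    run U (zBlock q) φ x = (if x q then (-1 : ℂ) else 1) * φ x := by
  classical
  induction φ using Finsupp.induction_linear with
  | zero => simp
  | add f g hf hg => simp only [map_add, Finsupp.add_apply, hf, hg, mul_add]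
  | single y c =>
    have e : Finsupp.single y c = c • ket y := by simp [ket]
    rw [e, map_smul, run_zBlock, Finsupp.smul_apply, Finsupp.smul_apply, Finsupp.smul_apply,
      ket_apply]
    by_cases h : y = x
    · subst h; simp only [if_true, smul_eq_mul]; ring
    · simp [h]

theorem ip_zBlock (q : ℕ) (φ : QState) : ip φ (run U (zBlock q) φ) =
    ((wt φ fun x => ¬ x q = true : ℝ) : ℂ) - ((wt φ fun x => x q = true : ℝ) : ℂ) := by
  classical
  unfold ip wt Finsupp.sum
  push_cast
  rw [← Finset.sum_sub_distrib]
  refine Finset.sum_congr rfl fun x _ => ?_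
  rw [run_zBlock_apply]
  have : (starRingEnd ℂ) (φ x) * φ x = (‖φ x‖ : ℂ) ^ 2 := by
    rw [mul_comm, Complex.mul_conj, Complex.normSq_eq_norm_sq]; simp
  by_cases h : x q = true
  · simp [h, this]
  · simp [h, this]

theorem wt_eq_of_smul {φ ψ : QState} {c : ℂ} {S : Config → Prop} (h : ∀ x, S x → ψ x = c * φ x) :
    wt ψ S = ‖c‖ ^ 2 * wt φ S := by
  classical
  rw [wt_eq_sum_of_subset (F := ψ.support ∪ φ.support) Finset.subset_union_left,
    wt_eq_sum_of_subset (F := ψ.support ∪ φ.support) Finset.subset_union_right, Finset.mul_sum]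
  refine Finset.sum_congr rfl fun x _ => ?_
  by_cases hS : S x
  · rw [if_pos hS, if_pos hS, h x hS, norm_mul, mul_pow]
  · simp [hS]

/-- With A the unitary of p and φ = A|0⟩, the step computes A(1 - 2|0⟩⟨0|)A⁻¹Zφ = Zφ - 2⟨φ, Zφ⟩φ,
where Z is the sign of the flag. As ⟨φ, Zφ⟩ = 1 - 2σ, every flagged amplitude is multiplied by -(3 -
4σ). This is the identity sin 3θ = sin θ (3 - 4 sin²θ) with σ = sin²θ. All flagged indices are
rescaled alike, whatever else the workspace holds. -/
theorem IsProc.amplify {n s : ℕ} {p : Proc} {W : ℕ → ℝ} (hp : IsProc U n s p W) :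
    IsProc U n s (amplify s p) fun i => (3 - 4 * ∑ j ∈ Finset.range n, W j) ^ 2 * W i := by
  classical
  have p1 := hp.le_flag; have p2 := hp.flag_lt; have p3 := hp.le_idx; have p4 := hp.idx_le
  set m := p.top - s with hm
  set σ := ∑ j ∈ Finset.range n, W j with hσ
  set φ := p.state U with hφ
  have hR : CircuitOn U (fun q => s ≤ q ∧ q < p.top + m + 1) (reflectCircuit s p.top m) :=
    reflectCircuit_on (by omega)
  have hon : ∀ {A}, CircuitOn U (fun q => s ≤ q ∧ q < p.top) A →
      CircuitOn U (fun q => s ≤ q ∧ q < p.top + m + 1) A := fun h => h.mono fun q hq => by omega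
  have hZ : CircuitOn U (fun q => s ≤ q ∧ q < p.top) (QSearch.zBlock p.flag) :=
    CircuitOn.zBlock ⟨p1, p2⟩
  set v := run U (QSearch.zBlock p.flag) φ with hv
  set u := run U (invCircuit p.code) v with hu
  have hus : SuppIn (Within s p.top) u :=
    suppIn_run_within U hp.on.inv.loc (suppIn_run_within U hZ.loc hp.suppIn)
  -- The amplitude at |0⟩ of A⁻¹Zφ equals ⟨φ, Zφ⟩ by adjointness: unflagged minus flagged weight.
  have hu0 : u zeroConfig = 1 - 2 * (σ : ℂ) := by
    rw [← ip_ket_left, hu, ← hp.on.rev.adj]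
    change ip φ v = _
    rw [hv, ip_zBlock, hp.wt_flag, ← hσ]
    have := wt_add_wt_not φ fun x => x p.flag = true
    rw [hp.wt_true, hp.wt_flag, ← hσ] at this
    rw [← eq_sub_iff_add_eq'] at this
    rw [this]; push_cast; ring
  have hRu : run U (reflectCircuit s p.top m) u = u - (2 * u zeroConfig) • ket zeroConfig := by
    let R : QState →ₗ[ℂ] QState := LinearMap.id -
      (2 : ℂ) • (Finsupp.lapply zeroConfig : QState →ₗ[ℂ] ℂ).smulRight (ket zeroConfig)
    have e : R u = u - (2 * u zeroConfig) • ket zeroConfig := by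
      simp [R, mul_smul]
    rw [← e]
    refine linearMap_congr hus fun x hx => ?_
    rw [run_reflectCircuit (by omega) (by omega) hx]
    by_cases h : x = zeroConfig
    · subst h
      simp only [if_true, R, LinearMap.sub_apply, LinearMap.id_apply, LinearMap.smul_apply,
        LinearMap.smulRight_apply, Finsupp.lapply_apply, ket_apply]
      module
    · simp [R, ket_apply, h]
  have hst : (QSearch.amplify s p).state U = v - (2 * (1 - 2 * (σ : ℂ))) • φ := by
    change run U (p.code ++ (_ ++ (_ ++ (_ ++ p.code)))) _ = _
    rw [run_append, run_append, run_append, run_append]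
    change run U p.code (run U (reflectCircuit s p.top m) u) = _
    rw [hRu, map_sub, map_smul, hu, hp.on.rev.right, ← hu, hu0]
    rfl
  refine ⟨p1, ?_, p3, ?_, hp.flag_idx, ?_, ?_, fun i hi => ?_⟩
  · simp only [QSearch.amplify, Proc.flag, Proc.top] at *; omega
  · simp only [QSearch.amplify, Proc.idx, Proc.top] at *; omega
  · exact (hon hp.on).append ((hon hZ).append ((hon hp.on.inv).append (hR.append (hon hp.on))))
  · rw [hst]
    intro x hx
    refine hp.valid x fun h0 => hx ?_
    simp only [Finsupp.sub_apply, Finsupp.smul_apply, hv, run_zBlock_apply]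
    rw [← hφ] at h0
    simp [h0]
  -- On flagged states Z is -1, which gives the factor -1 - 2(1 - 2σ) = -(3 - 4σ).
  · rw [hst, wt_eq_of_smul (φ := φ) (c := ((-(3 - 4 * σ) : ℝ) : ℂ))]
    · rw [← hp.weight i hi, Complex.norm_real, Real.norm_eq_abs, sq_abs, neg_sq]
      rfl
    · rintro x ⟨hf, -⟩
      change x p.flag = true at hf
      rw [Finsupp.sub_apply, Finsupp.smul_apply, hv, run_zBlock_apply, if_pos hf, smul_eq_mul]
      push_cast; ring

/-! ### The uniform superposition -/

/-- Hadamard gates on `m` qubits. -/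
def hadamardLayer (s : ℕ) : ℕ → Circuit
  | 0 => []
  | m + 1 => hadamardLayer s m ++ [.hadamard (s + m)]

theorem hadamardLayer_on (s m : ℕ) :
    CircuitOn U (fun q => s ≤ q ∧ q < s + m) (hadamardLayer s m) := by
  induction m with
  | zero => exact CircuitOn.nil
  | succ m ih => exact (ih.mono fun q hq => by omega).append (CircuitOn.hadamard (by omega))

theorem wt_run_hadamard_ket (q : ℕ) (b : Bool) :
    (wt (run U [.hadamard q] (ket zeroConfig)) fun x => x q = b) = 1 / 2 := by
  classical
  rw [run_cons, run_nil, apply_hadamard, wt_smul, wt_add_of_disjoint, wt_smul, wt_ket, wt_ket,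
    Complex.norm_real, Real.norm_eq_abs, sq_abs, div_pow, Real.sq_sqrt zero_le_two]
  · cases b <;> simp
  · intro x hx hx'
    have e1 : Function.update zeroConfig q false = x := by
      by_contra e; exact hx (by simp [ket_apply, e])
    have e2 : Function.update zeroConfig q true = x := by
      by_contra e; exact hx' (by simp [ket_apply, e])
    have := congrFun (e1.trans e2.symm) q
    simp at this

theorem wt_run_hadamardLayer (s m i : ℕ) (hi : i < 2 ^ m) :
    (wt (run U (hadamardLayer s m) (ket zeroConfig)) fun x => regValue x s m = i) =
      1 / 2 ^ m := by
  classical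
  induction m generalizing i with
  | zero =>
    have : i = 0 := by simpa using hi
    subst this
    simp [hadamardLayer, wt_ket, regValue]
  | succ m ih =>
    have hγ : SuppIn (Within s (s + m)) (run U (hadamardLayer s m) (ket zeroConfig)) :=
      suppIn_run_within U (hadamardLayer_on (U := U) s m).loc (SuppIn.ket within_zeroConfig)
    have hl : CircuitOn U (fun q => s + m ≤ q ∧ q < s + m + 1) [.hadamard (s + m)] :=
      CircuitOn.hadamard (by omega)
    have hδ : SuppIn (Within (s + m) (s + m + 1)) (run U [.hadamard (s + m)] (ket zeroConfig)) :=
      suppIn_run_within U hl.loc (SuppIn.ket within_zeroConfig)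
    have e : run U (hadamardLayer s (m + 1)) (ket zeroConfig) = tensor
        (run U (hadamardLayer s m) (ket zeroConfig))
        (run U [.hadamard (s + m)] (ket zeroConfig)) := by
      rw [hadamardLayer, run_append, map_eq_sum, tensor]
      refine Finset.sum_congr rfl fun x hx => ?_
      rw [run_ket_eq_translate U hl.loc]
      exact fun q hq => hγ x (Finsupp.mem_support_iff.mp hx) q (by omega)
    rw [e, wt_tensor_and hγ hδ (by omega) (T := fun x => regValue x s m = i % 2 ^ m)
      (T' := fun x => x (s + m) = i.testBit m), ih _ (Nat.mod_lt _ (by positivity)),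
      wt_run_hadamard_ket, pow_succ]
    · field_simp
    · intro x z hx hz
      have e1 : regValue (cxor x z) s m = regValue x s m :=
        regValue_congr fun j hj => by simp [hz (s + j) (by omega)]
      have e2 : cxor x z (s + m) = z (s + m) := by simp [hx (s + m) (by omega)]
      have e3 := regValue_lt x s m
      have e4 : i = i % 2 ^ m + if i.testBit m then 2 ^ m else 0 := by
        conv_lhs => rw [← Nat.mod_eq_of_lt hi]
        rw [Nat.mod_pow_succ, Nat.testBit_eq_decide_div_mod_eq]
        rcases Nat.mod_two_eq_zero_or_one (i / 2 ^ m) with h | h <;> simp [h]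
      have e5 : i % 2 ^ m < 2 ^ m := Nat.mod_lt _ (by positivity)
      rw [regValue_succ, e1, e2]
      cases z (s + m) <;> cases h : i.testBit m <;> rw [h] at e4 <;> simp at e4 ⊢ <;> omega

/-- The procedure that finds each index with the same probability. -/
def uniformProc (ℓ n s : ℕ) : Proc :=
  (hadamardLayer s ℓ ++ compareCircuit n s (s + ℓ + 1) (ℓ + 1), s, s + ℓ + 1 + (ℓ + 1),
    s + ℓ + 1 + (ℓ + 1) + 1)

/-- Flagging the values below n makes every index valid even if n is not a power of two. Since n =
2^ℓ is possible, the comparison uses ℓ + 1 bits, the top one being a spare qubit that stays 0. -/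
theorem isProc_uniform (U : OracleUnitary ℓ w) {n : ℕ} (hn : n ≤ 2 ^ ℓ) (s : ℕ) :
    IsProc U n s (uniformProc ℓ n s) fun _ => 1 / 2 ^ ℓ := by
  obtain ⟨c, hc, hcx⟩ := compareCircuit_computes (U := U) (k := n) (s := s) (b := s + ℓ + 1)
    (m := ℓ + 1) (by omega)
  have hC : CircuitOn U (fun q => s ≤ q ∧ q < s + ℓ + 1 + (ℓ + 1) + 1)
      (compareCircuit n s (s + ℓ + 1) (ℓ + 1)) :=
    (compareCircuit_on (by omega)).mono fun q hq => by omega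
  have hs : SuppIn (Within s (s + ℓ)) (run U (hadamardLayer s ℓ) (ket zeroConfig)) :=
    suppIn_run_within U (hadamardLayer_on (U := U) s ℓ).loc (SuppIn.ket within_zeroConfig)
  have hst : (uniformProc ℓ n s).state U = run U (compareCircuit n s (s + ℓ + 1) (ℓ + 1))
      (run U (hadamardLayer s ℓ) (ket zeroConfig)) := run_append U _ _ _
  have hflag : ∀ x, Within s (s + ℓ) x →
      (c x (s + ℓ + 1 + (ℓ + 1)) = true ↔ regValue x s ℓ < n) ∧
      regValue (c x) s ℓ = regValue x s ℓ := by
    intro x hx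
    obtain ⟨a, b⟩ := hcx x (hx.clean (by omega))
    have e : n % 2 ^ (ℓ + 1) = n :=
      Nat.mod_eq_of_lt (hn.trans_lt (Nat.pow_lt_pow_right one_lt_two (Nat.lt_succ_self _)))
    rw [e, regValue_succ, hx (s + ℓ) (by omega)] at a
    refine ⟨by rw [a]; simp, regValue_congr fun j hj => b _ (by omega)⟩
  refine ⟨?_, ?_, le_rfl, ?_, ?_, ?_, ?_, fun i hi => ?_⟩
  · simp only [uniformProc, Proc.flag]; omega
  · simp only [uniformProc, Proc.flag, Proc.top]; omega
  · simp only [uniformProc, Proc.idx, Proc.top]; omega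
  · simp only [uniformProc, Proc.idx, Proc.flag]; omega
  · refine ((hadamardLayer_on s ℓ).mono ?_).append hC
    intro q hq; simp only [uniformProc, Proc.top]; omega
  · rw [hst]
    refine hc.suppIn hs fun x hx hf => ?_
    obtain ⟨a, b⟩ := hflag x hx
    change regValue (c x) s ℓ < n
    rw [b]; exact a.mp hf
  · rw [hst, hc.wt_run hC.rev, ← wt_run_hadamardLayer (U := U) s ℓ i (hi.trans_le hn)]
    refine wt_congr fun x hx => ?_
    obtain ⟨a, b⟩ := hflag x (hs x hx)
    change c x (s + ℓ + 1 + (ℓ + 1)) = true ∧ regValue (c x) s ℓ = i ↔ _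
    rw [a, b]
    exact ⟨fun h => h.2, fun h => ⟨h ▸ hi, h⟩⟩

/-! ### The output -/

/-- The circuit that runs a procedure and copies its result to the output qubits. -/
def outputCircuit (ℓ : ℕ) (p : Proc) : Circuit :=
  p.code ++ ([.cnot p.flag 0] ++ copyCircuit p.flag p.idx 1 ℓ)

-- The procedure starts at qubit ℓ + 1, above the output qubits, which are still 0 when the flag and
-- the index are copied to them. The copy is controlled by the flag, so measuring the output has the
-- distribution given by the weights.
open Classical in
theorem outputCircuit_spec {n : ℕ} {p : Proc} {W : ℕ → ℝ} (hp : IsProc U n (ℓ + 1) p W) :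
    (outputCircuit ℓ p).WellFormed ℓ w ∧ ∀ S : Option ℕ → Prop,
      (outputCircuit ℓ p).prob U S =
        (∑ i ∈ Finset.range n, if S (some i) then W i else 0) +
          if S none then 1 - ∑ i ∈ Finset.range n, W i else 0 := by
  have p1 := hp.le_flag; have p3 := hp.le_idx; have p5 := hp.flag_idx
  have h1 : CircuitOn U (fun _ => True) [.cnot p.flag 0] :=
    CircuitOn.cnot trivial trivial (by omega)
  have h2 : CircuitOn U (fun _ => True) (copyCircuit p.flag p.idx 1 ℓ) :=
    copyCircuit_on trivial (fun _ _ => trivial) (fun _ _ => trivial) (by omega) (by omega)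
      (by omega)
  refine ⟨((hp.on.mono fun _ _ => trivial).append (h1.append h2)).wf, fun S => ?_⟩
  obtain ⟨f, hf, hfx⟩ := copyCircuit_computes (U := U) (c := p.flag) (src := p.idx) (dst := 1)
    (m := ℓ) (by omega) (by omega)
  have hout : ∀ x, Within (ℓ + 1) p.top x →
      Circuit.output ℓ (f (Function.update x 0 (xor (x 0) (x p.flag)))) =
        if x p.flag then some (regValue x p.idx ℓ) else none := by
    intro x hx
    obtain ⟨a, b⟩ := hfx (Function.update x 0 (xor (x 0) (x p.flag)))
    have e : f (Function.update x 0 (xor (x 0) (x p.flag))) 0 = x p.flag := by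
      rw [b 0 (by omega)]; simp [hx 0 (by omega)]
    rw [Circuit.output, e]
    cases h : x p.flag
    · simp
    · simp only [if_true, Option.some.injEq]
      refine regValue_congr fun j hj => ?_
      rw [h] at a
      rw [a j hj, Function.update_of_ne (by omega), Function.update_of_ne (by omega),
        Function.update_of_ne (by omega), hx (1 + j) (by omega), h]
      simp
  have hst : (outputCircuit ℓ p).prob U S =
      wt (p.state U) fun x => S (if x p.flag then some (regValue x p.idx ℓ) else none) := by
    change wt ((outputCircuit ℓ p).finalState U) (fun x => S (Circuit.output ℓ x)) = _
    rw [finalState_eq_run, outputCircuit, run_append,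
      ((Computes.cnot p.flag 0).append hf).wt_run (h1.append h2).rev]
    exact wt_congr fun x hx => by rw [hout x (hp.suppIn x hx)]
  rw [hst, ← wt_add_wt_and_not _ _ fun x => x p.flag = true]
  congr 1
  · rw [wt_eq_sum_fiber (Finset.range n) _ _ (fun x => regValue x p.idx ℓ)
      fun x hx h => Finset.mem_range.mpr (hp.valid x hx h.2)]
    refine Finset.sum_congr rfl fun i hi => ?_
    split_ifs with hS
    · rw [← hp.weight i (Finset.mem_range.mp hi)]
      refine wt_congr fun x _ => ⟨fun h => ⟨h.1.2, h.2⟩, fun h => ⟨⟨?_, h.1⟩, h.2⟩⟩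
      rw [if_pos h.1, h.2]; exact hS
    · refine wt_eq_zero fun x _ h => hS ?_
      have := h.1.1
      rwa [if_pos h.1.2, h.2] at this
  · split_ifs with hS
    · rw [← hp.wt_flag, ← hp.wt_true, ← wt_add_wt_not _ fun x => x p.flag = true,
        add_sub_cancel_left]
      refine wt_congr fun x _ => ⟨fun h => h.2, fun h => ⟨?_, h⟩⟩
      rw [if_neg h]; exact hS
    · refine wt_eq_zero fun x _ h => hS ?_
      have := h.1
      rwa [if_neg h.2] at this

end QSearch


/-! ### The search algorithm and its error probability -/

namespace QSearch

variable {w : ℕ}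

/-! ### The algorithm -/

/-- Filter by a tree of tests. -/
def treeFilter (c : Bool) (w k : ℕ) (p : Proc) : Proc :=
  filterProc p (treeCircuit c w p.idx k p.top) (p.top + treeSize w k) (p.top + treeSize w k + 1)

/-- The depth of the filter after `j` steps of amplification. -/
def levelDepth (j : ℕ) : ℕ := 2 * (5 + j / 2) + 1

/-- `j` steps of amplitude amplification, interleaved with filters. -/
def levelProc (ℓ n w s : ℕ) : ℕ → Proc
  | 0 => treeFilter false w (levelDepth 0) (uniformProc ℓ n s)
  | j + 1 => treeFilter false w (levelDepth (j + 1)) (amplify s (levelProc ℓ n w s j))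

/-- Try the first `m` levels. -/
def levelsProc (ℓ n w s : ℕ) : ℕ → Proc
  | 0 => emptyProc ℓ s
  | m + 1 => orElse ℓ (levelsProc ℓ n w s m) (levelProc ℓ n w (levelsProc ℓ n w s m).top m)

/-- Try the first `m` levels and test the result by a tree of depth `2 * h`. -/
def passProc (ℓ n w m h s : ℕ) : Proc := treeFilter true w (2 * h) (levelsProc ℓ n w s m)

/-- Repeat `passProc`. -/
def passesProc (ℓ n w m h s : ℕ) : ℕ → Proc
  | 0 => emptyProc ℓ s
  | r + 1 => orElse ℓ (passesProc ℓ n w m h s r)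
      (passProc ℓ n w m h (passesProc ℓ n w m h s r).top)

/-- The circuit for search with precision parameter `d`. -/
def searchCircuit (n w d : ℕ) : Circuit :=
  outputCircuit (Nat.clog 2 n) (passesProc (Nat.clog 2 n) n w (Nat.clog 9 (2 ^ Nat.clog 2 n) + 1)
    (Nat.clog 2 d + 2) (Nat.clog 2 n + 1) (6 * (d + 1)))

/-! ### Success probabilities -/

/-- The probability that level `j` finds the index `i`. -/
noncomputable def levelWeight (ℓ n : ℕ) (p : ℕ → ℝ) : ℕ → ℕ → ℝ
  | 0, i => treeProb false (p i) (levelDepth 0) * (1 / 2 ^ ℓ)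
  | j + 1, i => treeProb false (p i) (levelDepth (j + 1)) *
      ((3 - 4 * ∑ k ∈ Finset.range n, levelWeight ℓ n p j k) ^ 2 * levelWeight ℓ n p j i)

/-- The probability that the first `m` of a sequence of procedures find the index `i`. -/
noncomputable def orElseWeight (n : ℕ) (W : ℕ → ℕ → ℝ) : ℕ → ℕ → ℝ
  | 0, _ => 0
  | m + 1, i => orElseWeight n W m i +
      (1 - ∑ k ∈ Finset.range n, orElseWeight n W m k) * W m i

/-- The probability that one pass finds the index `i`. -/
noncomputable def passWeight (ℓ n : ℕ) (p : ℕ → ℝ) (m h i : ℕ) : ℝ :=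
  treeProb true (p i) (2 * h) * orElseWeight n (levelWeight ℓ n p) m i

section spec

variable {n : ℕ} (P : Instance n) {U : OracleUnitary (Instance.indexBits n) w}
  (hU : P.IsOracle U)
include hU

theorem IsProc.treeFilter {s : ℕ} {p : Proc} {W : ℕ → ℝ} (hp : IsProc U n s p W) (c : Bool)
    (k : ℕ) : IsProc U n s (treeFilter c w k p) fun i => treeProb c (P.prob i) k * W i :=
  hp.filter (isGadget_tree P hU c k hp.idx_le)

theorem isProc_levelProc (s j : ℕ) :
    IsProc U n s (levelProc (Nat.clog 2 n) n w s j) (levelWeight (Nat.clog 2 n) n P.prob j) := by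
  induction j with
  | zero => exact (isProc_uniform U (Nat.le_pow_clog one_lt_two n) s).treeFilter P hU false _
  | succ j ih => exact ih.amplify.treeFilter P hU false _

theorem isProc_levelsProc (s m : ℕ) : IsProc U n s (levelsProc (Nat.clog 2 n) n w s m)
    (orElseWeight n (levelWeight (Nat.clog 2 n) n P.prob) m) := by
  induction m with
  | zero => exact isProc_empty U n s
  | succ m ih => exact ih.orElse (isProc_levelProc P hU _ m)

theorem isProc_passProc (m h s : ℕ) : IsProc U n s (passProc (Nat.clog 2 n) n w m h s)
    (passWeight (Nat.clog 2 n) n P.prob m h) :=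
  (isProc_levelsProc P hU s m).treeFilter P hU true _

theorem isProc_passesProc (m h s r : ℕ) : IsProc U n s (passesProc (Nat.clog 2 n) n w m h s r)
    (orElseWeight n (fun _ => passWeight (Nat.clog 2 n) n P.prob m h) r) := by
  induction r with
  | zero => exact isProc_empty U n s
  | succ r ih => exact ih.orElse (isProc_passProc P hU m h _)

end spec

/-! ### Error reduction by trees -/

/-- The effect of two layers of NAND gates on the acceptance probability. -/
noncomputable def nandMap (x : ℝ) : ℝ := 1 - (1 - x * x) * (1 - x * x)

theorem treeProb_true (p : ℝ) (h : ℕ) : treeProb true p (2 * h) = nandMap^[h] p := by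
  induction h with
  | zero => rfl
  | succ h ih =>
    rw [Function.iterate_succ_apply', ← ih, show 2 * (h + 1) = 2 * h + 1 + 1 by ring]
    simp [treeProb, nandMap]

/-- The AND gates at the bottom replace p by p², so the threshold on p rises from about 0.618 to its
square root, about 0.786. -/
theorem treeProb_false (p : ℝ) (h : ℕ) : treeProb false p (2 * h + 1) = nandMap^[h] (p * p) := by
  induction h with
  | zero => simp [treeProb]
  | succ h ih =>
    rw [Function.iterate_succ_apply', ← ih, show 2 * (h + 1) + 1 = 2 * h + 1 + 1 + 1 by ring]
    simp [treeProb, nandMap]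

theorem nandMap_mem {x : ℝ} (h0 : 0 ≤ x) (h1 : x ≤ 1) : 0 ≤ nandMap x ∧ nandMap x ≤ 1 := by
  have h2 : x * x ≤ 1 := by nlinarith
  have h3 : 0 ≤ x * x := by positivity
  unfold nandMap
  constructor
  · nlinarith
  · nlinarith [mul_self_nonneg (1 - x * x)]

theorem iterate_nandMap_mem {x : ℝ} (h0 : 0 ≤ x) (h1 : x ≤ 1) (h : ℕ) :
    0 ≤ nandMap^[h] x ∧ nandMap^[h] x ≤ 1 := by
  induction h with
  | zero => exact ⟨h0, h1⟩
  | succ h ih => rw [Function.iterate_succ_apply']; exact nandMap_mem ih.1 ih.2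

/-- One step gives 2x² - x⁴ ≤ 2x², so 2x is at most squared. -/
theorem iterate_nandMap_le {x : ℝ} (h0 : 0 ≤ x) (h1 : x ≤ 1) (h : ℕ) :
    2 * nandMap^[h] x ≤ (2 * x) ^ 2 ^ h := by
  induction h with
  | zero => simp
  | succ h ih =>
    have hm := iterate_nandMap_mem h0 h1 h
    rw [Function.iterate_succ_apply', pow_succ 2 h, pow_mul]
    refine le_trans ?_ (pow_le_pow_left₀ (by linarith) ih 2)
    unfold nandMap
    nlinarith [sq_nonneg (nandMap^[h] x * nandMap^[h] x)]

/-- One step turns 1 - x into (1 - x²)² ≤ 4(1 - x)², so 4(1 - x) is at most squared. -/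
theorem one_sub_iterate_nandMap_le {x : ℝ} (h0 : 0 ≤ x) (h1 : x ≤ 1) (h : ℕ) :
    4 * (1 - nandMap^[h] x) ≤ (4 * (1 - x)) ^ 2 ^ h := by
  induction h with
  | zero => simp
  | succ h ih =>
    have hm := iterate_nandMap_mem h0 h1 h
    rw [Function.iterate_succ_apply', pow_succ 2 h, pow_mul]
    refine le_trans ?_ (pow_le_pow_left₀ (by linarith) ih 2)
    generalize nandMap^[h] x = y at hm
    unfold nandMap
    have e : 1 - y * y ≤ 2 * (1 - y) := by nlinarith
    have e' : 0 ≤ 1 - y * y := by nlinarith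
    nlinarith [mul_le_mul e e e' (by linarith)]

/-- The number 5/8 lies just above the repelling fixed point (√5 - 1)/2, so iteration does not go
below it. This is what makes the final check keep indices of intermediate p at any depth. -/
theorem le_iterate_nandMap {x : ℝ} (h0 : 5 / 8 ≤ x) (h1 : x ≤ 1) (h : ℕ) :
    5 / 8 ≤ nandMap^[h] x := by
  induction h with
  | zero => exact h0
  | succ h ih =>
    have hm := iterate_nandMap_mem (by linarith : (0 : ℝ) ≤ x) h1 h
    rw [Function.iterate_succ_apply']
    generalize nandMap^[h] x = y at hm ih
    unfold nandMap
    have e : 1 - y * y ≤ 39 / 64 := by nlinarith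
    have e' : 0 ≤ 1 - y * y := by nlinarith
    nlinarith [mul_le_mul e e e' (by norm_num)]

theorem treeProb_false_mem {p : ℝ} (h0 : 0 ≤ p) (h1 : p ≤ 1) (j : ℕ) :
    0 ≤ treeProb false p (levelDepth j) ∧ treeProb false p (levelDepth j) ≤ 1 := by
  rw [levelDepth, treeProb_false]
  exact iterate_nandMap_mem (by positivity) (by nlinarith) _

/-- Here 2p² < 25/32, and even the smallest depth raises this to a power of at least 2^5. -/
theorem treeProb_false_le {p : ℝ} (h0 : 0 ≤ p) (h1 : p < 5 / 8) (j : ℕ) :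
    treeProb false p (levelDepth j) ≤ 1 / 1000 := by
  rw [levelDepth, treeProb_false]
  have h := iterate_nandMap_le (x := p * p) (by positivity) (by nlinarith) (5 + j / 2)
  have h2 : 2 * (p * p) ≤ 25 / 32 := by nlinarith
  have h3 : (2 * (p * p)) ^ 2 ^ (5 + j / 2) ≤ (25 / 32 : ℝ) ^ 2 ^ 5 :=
    (pow_le_pow_left₀ (by positivity) h2 _).trans (pow_le_pow_of_le_one (by norm_num)
      (by norm_num) (Nat.pow_le_pow_right (by norm_num) (by omega)))
  have h4 : (25 / 32 : ℝ) ^ 2 ^ 5 ≤ 1 / 500 := by norm_num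
  linarith

/-- Here 4(1 - p²) ≤ 19/25, whose 16th power is below 1/50. The errors have to be summable over the
levels; the exponent 2^(5 + j/2) is at least 16(j + 1), so a tree with only O(2^j) leaves achieves
this. -/
theorem le_treeProb_false {p : ℝ} (h0 : 9 / 10 ≤ p) (h1 : p ≤ 1) (j : ℕ) :
    1 - 1 / 100 * (1 / 2) ^ (j + 1) ≤ treeProb false p (levelDepth j) := by
  rw [levelDepth, treeProb_false]
  have h := one_sub_iterate_nandMap_le (x := p * p) (by nlinarith) (by nlinarith) (5 + j / 2)
  have h2 : 4 * (1 - p * p) ≤ 19 / 25 := by nlinarith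
  have h3 : j + 1 ≤ 2 * 2 ^ (j / 2) := by
    have := Nat.lt_two_pow_self (n := j / 2)
    omega
  have h4 : (4 * (1 - p * p)) ^ 2 ^ (5 + j / 2) ≤ (1 / 50 : ℝ) ^ (j + 1) := by
    have e : 2 ^ (5 + j / 2) = 16 * (2 * 2 ^ (j / 2)) := by rw [pow_add]; ring
    have e2 : (4 * (1 - p * p)) ^ 16 ≤ 1 / 50 :=
      (pow_le_pow_left₀ (by nlinarith) h2 16).trans (by norm_num)
    rw [e, pow_mul]
    exact (pow_le_pow_left₀ (by positivity) e2 _).trans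
      (pow_le_pow_of_le_one (by norm_num) (by norm_num) h3)
  have h5 : (1 / 50 : ℝ) ^ (j + 1) ≤ 1 / 25 * (1 / 2) ^ (j + 1) := by
    rw [show (1 / 50 : ℝ) = 1 / 25 * (1 / 2) by norm_num, mul_pow]
    refine mul_le_mul_of_nonneg_right ?_ (by positivity)
    exact pow_le_of_le_one (by norm_num) (by norm_num) (Nat.succ_ne_zero j)
  linarith

/-! ### Analysis of the levels -/

section analysis

variable {ℓ n : ℕ} {p : ℕ → ℝ} (hp0 : ∀ i, 0 ≤ p i) (hp1 : ∀ i, p i ≤ 1)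

theorem sum_orElseWeight (W : ℕ → ℕ → ℝ) (m : ℕ) :
    1 - ∑ i ∈ Finset.range n, orElseWeight n W m i =
      ∏ j ∈ Finset.range m, (1 - ∑ i ∈ Finset.range n, W j i) := by
  induction m with
  | zero => simp [orElseWeight]
  | succ m ih =>
    rw [Finset.prod_range_succ, ← ih]
    simp only [orElseWeight, Finset.sum_add_distrib, ← Finset.mul_sum]
    ring

theorem orElseWeight_nonneg {W : ℕ → ℕ → ℝ} (hW : ∀ j, ∀ i < n, 0 ≤ W j i)
    (hs : ∀ j, ∑ i ∈ Finset.range n, W j i ≤ 1) (m : ℕ) : ∀ i < n, 0 ≤ orElseWeight n W m i := by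
  induction m with
  | zero => exact fun i _ => le_rfl
  | succ m ih =>
    intro i hi
    refine add_nonneg (ih i hi) (mul_nonneg ?_ (hW m i hi))
    rw [sum_orElseWeight]
    exact Finset.prod_nonneg fun j _ => sub_nonneg.mpr (hs j)

/-- The weight of a set of indices is subadditive. -/
theorem sum_orElseWeight_le {W : ℕ → ℕ → ℝ} (hW : ∀ j, ∀ i < n, 0 ≤ W j i)
    (hs : ∀ j, ∑ i ∈ Finset.range n, W j i ≤ 1) {T : Finset ℕ} (hT : T ⊆ Finset.range n) (m : ℕ) :
    ∑ i ∈ T, orElseWeight n W m i ≤ ∑ j ∈ Finset.range m, ∑ i ∈ T, W j i := by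
  induction m with
  | zero => simp [orElseWeight]
  | succ m ih =>
    rw [Finset.sum_range_succ]
    simp only [orElseWeight, Finset.sum_add_distrib]
    refine add_le_add ih (Finset.sum_le_sum fun i hi => ?_)
    have hi := Finset.mem_range.mp (hT hi)
    refine mul_le_of_le_one_left (hW m i hi) (sub_le_self _ (Finset.sum_nonneg fun k hk => ?_))
    exact orElseWeight_nonneg hW hs m k (Finset.mem_range.mp hk)

/-- If procedures find something with probabilities that sum to `1 / 4`, then one of them does with
probability `1 / 5`. -/
theorem prod_one_sub_le {s : ℕ → ℝ} (h0 : ∀ j, 0 ≤ s j) (h1 : ∀ j, s j ≤ 1) (m : ℕ) :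
    (∏ j ∈ Finset.range m, (1 - s j)) * (1 + ∑ j ∈ Finset.range m, s j) ≤ 1 := by
  induction m with
  | zero => simp
  | succ m ih =>
    rw [Finset.prod_range_succ, Finset.sum_range_succ]
    have hP : 0 ≤ ∏ j ∈ Finset.range m, (1 - s j) :=
      Finset.prod_nonneg fun j _ => sub_nonneg.mpr (h1 j)
    have hS : 0 ≤ ∑ j ∈ Finset.range m, s j := Finset.sum_nonneg fun j _ => h0 j
    refine le_trans ?_ ih
    rw [mul_assoc]
    refine mul_le_mul_of_nonneg_left ?_ hP
    nlinarith [mul_nonneg (h0 m) hS, sq_nonneg (s m)]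

include hp0 hp1

theorem levelWeight_nonneg (j i : ℕ) : 0 ≤ levelWeight ℓ n p j i := by
  induction j with
  | zero => exact mul_nonneg (treeProb_false_mem (hp0 i) (hp1 i) _).1 (by positivity)
  | succ j ih =>
    exact mul_nonneg (treeProb_false_mem (hp0 i) (hp1 i) _).1 (mul_nonneg (sq_nonneg _) ih)

variable (hn : n ≤ 2 ^ ℓ) (hs : ∀ j, ∑ i ∈ Finset.range n, levelWeight ℓ n p j i ≤ 1)
include hn hs

/-- Amplification multiplies the weight of a set by at most 9, since 0 ≤ σ ≤ 1, and the filter then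
multiplies it by at most 1/1000. The result is a decay by less than a factor 1/2 per level, whatever
the stronger indices do. -/
theorem sum_levelWeight_le {T : Finset ℕ} (hT : T ⊆ Finset.range n) (hw : ∀ i ∈ T, p i < 5 / 8)
    (j : ℕ) : ∑ i ∈ T, levelWeight ℓ n p j i ≤ 1 / 1000 * (1 / 2) ^ j := by
  induction j with
  | zero =>
    have h1 : ∑ i ∈ T, levelWeight ℓ n p 0 i ≤ ∑ _i ∈ T, 1 / 1000 * (1 / 2 ^ ℓ : ℝ) :=
      Finset.sum_le_sum fun i hi =>
        mul_le_mul_of_nonneg_right (treeProb_false_le (hp0 i) (hw i hi) _) (by positivity)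
    refine h1.trans ?_
    have h2 : (T.card : ℝ) ≤ 2 ^ ℓ := by
      have := (Finset.card_le_card hT).trans ((Finset.card_range n).le.trans hn)
      exact_mod_cast this
    have h3 : (T.card : ℝ) * (1 / 2 ^ ℓ) ≤ 1 := by
      rw [mul_one_div]; exact div_le_one_of_le₀ h2 (by positivity)
    rw [Finset.sum_const, nsmul_eq_mul]
    linarith
  | succ j ih =>
    set σ := ∑ k ∈ Finset.range n, levelWeight ℓ n p j k with hσ
    have hσ0 : 0 ≤ σ := Finset.sum_nonneg fun k _ => levelWeight_nonneg hp0 hp1 j k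
    have h9 : (3 - 4 * σ) ^ 2 ≤ 9 := by nlinarith [hs j]
    have h1 : ∑ i ∈ T, levelWeight ℓ n p (j + 1) i ≤
        ∑ i ∈ T, 1 / 1000 * (9 * levelWeight ℓ n p j i) := by
      refine Finset.sum_le_sum fun i hi => ?_
      have hl := levelWeight_nonneg (ℓ := ℓ) (n := n) hp0 hp1 j i
      exact mul_le_mul (treeProb_false_le (hp0 i) (hw i hi) _) (mul_le_mul_of_nonneg_right h9 hl)
        (mul_nonneg (sq_nonneg _) hl) (by norm_num)
    rw [← Finset.mul_sum, ← Finset.mul_sum] at h1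
    have : (0 : ℝ) < (1 / 2) ^ j := by positivity
    rw [pow_succ]
    linarith

-- Each level contributes the factor (3 - 4σ)² = 9(1 - 4σ/3)² and a filter loss of at most
-- 2^(-j-1)/100. The products of the correction factors are bounded below by one minus the sums: the
-- geometric series bounds the filter losses, and the sum of the σ bounds the loss of amplification.
omit hn hs in
theorem le_levelWeight {i : ℕ} (hgood : 9 / 10 ≤ p i) (m : ℕ)
    (hm : ∑ j ∈ Finset.range m, ∑ k ∈ Finset.range n, levelWeight ℓ n p j k ≤ 1 / 4) :
    9 ^ m / 2 ^ ℓ * (1 - 1 / 100 * (1 - (1 / 2) ^ (m + 1))) * (1 - 4 / 3 * ∑ j ∈ Finset.range m,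
      ∑ k ∈ Finset.range n, levelWeight ℓ n p j k) ^ 2 ≤ levelWeight ℓ n p m i := by
  induction m with
  | zero =>
    have := le_treeProb_false hgood (hp1 i) 0
    simp only [levelWeight, Finset.range_zero, Finset.sum_empty, mul_zero, sub_zero, one_pow,
      mul_one, pow_zero, zero_add, pow_one] at this ⊢
    rw [mul_comm]
    refine mul_le_mul_of_nonneg_right ?_ (by positivity)
    linarith
  | succ m ih =>
    rw [Finset.sum_range_succ] at hm ⊢
    set σ := ∑ k ∈ Finset.range n, levelWeight ℓ n p m k with hσ
    set S := ∑ j ∈ Finset.range m, ∑ k ∈ Finset.range n, levelWeight ℓ n p j k with hS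
    have hσ0 : 0 ≤ σ := Finset.sum_nonneg fun k _ => levelWeight_nonneg hp0 hp1 m k
    have hS0 : 0 ≤ S := Finset.sum_nonneg fun j _ => Finset.sum_nonneg fun k _ =>
      levelWeight_nonneg hp0 hp1 j k
    have ih := ih (by linarith)
    have hq := le_treeProb_false hgood (hp1 i) (m + 1)
    have hx : (0 : ℝ) < (1 / 2) ^ (m + 1) := by positivity
    have hx1 : (1 / 2 : ℝ) ^ (m + 1) ≤ 1 := pow_le_one₀ (by norm_num) (by norm_num)
    rw [pow_succ (1 / 2 : ℝ) (m + 1)] at hq ⊢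
    set x := (1 / 2 : ℝ) ^ (m + 1)
    set E := 1 - 1 / 100 * (1 - x) with hE
    have hE0 : 0 ≤ E := by rw [hE]; linarith
    have e1 : 1 - 1 / 100 * (1 - x * (1 / 2)) ≤
        E * (1 - 1 / 100 * (x * (1 / 2))) := by
      rw [hE]; nlinarith
    have e2 : (1 - 4 / 3 * (S + σ)) ^ 2 ≤ (1 - 4 / 3 * S) ^ 2 * (1 - 4 / 3 * σ) ^ 2 := by
      rw [← mul_pow]
      exact pow_le_pow_left₀ (by linarith) (by nlinarith [mul_nonneg hS0 hσ0]) 2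
    have hN : (0 : ℝ) ≤ 9 ^ (m + 1) / 2 ^ ℓ := by positivity
    calc 9 ^ (m + 1) / 2 ^ ℓ * (1 - 1 / 100 * (1 - x * (1 / 2))) * (1 - 4 / 3 * (S + σ)) ^ 2
        ≤ 9 ^ (m + 1) / 2 ^ ℓ * (E * (1 - 1 / 100 * (x * (1 / 2)))) *
            ((1 - 4 / 3 * S) ^ 2 * (1 - 4 / 3 * σ) ^ 2) := by
          refine mul_le_mul (mul_le_mul_of_nonneg_left e1 hN) e2 (sq_nonneg _) ?_
          exact mul_nonneg hN (mul_nonneg hE0 (by linarith))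
      _ = (1 - 1 / 100 * (x * (1 / 2))) * ((3 - 4 * σ) ^ 2 *
            (9 ^ m / 2 ^ ℓ * E * (1 - 4 / 3 * S) ^ 2)) := by
          rw [pow_succ]; ring
      _ ≤ treeProb false (p i) (levelDepth (m + 1)) * ((3 - 4 * σ) ^ 2 * levelWeight ℓ n p m i) :=
          mul_le_mul hq (mul_le_mul_of_nonneg_left ih (sq_nonneg _))
            (mul_nonneg (sq_nonneg _) (by positivity))
            (treeProb_false_mem (hp0 i) (hp1 i) _).1

-- If the sum stayed below 1/4, the good index alone would have weight at least 99/100 * (2/3)² >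
-- 1/4 at level m, where 9^m has caught up with 2^ℓ. No knowledge of the number of good indices, nor
-- of which level succeeds, is needed.
omit hn hs in
theorem one_fourth_le_sum {i : ℕ} (hi : i < n) (hgood : 9 / 10 ≤ p i) {m : ℕ}
    (hm : 2 ^ ℓ ≤ 9 ^ m) :
    1 / 4 ≤ ∑ j ∈ Finset.range (m + 1), ∑ k ∈ Finset.range n, levelWeight ℓ n p j k := by
  by_contra! hlt
  rw [Finset.sum_range_succ] at hlt
  have hS0 : 0 ≤ ∑ j ∈ Finset.range m, ∑ k ∈ Finset.range n, levelWeight ℓ n p j k :=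
    Finset.sum_nonneg fun j _ => Finset.sum_nonneg fun k _ => levelWeight_nonneg hp0 hp1 j k
  have h1 : levelWeight ℓ n p m i ≤ ∑ k ∈ Finset.range n, levelWeight ℓ n p m k :=
    Finset.single_le_sum (fun k _ => levelWeight_nonneg hp0 hp1 m k) (Finset.mem_range.mpr hi)
  have h0 := levelWeight_nonneg (ℓ := ℓ) (n := n) hp0 hp1 m i
  have h2 := le_levelWeight (ℓ := ℓ) (n := n) hp0 hp1 hgood m (by linarith)
  have h3 : (1 : ℝ) ≤ 9 ^ m / 2 ^ ℓ := by
    rw [one_le_div (by positivity)]; exact_mod_cast hm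
  have h4 : (1 / 2 : ℝ) ^ (m + 1) ≥ 0 := by positivity
  set S := ∑ j ∈ Finset.range m, ∑ k ∈ Finset.range n, levelWeight ℓ n p j k
  have h5 : (4 / 9 : ℝ) ≤ (1 - 4 / 3 * S) ^ 2 := by nlinarith
  have h6 : (99 / 100 : ℝ) ≤ 9 ^ m / 2 ^ ℓ * (1 - 1 / 100 * (1 - (1 / 2) ^ (m + 1))) := by
    nlinarith
  have h7 : (99 / 100 : ℝ) * (4 / 9) ≤ levelWeight ℓ n p m i :=
    (mul_le_mul h6 h5 (by norm_num) (by linarith)).trans h2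
  linarith

/-- The levels find something with probability at least 1/5, and an index with p < 5/8 with
probability at most 1/500. The final check keeps the other indices with probability at least 5/8,
and 5/8 * (1/5 - 1/500) > 1/9. -/
theorem le_sum_passWeight {i : ℕ} (hi : i < n) (hgood : 9 / 10 ≤ p i) {m : ℕ}
    (hm : 2 ^ ℓ ≤ 9 ^ m) (h : ℕ) :
    1 / 9 ≤ ∑ k ∈ Finset.range n, passWeight ℓ n p (m + 1) h k := by
  set V := orElseWeight n (levelWeight ℓ n p) (m + 1) with hV
  have hl0 : ∀ j, ∀ i < n, 0 ≤ levelWeight ℓ n p j i := fun j i _ =>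
    levelWeight_nonneg hp0 hp1 j i
  have hV0 := orElseWeight_nonneg hl0 hs (m + 1)
  -- The probability that all levels fail is at most 1/(1 + 1/4) = 4/5.
  have htot : 1 / 5 ≤ ∑ k ∈ Finset.range n, V k := by
    have h1 := one_fourth_le_sum (ℓ := ℓ) hp0 hp1 hi hgood hm
    have h2 := prod_one_sub_le (s := fun j => ∑ k ∈ Finset.range n, levelWeight ℓ n p j k)
      (fun j => Finset.sum_nonneg fun k _ => levelWeight_nonneg hp0 hp1 j k) hs (m + 1)
    have h3 := sum_orElseWeight (n := n) (levelWeight ℓ n p) (m + 1)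
    rw [← h3] at h2
    have h4 : 0 ≤ 1 - ∑ i ∈ Finset.range n, orElseWeight n (levelWeight ℓ n p) (m + 1) i := by
      rw [h3]; exact Finset.prod_nonneg fun j _ => sub_nonneg.mpr (hs j)
    nlinarith
  have hweak : ∑ k ∈ (Finset.range n).filter (fun k => p k < 5 / 8), V k ≤ 1 / 500 := by
    refine (sum_orElseWeight_le hl0 hs (Finset.filter_subset _ _) (m + 1)).trans ?_
    have h1 : ∑ j ∈ Finset.range (m + 1), ∑ k ∈ (Finset.range n).filter (fun k => p k < 5 / 8),
        levelWeight ℓ n p j k ≤ ∑ j ∈ Finset.range (m + 1), 1 / 1000 * (1 / 2 : ℝ) ^ j :=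
      Finset.sum_le_sum fun j _ => sum_levelWeight_le hp0 hp1 hn hs (Finset.filter_subset _ _)
        (fun i hi => (Finset.mem_filter.mp hi).2) j
    refine h1.trans ?_
    rw [← Finset.mul_sum]
    have h2 : ∑ j ∈ Finset.range (m + 1), (1 / 2 : ℝ) ^ j ≤ 2 := sum_geometric_two_le _
    linarith
  have hsplit := Finset.sum_filter_add_sum_filter_not (Finset.range n) (fun k => p k < 5 / 8) V
  have hstrong : ∑ k ∈ (Finset.range n).filter (fun k => ¬ p k < 5 / 8), 5 / 8 * V k ≤
      ∑ k ∈ Finset.range n, passWeight ℓ n p (m + 1) h k := by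
    refine (Finset.sum_le_sum fun k hk => ?_).trans (Finset.sum_le_sum_of_subset_of_nonneg
      (Finset.filter_subset (fun k => ¬ p k < 5 / 8) _) fun k hk _ => ?_)
    · obtain ⟨hk, hk'⟩ := Finset.mem_filter.mp hk
      refine mul_le_mul_of_nonneg_right ?_ (hV0 k (Finset.mem_range.mp hk))
      rw [treeProb_true]
      exact le_iterate_nandMap (not_lt.mp hk') (hp1 k) h
    · refine mul_nonneg ?_ (hV0 k (Finset.mem_range.mp hk))
      rw [treeProb_true]
      exact (iterate_nandMap_mem (hp0 k) (hp1 k) h).1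
  rw [← Finset.mul_sum] at hstrong
  linarith

-- The final check accepts each index of T with probability at most (1/5)^(2^h)/2, and the weights
-- it acts on have sum at most 1.
omit hn in
theorem sum_passWeight_le {T : Finset ℕ} (hT : T ⊆ Finset.range n) (hw : ∀ i ∈ T, p i < 1 / 10)
    (m h : ℕ) : ∑ i ∈ T, passWeight ℓ n p m h i ≤ 1 / 2 * (1 / 5) ^ 2 ^ h := by
  have hl0 : ∀ j, ∀ i < n, 0 ≤ levelWeight ℓ n p j i := fun j i _ =>
    levelWeight_nonneg hp0 hp1 j i
  have hV0 := orElseWeight_nonneg hl0 hs m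
  have h1 : ∑ i ∈ T, orElseWeight n (levelWeight ℓ n p) m i ≤ 1 := by
    refine (Finset.sum_le_sum_of_subset_of_nonneg hT fun i hi _ =>
      hV0 i (Finset.mem_range.mp hi)).trans ?_
    rw [← sub_nonneg, sum_orElseWeight]
    exact Finset.prod_nonneg fun j _ => sub_nonneg.mpr (hs j)
  have h2 : ∑ i ∈ T, passWeight ℓ n p m h i ≤
      ∑ i ∈ T, 1 / 2 * (1 / 5) ^ 2 ^ h * orElseWeight n (levelWeight ℓ n p) m i := by
    refine Finset.sum_le_sum fun i hi => mul_le_mul_of_nonneg_right ?_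
      (hV0 i (Finset.mem_range.mp (hT hi)))
    rw [treeProb_true]
    have e1 := iterate_nandMap_le (hp0 i) (hp1 i) h
    have e2 : (2 * p i) ^ 2 ^ h ≤ (1 / 5) ^ 2 ^ h :=
      pow_le_pow_left₀ (by linarith [hp0 i]) (by linarith [hw i hi]) _
    linarith
  refine h2.trans ?_
  rw [← Finset.mul_sum]
  exact mul_le_of_le_one_right (by positivity) h1

end analysis

/-- The search circuit errs with probability at most `2 ^ (-d)`. -/
theorem le_prob_searchCircuit {n d : ℕ} (hd : 1 ≤ d) (P : Instance n)
    {U : OracleUnitary (Instance.indexBits n) w} (hU : P.IsOracle U) :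
    1 - (1 / 2 : ℝ) ^ d ≤ (searchCircuit n w d).prob U P.IsCorrect := by
  classical
  set ℓ := Nat.clog 2 n with hℓ
  -- Parameters: 9^m ≥ 2^ℓ lets the levels reach constant weight, 2^h ≥ 4d makes the final check
  -- accurate enough for a union bound over all passes, and r passes bring the probability of
  -- finding nothing below 2^(-d-1).
  set m := Nat.clog 9 (2 ^ ℓ) with hm
  set h := Nat.clog 2 d + 2 with hh
  set r := 6 * (d + 1) with hr
  have hproc := isProc_passesProc P hU (m + 1) h (ℓ + 1) r
  set W := orElseWeight n (fun _ => passWeight ℓ n P.prob (m + 1) h) r with hW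
  have hprob := (outputCircuit_spec hproc).2 P.IsCorrect
  rw [show searchCircuit n w d = outputCircuit ℓ (passesProc ℓ n w (m + 1) h (ℓ + 1) r) from rfl]
  rw [hprob]
  have hp0 := P.prob_nonneg
  have hp1 := P.prob_le_one
  have hn : n ≤ 2 ^ ℓ := Nat.le_pow_clog one_lt_two n
  -- That the weights of a level add up to at most 1 comes from the normalization of its quantum
  -- state, not from the recursion.
  have hs := fun j => (isProc_levelProc P hU 0 j).sum_le_one
  have hpass := isProc_passProc P hU (m + 1) h 0
  have hbad : ∀ i < n, ¬ P.IsCorrect (some i) → P.prob i < 1 / 10 := by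
    intro i hi hc
    have hmem : (⟨i, hi⟩ : Fin n) ∈ P.bad := by
      have := Finset.mem_univ (⟨i, hi⟩ : Fin n)
      rw [← P.cover, Finset.mem_union] at this
      exact this.resolve_left fun h => hc ⟨_, h, rfl⟩
    rw [Instance.prob, dif_pos hi]
    exact P.lt_of_bad _ hmem
  -- Union bound over the passes for the probability of a wrong index.
  have hTle : ∑ i ∈ (Finset.range n).filter (fun i => ¬ P.IsCorrect (some i)), W i ≤
      1 / 2 * (1 / 2) ^ d := by
    refine (sum_orElseWeight_le (fun _ i hi => hpass.nonneg hi) (fun _ => hpass.sum_le_one)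
      (Finset.filter_subset _ _) r).trans ?_
    have e1 := sum_passWeight_le hp0 hp1 hs
      (T := (Finset.range n).filter (fun i => ¬ P.IsCorrect (some i))) (Finset.filter_subset _ _)
      (fun i hi => hbad i (Finset.mem_range.mp (Finset.mem_filter.mp hi).1)
        (Finset.mem_filter.mp hi).2) (m + 1) h
    rw [Finset.sum_const, Finset.card_range, nsmul_eq_mul]
    have e2 : 4 * d ≤ 2 ^ h := by
      rw [hh, pow_add]; have := Nat.le_pow_clog one_lt_two d; omega
    have e3 : (1 / 5 : ℝ) ^ 2 ^ h ≤ (1 / 625) ^ d := by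
      refine (pow_le_pow_of_le_one (by norm_num) (by norm_num) e2).trans ?_
      rw [pow_mul]; norm_num
    have e4 : ((d + 1 : ℕ) : ℝ) ≤ 2 ^ d := by exact_mod_cast Nat.lt_two_pow_self
    have e5 : (4 / 625 : ℝ) ^ d ≤ 4 / 625 := pow_le_of_le_one (by norm_num) (by norm_num) (by omega)
    have e6 : (2 : ℝ) ^ d * (1 / 625) ^ d = (4 / 625) ^ d * (1 / 2) ^ d := by
      rw [← mul_pow, ← mul_pow]; norm_num
    have e7 : (0 : ℝ) < (1 / 2) ^ d := by positivity
    calc (r : ℝ) * _ ≤ (6 * 2 ^ d) * (1 / 2 * (1 / 625) ^ d) := by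
          refine mul_le_mul ?_ (e1.trans (by linarith)) (Finset.sum_nonneg fun i hi =>
            hpass.nonneg (Finset.mem_range.mp (Finset.mem_filter.mp hi).1)) (by positivity)
          rw [hr, Nat.cast_mul]; push_cast at e4 ⊢; linarith
      _ = 3 * (4 / 625) ^ d * (1 / 2) ^ d := by rw [mul_assoc 3, ← e6]; ring
      _ ≤ 1 / 2 * (1 / 2) ^ d := by
          refine mul_le_mul_of_nonneg_right ?_ e7.le; linarith
  have hsplit := Finset.sum_filter_add_sum_filter_not (Finset.range n)
    (fun i => P.IsCorrect (some i)) W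
  rw [Finset.sum_filter] at hsplit
  have e7 : (0 : ℝ) < (1 / 2) ^ d := by positivity
  -- Without good indices ⊥ is correct, so only a wrong index is an error. Otherwise the failure of
  -- all passes is an error too.
  by_cases hg : P.good = ∅
  · rw [if_pos (show P.IsCorrect none from hg)]
    linarith
  · rw [if_neg (show ¬ P.IsCorrect none from hg)]
    obtain ⟨i, hi⟩ := Finset.nonempty_iff_ne_empty.mpr hg
    have hgood : 9 / 10 ≤ P.prob i := by
      rw [Instance.prob, dif_pos i.2]; exact P.le_of_good i hi
    have e1 := le_sum_passWeight hp0 hp1 hn hs i.2 hgood (m := m)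
      (Nat.le_pow_clog (by norm_num) _) h
    have e2 := sum_orElseWeight (n := n) (fun _ => passWeight ℓ n P.prob (m + 1) h) r
    rw [Finset.prod_const, Finset.card_range] at e2
    have e3 : (1 - ∑ i ∈ Finset.range n, passWeight ℓ n P.prob (m + 1) h i) ^ r ≤
        1 / 2 * (1 / 2) ^ d := by
      -- Six passes halve the probability of finding nothing, as (8/9)^6 < 1/2.
      rw [hr, pow_mul, ← pow_succ']
      refine pow_le_pow_left₀ (pow_nonneg (sub_nonneg.mpr hpass.sum_le_one) _) ?_ _
      refine (pow_le_pow_left₀ (sub_nonneg.mpr hpass.sum_le_one)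
        (show _ ≤ (8 / 9 : ℝ) by linarith) 6).trans (by norm_num)
    linarith

end QSearch


/-! ### Query, time and space bounds -/

namespace QSearch

/-! ### Costs -/

@[simp] theorem Proc.code_mk (A : Circuit) (i f t : ℕ) : Proc.code (A, i, f, t) = A := rfl

@[simp] theorem Proc.top_mk (A : Circuit) (i f t : ℕ) : Proc.top (A, i, f, t) = t := rfl

@[simp] theorem length_zBlock (q : ℕ) : (zBlock q).length = 4 := rfl

@[simp] theorem length_xBlock (q : ℕ) : (xBlock q).length = 6 := rfl

@[simp] theorem queries_zBlock (q : ℕ) : (zBlock q).countP Gate.isQuery = 0 := rfl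

@[simp] theorem queries_xBlock (q : ℕ) : (xBlock q).countP Gate.isQuery = 0 := rfl

theorem length_compareCircuit (k s b m : ℕ) : (compareCircuit k s b m).length ≤ 19 * m := by
  induction m with
  | zero => simp [compareCircuit]
  | succ m ih =>
    rw [compareCircuit]
    split <;> simp <;> omega

@[simp] theorem queries_compareCircuit (k s b m : ℕ) :
    (compareCircuit k s b m).countP Gate.isQuery = 0 := by
  induction m with
  | zero => simp [compareCircuit]
  | succ m ih =>
    rw [compareCircuit]
    split <;> simp [ih, Gate.isQuery]

@[simp] theorem length_copyCircuit (c a b m : ℕ) : (copyCircuit c a b m).length = m := by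
  induction m with
  | zero => simp [copyCircuit]
  | succ m ih => simp [copyCircuit, ih]

@[simp] theorem queries_copyCircuit (c a b m : ℕ) :
    (copyCircuit c a b m).countP Gate.isQuery = 0 := by
  induction m with
  | zero => simp [copyCircuit]
  | succ m ih => simp [copyCircuit, ih, Gate.isQuery]

@[simp] theorem length_hadamardLayer (s m : ℕ) : (hadamardLayer s m).length = m := by
  induction m with
  | zero => simp [hadamardLayer]
  | succ m ih => simp [hadamardLayer, ih]

@[simp] theorem queries_hadamardLayer (s m : ℕ) :
    (hadamardLayer s m).countP Gate.isQuery = 0 := by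
  induction m with
  | zero => simp [hadamardLayer]
  | succ m ih => simp [hadamardLayer, ih, Gate.isQuery]

theorem length_nodeCircuit (b : Bool) (x y t : ℕ) : (nodeCircuit b x y t).length ≤ 7 := by
  cases b <;> simp [nodeCircuit]

@[simp] theorem queries_nodeCircuit (b : Bool) (x y t : ℕ) :
    (nodeCircuit b x y t).countP Gate.isQuery = 0 := by
  cases b <;> simp [nodeCircuit, Gate.isQuery]

theorem length_treeCircuit (c : Bool) (w idx k s : ℕ) :
    (treeCircuit c w idx k s).length + 7 ≤ 8 * 2 ^ k := by
  induction k generalizing s with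
  | zero => simp [treeCircuit]
  | succ k ih =>
    have h1 := ih s
    have h2 := ih (s + treeSize w k + 1)
    have h3 := length_nodeCircuit (c || k != 0) (s + treeSize w k)
      (s + treeSize w k + 1 + treeSize w k) (s + treeSize w (k + 1))
    rw [treeCircuit, List.length_append, List.length_append, pow_succ]
    omega

theorem queries_treeCircuit (c : Bool) (w idx k s : ℕ) :
    (treeCircuit c w idx k s).countP Gate.isQuery = 2 ^ k := by
  induction k generalizing s with
  | zero => simp [treeCircuit, Gate.isQuery]
  | succ k ih => rw [treeCircuit]; simp [ih, pow_succ]; omega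

theorem treeSize_add_two (w k : ℕ) : treeSize w k + 2 = 2 ^ k * (w + 2) := by
  induction k with
  | zero => simp [treeSize]
  | succ k ih => rw [treeSize, pow_succ, mul_right_comm, ← ih]; ring

theorem length_muxCircuit (ℓ f₁ i₁ f₂ i₂ t : ℕ) :
    (muxCircuit ℓ f₁ i₁ f₂ i₂ t).length = 2 * ℓ + 15 := by
  simp [muxCircuit]; omega

@[simp] theorem queries_muxCircuit (ℓ f₁ i₁ f₂ i₂ t : ℕ) :
    (muxCircuit ℓ f₁ i₁ f₂ i₂ t).countP Gate.isQuery = 0 := by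
  simp [muxCircuit, Gate.isQuery]

theorem length_reflectCircuit (s b m : ℕ) : (reflectCircuit s b m).length ≤ 38 * m + 4 := by
  have := length_compareCircuit 1 s b m
  simp [reflectCircuit]; omega

@[simp] theorem queries_reflectCircuit (s b m : ℕ) :
    (reflectCircuit s b m).countP Gate.isQuery = 0 := by
  simp [reflectCircuit]

theorem length_treeFilter (c : Bool) (w k : ℕ) (p : Proc) :
    (treeFilter c w k p).code.length ≤ p.code.length + 8 * 2 ^ k := by
  have := length_treeCircuit c w p.idx k p.top
  simp [treeFilter, filterProc]; omega

theorem queries_treeFilter (c : Bool) (w k : ℕ) (p : Proc) :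
    (treeFilter c w k p).code.countP Gate.isQuery = p.code.countP Gate.isQuery + 2 ^ k := by
  simp [treeFilter, filterProc, queries_treeCircuit, Gate.isQuery]

theorem top_treeFilter (c : Bool) (w k : ℕ) (p : Proc) :
    (treeFilter c w k p).top = p.top + 2 ^ k * (w + 2) := by
  rw [← treeSize_add_two]; rfl

theorem length_amplify (s : ℕ) (p : Proc) :
    (amplify s p).code.length ≤ 3 * p.code.length + 38 * (p.top - s) + 8 := by
  have := length_reflectCircuit s p.top (p.top - s)
  simp [amplify]; omega

theorem queries_amplify (s : ℕ) (p : Proc) :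
    (amplify s p).code.countP Gate.isQuery = 3 * p.code.countP Gate.isQuery := by
  simp [amplify]; omega

theorem two_pow_levelDepth (j : ℕ) : 2 ^ levelDepth j ≤ 2048 * 2 ^ j := by
  rw [show 2048 = 2 ^ 11 by norm_num, ← pow_add, levelDepth]
  exact Nat.pow_le_pow_right (by norm_num) (by omega)

/-- The recursion is T' ≤ 3T + 4096 * 2^j. Adding 4096 * 2^j to T absorbs the inhomogeneous term:
the sum grows by at most the factor 3. -/
theorem queries_levelProc (ℓ n w s j : ℕ) :
    (levelProc ℓ n w s j).code.countP Gate.isQuery + 4096 * 2 ^ j ≤ 6144 * 3 ^ j := by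
  induction j with
  | zero =>
    have := two_pow_levelDepth 0
    rw [levelProc, queries_treeFilter]
    simp [uniformProc]; omega
  | succ j ih =>
    have := two_pow_levelDepth (j + 1)
    rw [levelProc, queries_treeFilter, queries_amplify, pow_succ 3]
    rw [pow_succ] at *
    omega

/-- The ancillas of the reflection about double the width, and the tree adds O(2^j) blocks. The
bound has base 5/2: anything above 2 absorbs the added trees, and anything below 3 keeps the
reflections affordable. The factor 2^j clears denominators. -/
theorem top_levelProc (ℓ n w s j : ℕ) :
    2 ^ j * ((levelProc ℓ n w s j).top - s) ≤ 8194 * 5 ^ j * (ℓ + w + 2) := by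
  induction j with
  | zero =>
    have h := Nat.mul_le_mul_right (w + 2) (two_pow_levelDepth 0)
    rw [levelProc, top_treeFilter]
    simp only [uniformProc, Proc.top_mk, pow_zero] at *
    omega
  | succ j ih =>
    have h := Nat.mul_le_mul_right (w + 2) (two_pow_levelDepth (j + 1))
    rw [levelProc, top_treeFilter]
    simp only [amplify, Proc.top_mk]
    set K := ℓ + w + 2
    set Q := (levelProc ℓ n w s j).top
    have h1 : Q + (Q - s) + 1 + 2 ^ levelDepth (j + 1) * (w + 2) - s ≤
        2 * (Q - s) + 4097 * 2 ^ j * K := by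
      have h2 : 2048 * 2 ^ (j + 1) * (w + 2) ≤ 4096 * 2 ^ j * K := by
        rw [pow_succ]
        calc 2048 * (2 ^ j * 2) * (w + 2) = 4096 * 2 ^ j * (w + 2) := by ring
          _ ≤ _ := Nat.mul_le_mul_left _ (by omega)
      have h3 : 1 ≤ 2 ^ j * K := Nat.mul_pos (by positivity) (by omega)
      have h4 : 4097 * 2 ^ j * K = 4096 * 2 ^ j * K + 2 ^ j * K := by ring
      omega
    have h5 : (2 ^ j * 2 ^ j : ℕ) ≤ 5 ^ j := by
      rw [← mul_pow]; exact Nat.pow_le_pow_left (by norm_num) j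
    calc 2 ^ (j + 1) * _ ≤ 2 ^ (j + 1) * (2 * (Q - s) + 4097 * 2 ^ j * K) :=
          Nat.mul_le_mul_left _ h1
      _ = 4 * (2 ^ j * (Q - s)) + 8194 * (2 ^ j * 2 ^ j) * K := by ring
      _ ≤ 4 * (8194 * 5 ^ j * K) + 8194 * 5 ^ j * K := by gcongr
      _ = _ := by ring

/-- Each level triples the length and adds a reflection of cost proportional to the width, of order
(5/2)^j. The negative term is the particular solution that absorbs this, so that the total is
O(3^j). -/
theorem length_levelProc (ℓ n w s j : ℕ) :
    ((levelProc ℓ n w s j).code.length : ℝ) ≤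
      (700000 * 3 ^ j - 690000 * (5 / 2) ^ j) * (ℓ + w + 2) := by
  induction j with
  | zero =>
    have h := two_pow_levelDepth 0
    have h1 := length_treeFilter false w (levelDepth 0) (uniformProc ℓ n s)
    have h2 := length_compareCircuit n s (s + ℓ + 1) (ℓ + 1)
    have h3 : (levelProc ℓ n w s 0).code.length ≤ 10000 * (ℓ + w + 2) := by
      rw [levelProc]
      simp only [uniformProc, Proc.code_mk, List.length_append, length_hadamardLayer] at h1
      simp only [uniformProc]
      omega
    have h4 : ((levelProc ℓ n w s 0).code.length : ℝ) ≤ ((10000 * (ℓ + w + 2) : ℕ) : ℝ) := by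
      exact_mod_cast h3
    push_cast at h4
    linarith
  | succ j ih =>
    have h := two_pow_levelDepth (j + 1)
    have h1 := length_treeFilter false w (levelDepth (j + 1)) (amplify s (levelProc ℓ n w s j))
    have h2 := length_amplify s (levelProc ℓ n w s j)
    have h3 := top_levelProc ℓ n w s j
    change (levelProc ℓ n w s (j + 1)).code.length ≤ _ at h1
    set T := (levelProc ℓ n w s j).code.length
    set Q := (levelProc ℓ n w s j).top - s
    have h4 : (levelProc ℓ n w s (j + 1)).code.length ≤ 3 * T + 38 * Q + 8 + 32768 * 2 ^ j := by
      rw [pow_succ] at h; omega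
    have h4' : ((levelProc ℓ n w s (j + 1)).code.length : ℝ) ≤
      ((3 * T + 38 * Q + 8 + 32768 * 2 ^ j : ℕ) : ℝ) := by exact_mod_cast h4
    push_cast at h4'
    have h3' : (Q : ℝ) ≤ 8194 * (5 / 2) ^ j * (ℓ + w + 2) := by
      have e : ((2 ^ j * Q : ℕ) : ℝ) ≤ ((8194 * 5 ^ j * (ℓ + w + 2) : ℕ) : ℝ) := by
        exact_mod_cast h3
      push_cast at e
      rw [div_pow, ← mul_le_mul_iff_right₀ (show (0 : ℝ) < 2 ^ j by positivity)]
      refine e.trans (le_of_eq ?_)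
      field_simp
    have h5 : (2 : ℝ) ^ j ≤ (5 / 2) ^ j := pow_le_pow_left₀ (by norm_num) (by norm_num) j
    have h6 : (1 : ℝ) ≤ (5 / 2) ^ j := one_le_pow₀ (by norm_num)
    have h7 : (1 : ℝ) ≤ (ℓ + w + 2 : ℝ) := by
      have := Nat.cast_nonneg (α := ℝ) ℓ
      have := Nat.cast_nonneg (α := ℝ) w
      linarith
    set K := (ℓ + w + 2 : ℝ)
    set x := (5 / 2 : ℝ) ^ j
    have h8 : x ≤ x * K := le_mul_of_one_le_right (by linarith) h7
    rw [pow_succ, pow_succ]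
    change _ ≤ (700000 * (3 ^ j * 3) - 690000 * (x * (5 / 2))) * K
    nlinarith

theorem queries_orElse (ℓ : ℕ) (p q : Proc) : (orElse ℓ p q).code.countP Gate.isQuery =
    p.code.countP Gate.isQuery + q.code.countP Gate.isQuery := by
  simp [orElse]

theorem length_orElse (ℓ : ℕ) (p q : Proc) :
    (orElse ℓ p q).code.length = p.code.length + q.code.length + (2 * ℓ + 15) := by
  simp [orElse, length_muxCircuit, add_assoc]

/-- A geometric series: the last level dominates. -/
theorem queries_levelsProc (ℓ n w s m : ℕ) :
    (levelsProc ℓ n w s m).code.countP Gate.isQuery ≤ 3072 * 3 ^ m := by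
  induction m with
  | zero => simp [levelsProc, emptyProc]
  | succ m ih =>
    have := queries_levelProc ℓ n w (levelsProc ℓ n w s m).top m
    rw [levelsProc, queries_orElse, pow_succ]
    omega

theorem length_levelsProc (ℓ n w s m : ℕ) :
    ((levelsProc ℓ n w s m).code.length : ℝ) ≤ 400000 * 3 ^ m * (ℓ + w + 2) := by
  induction m with
  | zero => simp [levelsProc, emptyProc]; positivity
  | succ m ih =>
    have h := length_levelProc ℓ n w (levelsProc ℓ n w s m).top m
    rw [levelsProc, length_orElse, pow_succ]
    push_cast
    have h1 : (0 : ℝ) ≤ (5 / 2) ^ m * (ℓ + w + 2) := by positivity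
    have h2 : (ℓ + w + 2 : ℝ) ≤ 3 ^ m * (ℓ + w + 2) :=
      le_mul_of_one_le_left (by positivity) (one_le_pow₀ (by norm_num))
    have h3 : (0 : ℝ) ≤ ℓ := by positivity
    have h4 : (0 : ℝ) ≤ w := by positivity
    linarith

/-- The term 4^h is the number of leaves of the final check, a tree of depth 2h. -/
theorem queries_passesProc (ℓ n w m h s r : ℕ) :
    (passesProc ℓ n w m h s r).code.countP Gate.isQuery ≤ r * (3072 * 3 ^ m + 4 ^ h) := by
  induction r with
  | zero => simp [passesProc, emptyProc]
  | succ r ih =>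
    have := queries_levelsProc ℓ n w (passesProc ℓ n w m h s r).top m
    rw [passesProc, queries_orElse, passProc, queries_treeFilter, pow_mul, add_mul r 1]
    norm_num
    omega

theorem length_passesProc (ℓ n w m h s r : ℕ) :
    ((passesProc ℓ n w m h s r).code.length : ℝ) ≤
      r * ((400000 * 3 ^ m + 8) * (ℓ + w + 2) + 8 * 4 ^ h) := by
  induction r with
  | zero => simp [passesProc, emptyProc]
  | succ r ih =>
    have h1 := length_levelsProc ℓ n w (passesProc ℓ n w m h s r).top m
    have h2 := length_treeFilter true w (2 * h)
      (levelsProc ℓ n w (passesProc ℓ n w m h s r).top m)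
    rw [← passProc, pow_mul] at h2
    have h2' := (Nat.cast_le (α := ℝ)).mpr h2
    rw [passesProc, length_orElse]
    push_cast at h2' ⊢
    have h3 : (0 : ℝ) ≤ ℓ := by positivity
    have h4 : (0 : ℝ) ≤ w := by positivity
    linarith

theorem pow_clog_le {b n : ℕ} (hb : 1 < b) (hn : 1 ≤ n) : b ^ Nat.clog b n ≤ b * n := by
  rcases Nat.lt_or_ge 1 n with h | h
  · have h1 := Nat.pow_pred_clog_lt_self hb h
    have h2 : Nat.clog b n = (Nat.clog b n).pred + 1 :=
      (Nat.succ_pred_eq_of_pos (Nat.clog_pos hb h)).symm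
    rw [h2, pow_succ, mul_comm]
    exact Nat.mul_le_mul_left b h1.le
  · obtain rfl : n = 1 := by omega
    simp; omega

/-- The base 9 exceeds 18n by no power: 9^m ≤ 9 * 2^ℓ ≤ 18n, and 3^m is its square root. The summand
1 covers n = 0. -/
theorem three_pow_clog_le (n : ℕ) :
    (3 : ℝ) ^ Nat.clog 9 (2 ^ Nat.clog 2 n) ≤ 5 * √(n : ℝ) + 1 := by
  rcases Nat.eq_zero_or_pos n with rfl | hn
  · simp
  have h1 := pow_clog_le (b := 9) (n := 2 ^ Nat.clog 2 n) (by norm_num) (Nat.one_le_two_pow)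
  have h2 := pow_clog_le (b := 2) one_lt_two hn
  have h3 : 9 ^ Nat.clog 9 (2 ^ Nat.clog 2 n) ≤ 18 * n := by omega
  have h4 : ((9 ^ Nat.clog 9 (2 ^ Nat.clog 2 n) : ℕ) : ℝ) ≤ ((18 * n : ℕ) : ℝ) := by
    exact_mod_cast h3
  rw [show 9 = 3 ^ 2 by norm_num, ← pow_mul, mul_comm 2, pow_mul, ← show 9 = 3 ^ 2 by norm_num]
    at h4
  push_cast at h4
  have h5 : (3 : ℝ) ^ Nat.clog 9 (2 ^ Nat.clog 2 n) ≤ 5 * √(n : ℝ) := by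
    refine abs_le_of_sq_le_sq' ?_ (by positivity) |>.2
    rw [mul_pow, Real.sq_sqrt (by positivity)]
    linarith [show (0 : ℝ) ≤ n by positivity]
  linarith

/-- This d², times the O(d) passes, is the source of the cubic term in the final bounds. -/
theorem four_pow_le {d : ℕ} (hd : 1 ≤ d) : 4 ^ (Nat.clog 2 d + 2) ≤ 64 * d ^ 2 := by
  have h := Nat.pow_le_pow_left (pow_clog_le one_lt_two hd) 2
  rw [pow_add, show 4 = 2 ^ 2 by norm_num, ← pow_mul, mul_comm 2, pow_mul]
  rw [mul_pow] at h
  omega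

theorem clog_le_log (n : ℕ) : (Nat.clog 2 n : ℝ) + 2 ≤ 3 * (1 + Real.log n) := by
  rcases Nat.eq_zero_or_pos n with rfl | hn
  · simp; norm_num
  have h := pow_clog_le one_lt_two hn
  have h1 : ((2 : ℝ) ^ Nat.clog 2 n) ≤ 2 * n := by exact_mod_cast h
  have hn' : (1 : ℝ) ≤ n := by exact_mod_cast hn
  have h2 := Real.log_le_log (by positivity) h1
  rw [Real.log_pow, Real.log_mul (by norm_num) (by positivity)] at h2
  have h3 := Real.log_two_gt_d9
  have h4 := Real.log_nonneg hn'
  nlinarith [Real.log_two_lt_d9]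

theorem queries_searchCircuit {d : ℕ} (hd : 1 ≤ d) (n w : ℕ) :
    ((searchCircuit n w d).queries : ℝ) ≤ 600000 * (√(n : ℝ) * d + (d : ℝ) ^ 3) := by
  have h := queries_passesProc (Nat.clog 2 n) n w (Nat.clog 9 (2 ^ Nat.clog 2 n) + 1)
    (Nat.clog 2 d + 2) (Nat.clog 2 n + 1) (6 * (d + 1))
  have h1 : (searchCircuit n w d).queries ≤
      12 * d * (9216 * 3 ^ Nat.clog 9 (2 ^ Nat.clog 2 n) + 64 * d ^ 2) := by
    have e : (searchCircuit n w d).queries = (passesProc (Nat.clog 2 n) n w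
        (Nat.clog 9 (2 ^ Nat.clog 2 n) + 1) (Nat.clog 2 d + 2) (Nat.clog 2 n + 1)
        (6 * (d + 1))).code.countP Gate.isQuery := by
      simp [Circuit.queries, searchCircuit, outputCircuit, Gate.isQuery]
    rw [e]
    refine h.trans (Nat.mul_le_mul (by omega) (Nat.add_le_add ?_ (four_pow_le hd)))
    rw [pow_succ]; omega
  have h2 := (Nat.cast_le (α := ℝ)).mpr h1
  push_cast at h2
  have h3 := three_pow_clog_le n
  have hd' : (1 : ℝ) ≤ d := by exact_mod_cast hd
  have h4 : (d : ℝ) ≤ (d : ℝ) ^ 3 := le_self_pow₀ hd' (by norm_num)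
  have h5 := mul_le_mul_of_nonneg_left h3 (show (0 : ℝ) ≤ d by linarith)
  have h6 : 0 ≤ √(n : ℝ) * d := by positivity
  nlinarith

theorem time_searchCircuit {d : ℕ} (hd : 1 ≤ d) (n w : ℕ) :
    ((searchCircuit n w d).time : ℝ) ≤
      300000000 * (w + 1) * (1 + Real.log n) * (√(n : ℝ) * d + (d : ℝ) ^ 3) := by
  set ℓ := Nat.clog 2 n
  set m := Nat.clog 9 (2 ^ ℓ)
  have h := length_passesProc ℓ n w (m + 1) (Nat.clog 2 d + 2) (ℓ + 1) (6 * (d + 1))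
  have e : (searchCircuit n w d).time = (passesProc ℓ n w (m + 1) (Nat.clog 2 d + 2) (ℓ + 1)
      (6 * (d + 1))).code.length + (ℓ + 1) := by
    simp [Circuit.time, searchCircuit, outputCircuit, ℓ, m]
  have hd' : (1 : ℝ) ≤ d := by exact_mod_cast hd
  have h2 : (4 : ℝ) ^ (Nat.clog 2 d + 2) ≤ 64 * d ^ 2 := by exact_mod_cast four_pow_le hd
  have h3 : (3 : ℝ) ^ (m + 1) ≤ 15 * √(n : ℝ) + 3 := by
    have := three_pow_clog_le n
    rw [pow_succ]; linarith
  have h4 : (d : ℝ) ≤ (d : ℝ) ^ 3 := le_self_pow₀ hd' (by norm_num)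
  have hw : (0 : ℝ) ≤ w := by positivity
  have hℓ : (0 : ℝ) ≤ ℓ := by positivity
  set K := (ℓ + w + 2 : ℝ) with hK
  have hK1 : 1 ≤ K := by linarith
  have hr : ((6 * (d + 1) : ℕ) : ℝ) ≤ 12 * d := by push_cast; linarith
  set X := √(n : ℝ) * d + (d : ℝ) ^ 3 with hX
  have hX1 : 1 ≤ X := by
    have : 0 ≤ √(n : ℝ) * d := by positivity
    linarith
  have h5 : ((searchCircuit n w d).time : ℝ) ≤ 100000000 * (K * X) := by
    rw [e]
    push_cast at h hr ⊢
    have e1 : (400000 * (3 : ℝ) ^ (m + 1) + 8) * K + 8 * 4 ^ (Nat.clog 2 d + 2) ≤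
        (6000000 * √(n : ℝ) + 1200008 + 512 * d ^ 2) * K := by
      have := mul_le_mul_of_nonneg_right h3 (by linarith : 0 ≤ K)
      have e3 : (512 : ℝ) * d ^ 2 ≤ 512 * d ^ 2 * K := le_mul_of_one_le_right (by positivity) hK1
      linarith
    have e2 := h.trans (mul_le_mul hr e1 (by positivity) (by linarith))
    have e4 : 12 * (d : ℝ) * ((6000000 * √(n : ℝ) + 1200008 + 512 * d ^ 2) * K) ≤
        90000000 * (K * X) := by
      have : (12 * (d : ℝ) * (6000000 * √(n : ℝ) + 1200008 + 512 * d ^ 2)) ≤ 90000000 * X := by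
        have : 0 ≤ √(n : ℝ) * d := by positivity
        rw [hX]; linarith [pow_succ (d : ℝ) 2]
      nlinarith
    have e5 : (ℓ : ℝ) + 1 ≤ K * X := by nlinarith
    linarith
  have h6 : K ≤ 3 * ((w + 1) * (1 + Real.log n)) := by
    have := clog_le_log n
    have : (ℓ : ℝ) + w + 2 ≤ (w + 1) * (ℓ + 2) := by nlinarith
    nlinarith
  refine h5.trans ?_
  have := mul_le_mul_of_nonneg_right h6 (by linarith : 0 ≤ X)
  linarith

end QSearch


/-! ### The circuits as primitive recursive functions -/

namespace QSearch

/-! ### Computability -/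

section computable_basics

attribute [local fun_prop] Primrec Primrec.id Primrec.const Primrec.comp Primrec.fst Primrec.snd
  Primrec.pair

variable {α β σ : Type*} [Primcodable α] [Primcodable β] [Primcodable σ]

@[fun_prop] theorem primrec_fst {f : α → β × σ} (hf : Primrec f) : Primrec fun a => (f a).1 :=
  Primrec.fst.comp hf

@[fun_prop] theorem primrec_snd {f : α → β × σ} (hf : Primrec f) : Primrec fun a => (f a).2 :=
  Primrec.snd.comp hf

@[fun_prop] theorem primrec_add {f g : α → ℕ} (hf : Primrec f) (hg : Primrec g) :
    Primrec fun a => f a + g a := Primrec.nat_add.comp hf hg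

@[fun_prop] theorem primrec_sub {f g : α → ℕ} (hf : Primrec f) (hg : Primrec g) :
    Primrec fun a => f a - g a := Primrec.nat_sub.comp hf hg

@[fun_prop] theorem primrec_mul {f g : α → ℕ} (hf : Primrec f) (hg : Primrec g) :
    Primrec fun a => f a * g a := Primrec.nat_mul.comp hf hg

@[fun_prop] theorem primrec_div {f g : α → ℕ} (hf : Primrec f) (hg : Primrec g) :
    Primrec fun a => f a / g a := Primrec.nat_div.comp hf hg

@[fun_prop] theorem primrec_mod {f g : α → ℕ} (hf : Primrec f) (hg : Primrec g) :
    Primrec fun a => f a % g a := Primrec.nat_mod.comp hf hg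

@[fun_prop] theorem primrec_beq {f g : α → ℕ} (hf : Primrec f) (hg : Primrec g) :
    Primrec fun a => f a == g a := Primrec.beq.comp hf hg

@[fun_prop] theorem primrec_or {f g : α → Bool} (hf : Primrec f) (hg : Primrec g) :
    Primrec fun a => f a || g a := Primrec.or.comp hf hg

@[fun_prop] theorem primrec_not {f : α → Bool} (hf : Primrec f) :
    Primrec fun a => !f a := Primrec.not.comp hf

@[fun_prop] theorem primrec_append {f g : α → List β} (hf : Primrec f) (hg : Primrec g) :
    Primrec fun a => f a ++ g a := Primrec.list_append.comp hf hg

@[fun_prop] theorem primrec_cons {f : α → β} {g : α → List β} (hf : Primrec f) (hg : Primrec g) :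
    Primrec fun a => f a :: g a := Primrec.list_cons.comp hf hg

@[fun_prop] theorem primrec_cond {c : α → Bool} {f g : α → σ} (hc : Primrec c) (hf : Primrec f)
    (hg : Primrec g) : Primrec fun a => if c a = true then f a else g a :=
  (Primrec.cond hc hf hg).of_eq fun a => by cases c a <;> rfl

/-- A function that is defined by primitive recursion is primitive recursive. -/
theorem primrec_of_recursion {F : α → ℕ → σ} {g : α → σ} {h : α → ℕ × σ → σ} (hg : Primrec g)
    (hh : Primrec₂ h) (h0 : ∀ a, F a 0 = g a) (hs : ∀ a m, F a (m + 1) = h a (m, F a m)) :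
    Primrec₂ F :=
  (Primrec.nat_rec hg hh).of_eq fun a m => by
    induction m with
    | zero => exact (h0 a).symm
    | succ m ih => rw [hs, ← ih]

@[fun_prop] theorem primrec_pow {f g : α → ℕ} (hf : Primrec f) (hg : Primrec g) :
    Primrec fun a => f a ^ g a := by
  have : Primrec₂ fun b m : ℕ => b ^ m := by
    refine primrec_of_recursion (g := fun _ => 1) (h := fun b q => q.2 * b) (by fun_prop) ?_
      (fun _ => pow_zero _) fun _ _ => pow_succ _ _
    unfold Primrec₂
    fun_prop
  exact this.comp hf hg

@[fun_prop] theorem primrec_testBit {f g : α → ℕ} (hf : Primrec f) (hg : Primrec g) :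
    Primrec fun a => (f a).testBit (g a) := by
  have : Primrec fun a => (f a / 2 ^ g a) % 2 == 1 := by fun_prop
  refine this.of_eq fun a => ?_
  rw [Nat.testBit_eq_decide_div_mod_eq]
  rfl

@[fun_prop] theorem primrec_clog {b : ℕ} [Fact (1 < b)] {f : α → ℕ} (hf : Primrec f) :
    Primrec fun a => Nat.clog b (f a) := by
  have hb : 1 < b := Fact.out
  have hp : PrimrecRel fun n k : ℕ => b ^ (k - 1) < n :=
    Primrec.nat_lt.comp (by fun_prop) (by fun_prop)
  -- For k ≥ 1 the condition says that k is at most the ceiling logarithm, and n bounds the search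
  -- because n ≤ b^n.
  have : Primrec fun n : ℕ => n.findGreatest fun k => b ^ (k - 1) < n :=
    Primrec.nat_findGreatest Primrec.id hp
  refine (this.comp hf).of_eq fun a => ?_
  rw [Nat.findGreatest_eq_iff]
  refine ⟨?_, fun h => ?_, fun k hk _ => ?_⟩
  · rw [Nat.clog_le_iff_le_pow hb]
    exact (Nat.lt_pow_self hb).le
  · rw [← Nat.lt_clog_iff_pow_lt hb]
    omega
  · rw [not_lt, ← Nat.clog_le_iff_le_pow hb]
    omega

theorem primrec_sum_elim {γ : Type*} [Primcodable γ] {f : α → β ⊕ γ} {g : α → β → σ}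
    {h : α → γ → σ} (hf : Primrec f) (hg : Primrec₂ g) (hh : Primrec₂ h) :
    Primrec fun a => Sum.elim (g a) (h a) (f a) :=
  (Primrec.sumCasesOn hf hg hh).of_eq fun a => by cases f a <;> rfl

/-! #### Gates -/

theorem primrec_equivSum : Primrec Gate.equivSum := Primrec.of_equiv

theorem primrec_equivSum_symm : Primrec Gate.equivSum.symm := Primrec.of_equiv_symm

@[fun_prop] theorem primrec_hadamard {f : α → ℕ} (hf : Primrec f) :
    Primrec fun a => Gate.hadamard (f a) :=
  primrec_equivSum_symm.comp (Primrec.sumInl.comp (Primrec.sumInl.comp hf))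

@[fun_prop] theorem primrec_tgate {f : α → ℕ} (hf : Primrec f) :
    Primrec fun a => Gate.tgate (f a) :=
  primrec_equivSum_symm.comp (Primrec.sumInl.comp (Primrec.sumInr.comp hf))

@[fun_prop] theorem primrec_cnot {f g : α → ℕ} (hf : Primrec f) (hg : Primrec g) :
    Primrec fun a => Gate.cnot (f a) (g a) :=
  primrec_equivSum_symm.comp (Primrec.sumInr.comp (Primrec.sumInl.comp
    (Primrec.sumInl.comp (hf.pair hg))))

@[fun_prop] theorem primrec_toffoli {f g h : α → ℕ} (hf : Primrec f) (hg : Primrec g)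
    (hh : Primrec h) : Primrec fun a => Gate.toffoli (f a) (g a) (h a) :=
  primrec_equivSum_symm.comp (Primrec.sumInr.comp (Primrec.sumInl.comp
    (Primrec.sumInr.comp (hf.pair (hg.pair hh)))))

@[fun_prop] theorem primrec_oracle {f g h : α → ℕ} (hf : Primrec f) (hg : Primrec g)
    (hh : Primrec h) : Primrec fun a => Gate.oracle (f a) (g a) (h a) :=
  primrec_equivSum_symm.comp (Primrec.sumInr.comp (Primrec.sumInr.comp (Primrec.sumInr.comp
    (Primrec.sumInl.comp (hf.pair (hg.pair hh))))))

@[fun_prop] theorem primrec_oracleInv {f g h : α → ℕ} (hf : Primrec f) (hg : Primrec g)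
    (hh : Primrec h) : Primrec fun a => Gate.oracleInv (f a) (g a) (h a) :=
  primrec_equivSum_symm.comp (Primrec.sumInr.comp (Primrec.sumInr.comp (Primrec.sumInr.comp
    (Primrec.sumInr.comp (hf.pair (hg.pair hh))))))

theorem primrec_invGate : Primrec invGate := by
  have h : Primrec fun g : Gate => Sum.elim (fun _ => g) (fun r =>
      Sum.elim (fun _ => g) (fun r => Sum.elim (fun _ => g) (fun r =>
        Sum.elim (fun x => Gate.oracleInv x.1 x.2.1 x.2.2)
          (fun x => Gate.oracle x.1 x.2.1 x.2.2) r) r) r) (Gate.equivSum g) := by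
    refine primrec_sum_elim primrec_equivSum Primrec.fst
      (primrec_sum_elim (by fun_prop) (by unfold Primrec₂; fun_prop)
        (primrec_sum_elim (by fun_prop) (by unfold Primrec₂; fun_prop)
          (primrec_sum_elim (by fun_prop) (by unfold Primrec₂; fun_prop)
            (by unfold Primrec₂; fun_prop))))
  exact h.of_eq fun g => by cases g <;> rfl

@[fun_prop] theorem primrec_invCircuit {f : α → Circuit} (hf : Primrec f) :
    Primrec fun a => invCircuit (f a) :=
  Primrec.list_map (Primrec.list_reverse.comp hf) (primrec_invGate.comp Primrec.snd)

@[fun_prop] theorem primrec_zBlock {f : α → ℕ} (hf : Primrec f) :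
    Primrec fun a => zBlock (f a) := by
  unfold zBlock; fun_prop

@[fun_prop] theorem primrec_xBlock {f : α → ℕ} (hf : Primrec f) :
    Primrec fun a => xBlock (f a) := by
  unfold xBlock; fun_prop

/-! #### Circuits -/

@[fun_prop] theorem primrec_compareCircuit {f g h m : α → ℕ} (hf : Primrec f) (hg : Primrec g)
    (hh : Primrec h) (hm : Primrec m) :
    Primrec fun a => compareCircuit (f a) (g a) (h a) (m a) := by
  have : Primrec₂ fun (x : ℕ × ℕ × ℕ) m => compareCircuit x.1 x.2.1 x.2.2 m := by
    refine primrec_of_recursion (Primrec.const []) ?_ (fun _ => rfl) (h := fun x y => y.2 ++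
      if x.1.testBit y.1 then
        xBlock (x.2.2 + y.1) ++ ([.toffoli (x.2.1 + y.1) (x.2.2 + y.1) (x.2.2 + y.1 + 1)] ++
          (xBlock (x.2.2 + y.1) ++ xBlock (x.2.2 + y.1 + 1)))
      else xBlock (x.2.1 + y.1) ++ ([.toffoli (x.2.1 + y.1) (x.2.2 + y.1) (x.2.2 + y.1 + 1)] ++
        xBlock (x.2.1 + y.1))) fun _ _ => rfl
    unfold Primrec₂
    fun_prop
  exact this.comp (hf.pair (hg.pair hh)) hm

@[fun_prop] theorem primrec_copyCircuit {f g h m : α → ℕ} (hf : Primrec f) (hg : Primrec g)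
    (hh : Primrec h) (hm : Primrec m) :
    Primrec fun a => copyCircuit (f a) (g a) (h a) (m a) := by
  have : Primrec₂ fun (x : ℕ × ℕ × ℕ) m => copyCircuit x.1 x.2.1 x.2.2 m := by
    refine primrec_of_recursion (Primrec.const []) ?_ (fun _ => rfl) (h := fun x y => y.2 ++
      [.toffoli x.1 (x.2.1 + y.1) (x.2.2 + y.1)]) fun _ _ => rfl
    unfold Primrec₂
    fun_prop
  exact this.comp (hf.pair (hg.pair hh)) hm

@[fun_prop] theorem primrec_hadamardLayer {f m : α → ℕ} (hf : Primrec f) (hm : Primrec m) :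
    Primrec fun a => hadamardLayer (f a) (m a) := by
  have : Primrec₂ fun s m => hadamardLayer s m := by
    refine primrec_of_recursion (Primrec.const []) ?_ (fun _ => rfl) (h := fun s y => y.2 ++
      [.hadamard (s + y.1)]) fun _ _ => rfl
    unfold Primrec₂
    fun_prop
  exact this.comp hf hm

@[fun_prop] theorem primrec_nodeCircuit {b : α → Bool} {f g h : α → ℕ} (hb : Primrec b)
    (hf : Primrec f) (hg : Primrec g) (hh : Primrec h) :
    Primrec fun a => nodeCircuit (b a) (f a) (g a) (h a) := by
  unfold nodeCircuit; fun_prop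

@[fun_prop] theorem primrec_treeSize {f m : α → ℕ} (hf : Primrec f) (hm : Primrec m) :
    Primrec fun a => treeSize (f a) (m a) := by
  have : Primrec₂ fun w k => treeSize w k := by
    refine primrec_of_recursion Primrec.id ?_ (fun _ => rfl) (h := fun w y => 2 * (y.2 + 1))
      fun _ _ => rfl
    unfold Primrec₂
    fun_prop
  exact this.comp hf hm

/-- Moves a gate by `d` qubits, except for the index register of an oracle gate. -/
def shiftGate (d : ℕ) : Gate → Gate
  | .hadamard q => .hadamard (q + d)
  | .tgate q => .tgate (q + d)
  | .cnot c t => .cnot (c + d) (t + d)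
  | .toffoli c c' t => .toffoli (c + d) (c' + d) (t + d)
  | .oracle i a v => .oracle i (a + d) (v + d)
  | g => g

theorem primrec_shiftGate : Primrec₂ shiftGate := by
  have h : Primrec₂ fun (d : ℕ) (g : Gate) => Sum.elim
      (fun r => Sum.elim (fun q => Gate.hadamard (q + d)) (fun q => Gate.tgate (q + d)) r)
      (fun r => Sum.elim (fun r => Sum.elim (fun x => Gate.cnot (x.1 + d) (x.2 + d))
          (fun x => Gate.toffoli (x.1 + d) (x.2.1 + d) (x.2.2 + d)) r)
        (fun r => Sum.elim (fun _ => g) (fun r =>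
          Sum.elim (fun x => Gate.oracle x.1 (x.2.1 + d) (x.2.2 + d)) (fun _ => g) r) r) r)
      (Gate.equivSum g) := by
    refine primrec_sum_elim (primrec_equivSum.comp Primrec.snd)
      (primrec_sum_elim (by fun_prop) (by unfold Primrec₂; fun_prop)
        (by unfold Primrec₂; fun_prop))
      (primrec_sum_elim (by fun_prop)
        (primrec_sum_elim (by fun_prop) (by unfold Primrec₂; fun_prop)
          (by unfold Primrec₂; fun_prop))
        (primrec_sum_elim (by fun_prop) (by unfold Primrec₂; fun_prop)
          (primrec_sum_elim (by fun_prop) (by unfold Primrec₂; fun_prop)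
            (by unfold Primrec₂; fun_prop))))
  exact h.of_eq fun d g => by cases g <;> rfl

/-- The recursion for trees changes the parameter s, so it is not primitive as it stands. The right
subtree is however a shifted copy of the left one with the same index register, so one recursive
value suffices. -/
theorem map_shiftGate_treeCircuit (c : Bool) (w idx k s d : ℕ) :
    (treeCircuit c w idx k s).map (shiftGate d) = treeCircuit c w idx k (s + d) := by
  induction k generalizing s with
  | zero => simp [treeCircuit, shiftGate, add_right_comm]
  | succ k ih =>
    have h : ∀ (b : Bool) (x y t : ℕ), (nodeCircuit b x y t).map (shiftGate d) =
        nodeCircuit b (x + d) (y + d) (t + d) := by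
      intro b x y t
      cases b <;> rfl
    simp only [treeCircuit, List.map_append, ih, h]
    simp only [add_right_comm _ _ d]

@[fun_prop] theorem primrec_treeCircuit (c : Bool) {f g k s : α → ℕ} (hf : Primrec f)
    (hg : Primrec g) (hk : Primrec k) (hs : Primrec s) :
    Primrec fun a => treeCircuit c (f a) (g a) (k a) (s a) := by
  -- Trees are built at position 0 by genuine primitive recursion and moved to s afterwards.
  have h1 : Primrec₂ fun (x : ℕ × ℕ) k => treeCircuit c x.1 x.2 k 0 := by
    refine primrec_of_recursion (g := fun x => [.oracle x.2 (0 + x.1) 0])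
      (h := fun x y => y.2 ++ (y.2.map (shiftGate (0 + treeSize x.1 y.1 + 1)) ++
        nodeCircuit (c || !(y.1 == 0)) (0 + treeSize x.1 y.1)
          (0 + treeSize x.1 y.1 + 1 + treeSize x.1 y.1) (0 + treeSize x.1 (y.1 + 1))))
      (by fun_prop) ?_ (fun _ => rfl) fun x m => ?_
    · have e : Primrec fun p : (ℕ × ℕ) × ℕ × Circuit =>
          p.2.2.map (shiftGate (0 + treeSize p.1.1 p.2.1 + 1)) :=
        Primrec.list_map (by fun_prop) (primrec_shiftGate.comp (by fun_prop) (by fun_prop))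
      unfold Primrec₂
      fun_prop
    · rw [map_shiftGate_treeCircuit, treeCircuit]
      simp only [zero_add]
      rfl
  have h2 : Primrec fun a => (treeCircuit c (f a) (g a) (k a) 0).map (shiftGate (s a)) :=
    Primrec.list_map (h1.comp (hf.pair hg) hk) (primrec_shiftGate.comp (by fun_prop) (by fun_prop))
  exact h2.of_eq fun a => by rw [map_shiftGate_treeCircuit, zero_add]

/-! #### Search procedures -/

@[fun_prop] theorem primrec_proc_flag {p : α → Proc} (hp : Primrec p) :
    Primrec fun a => (p a).flag := primrec_fst (primrec_snd (primrec_snd hp))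

@[fun_prop] theorem primrec_proc_top {p : α → Proc} (hp : Primrec p) :
    Primrec fun a => (p a).top := primrec_snd (primrec_snd (primrec_snd hp))

@[fun_prop] theorem primrec_emptyProc {f s : α → ℕ} (hf : Primrec f) (hs : Primrec s) :
    Primrec fun a => emptyProc (f a) (s a) := by
  unfold emptyProc; fun_prop

@[fun_prop] theorem primrec_orElse {f : α → ℕ} {p q : α → Proc} (hf : Primrec f) (hp : Primrec p)
    (hq : Primrec q) : Primrec fun a => orElse (f a) (p a) (q a) := by
  unfold orElse muxCircuit; fun_prop

@[fun_prop] theorem primrec_treeFilter (c : Bool) {f k : α → ℕ} {p : α → Proc} (hf : Primrec f)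
    (hk : Primrec k) (hp : Primrec p) : Primrec fun a => treeFilter c (f a) (k a) (p a) := by
  unfold treeFilter filterProc; fun_prop

@[fun_prop] theorem primrec_amplify {s : α → ℕ} {p : α → Proc} (hs : Primrec s) (hp : Primrec p) :
    Primrec fun a => amplify (s a) (p a) := by
  unfold amplify reflectCircuit; fun_prop

@[fun_prop] theorem primrec_uniformProc {f g s : α → ℕ} (hf : Primrec f) (hg : Primrec g)
    (hs : Primrec s) : Primrec fun a => uniformProc (f a) (g a) (s a) := by
  unfold uniformProc; fun_prop

@[fun_prop] theorem primrec_levelDepth {f : α → ℕ} (hf : Primrec f) :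
    Primrec fun a => levelDepth (f a) := by
  unfold levelDepth; fun_prop

end computable_basics

section computable_search

attribute [local fun_prop] Primrec Primrec.id Primrec.const Primrec.comp Primrec.fst Primrec.snd
  Primrec.pair

variable {α β σ : Type*} [Primcodable α] [Primcodable β] [Primcodable σ]

theorem primrec_levelProc_aux :
    Primrec₂ fun (x : ℕ × ℕ × ℕ × ℕ) m => levelProc x.1 x.2.1 x.2.2.1 x.2.2.2 m := by
  refine primrec_of_recursion (g := fun x => treeFilter false x.2.2.1 (levelDepth 0)
      (uniformProc x.1 x.2.1 x.2.2.2))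
    (h := fun x y => treeFilter false x.2.2.1 (levelDepth (y.1 + 1)) (amplify x.2.2.2 y.2))
    (by fun_prop) ?_ (fun _ => by rw [levelProc]) fun _ _ => by rw [levelProc]
  unfold Primrec₂
  fun_prop

@[fun_prop] theorem primrec_levelProc {f g h s m : α → ℕ} (hf : Primrec f) (hg : Primrec g)
    (hh : Primrec h) (hs : Primrec s) (hm : Primrec m) :
    Primrec fun a => levelProc (f a) (g a) (h a) (s a) (m a) :=
  primrec_levelProc_aux.comp (hf.pair (hg.pair (hh.pair hs))) hm

theorem primrec_levelsProc_aux :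
    Primrec₂ fun (x : ℕ × ℕ × ℕ × ℕ) m => levelsProc x.1 x.2.1 x.2.2.1 x.2.2.2 m := by
  refine primrec_of_recursion (g := fun x => emptyProc x.1 x.2.2.2)
    (h := fun x y => orElse x.1 y.2 (levelProc x.1 x.2.1 x.2.2.1 y.2.top y.1))
    (by fun_prop) ?_ (fun _ => by rw [levelsProc]) fun _ _ => by rw [levelsProc]
  unfold Primrec₂
  fun_prop

@[fun_prop] theorem primrec_levelsProc {f g h s m : α → ℕ} (hf : Primrec f) (hg : Primrec g)
    (hh : Primrec h) (hs : Primrec s) (hm : Primrec m) :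
    Primrec fun a => levelsProc (f a) (g a) (h a) (s a) (m a) :=
  primrec_levelsProc_aux.comp (hf.pair (hg.pair (hh.pair hs))) hm

theorem primrec_passesProc_aux : Primrec₂ fun (x : ℕ × ℕ × ℕ × ℕ × ℕ × ℕ) r =>
    passesProc x.1 x.2.1 x.2.2.1 x.2.2.2.1 x.2.2.2.2.1 x.2.2.2.2.2 r := by
  refine primrec_of_recursion (g := fun x => emptyProc x.1 x.2.2.2.2.2)
    (h := fun x y => orElse x.1 y.2 (treeFilter true x.2.2.1 (2 * x.2.2.2.2.1)
      (levelsProc x.1 x.2.1 x.2.2.1 y.2.top x.2.2.2.1)))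
    (by fun_prop) ?_ (fun _ => by rw [passesProc]) fun _ _ => by rw [passesProc, passProc]
  unfold Primrec₂
  fun_prop

@[fun_prop] theorem primrec_passesProc {f g h m k s r : α → ℕ} (hf : Primrec f) (hg : Primrec g)
    (hh : Primrec h) (hm : Primrec m) (hk : Primrec k) (hs : Primrec s) (hr : Primrec r) :
    Primrec fun a => passesProc (f a) (g a) (h a) (m a) (k a) (s a) (r a) :=
  primrec_passesProc_aux.comp (hf.pair (hg.pair (hh.pair (hm.pair (hk.pair hs))))) hr

@[fun_prop] theorem primrec_outputCircuit {f : α → ℕ} {p : α → Proc} (hf : Primrec f)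
    (hp : Primrec p) : Primrec fun a => outputCircuit (f a) (p a) := by
  unfold outputCircuit; fun_prop

theorem primrec_searchCircuit {f g h : α → ℕ} (hf : Primrec f) (hg : Primrec g)
    (hh : Primrec h) : Primrec fun a => searchCircuit (f a) (g a) (h a) := by
  have : Fact (1 < 9) := ⟨by norm_num⟩
  have : Fact (1 < 2) := ⟨by norm_num⟩
  exact primrec_outputCircuit (by fun_prop) (primrec_passesProc (by fun_prop) hf hg (by fun_prop)
    (by fun_prop) (by fun_prop) (primrec_mul (by fun_prop) (by fun_prop)))

end computable_search

end QSearch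


/-! ### Choice of parameters and final bounds -/

namespace QSearch

/-! ### The search problem -/

/-- The instance all of whose indices are bad. -/
noncomputable def Instance.allBad (n : ℕ) : Instance n where
  good := ∅
  neutral := ∅
  bad := Finset.univ
  good_neutral := by simp
  good_bad := by simp
  neutral_bad := by simp
  cover := by simp
  f _ := PMF.pure false
  le_of_good := by simp
  lt_of_bad := by simp

/-- With p = 0 everywhere the identity is an oracle, with the clean workspace as ψ₀. -/
theorem Instance.isOracle_allBad (n w : ℕ) :
    (Instance.allBad n).IsOracle (1 : OracleUnitary (Instance.indexBits n) w) := by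
  intro i
  have hp : (Instance.allBad n).p i = 0 := by simp [Instance.p, Instance.allBad]
  refine ⟨fun z => if z = fun _ => false then 1 else 0, fun z => if z = fun _ => false then 1 else 0,
    by simp [apply_ite], by simp [apply_ite], fun j b z => ?_⟩
  rw [hp, Submonoid.coe_one, Matrix.one_apply]
  by_cases hj : j = Instance.enc i <;> by_cases hz : z = fun _ => false <;> cases b <;>
    simp [hj, hz]

/-- Well-formedness does not involve the oracle, but it is obtained here from a specification that
does; any one instance with an oracle will do. -/
theorem wellFormed_searchCircuit (n w d : ℕ) :
    (searchCircuit n w d).WellFormed (Instance.indexBits n) w :=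
  (outputCircuit_spec (isProc_passesProc (Instance.allBad n)
    (Instance.isOracle_allBad n w) _ _ _ _)).1

/-- The circuit that measures the initial state returns `⊥`. -/
theorem prob_nil {ℓ w : ℕ} (U : OracleUnitary ℓ w) {S : Option ℕ → Prop} (hS : S none) :
    Circuit.prob [] U S = 1 := by
  simp [Circuit.prob, Circuit.finalState, ket, Circuit.output, hS]

theorem exists_search_two_thirds :
    ∃ A : ℕ → ℕ → Circuit, Computable (fun x : ℕ × ℕ => A x.1 x.2) ∧
      ∃ (C : ℝ) (c : ℕ), ∀ n w : ℕ,
        (A n w).WellFormed (Instance.indexBits n) w ∧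
        ((A n w).queries : ℝ) ≤ C * √(n : ℝ) ∧
        ((A n w).time : ℝ) ≤ C * (w + 1) * (1 + Real.log n) ^ c * √(n : ℝ) ∧
        ∀ (P : Instance n) (U : OracleUnitary (Instance.indexBits n) w),
          P.IsOracle U → 2 / 3 ≤ (A n w).prob U P.IsCorrect := by
  -- For n = 0 the bounds are 0 and force the empty circuit, whose output ⊥ is correct. Otherwise d
  -- = 2 gives error at most 1/4, and √n ≥ 1 absorbs the constant terms.
  refine ⟨fun n w => if (n == 0) = true then [] else searchCircuit n w 2, ?_, 3000000000, 1,
    fun n w => ?_⟩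
  · exact (primrec_cond (primrec_beq Primrec.fst (Primrec.const 0)) (Primrec.const [])
      (primrec_searchCircuit Primrec.fst Primrec.snd (Primrec.const 2))).to_comp
  rcases Nat.eq_zero_or_pos n with rfl | hn
  · refine ⟨fun g hg => ?_, by simp [Circuit.queries], by simp [Circuit.time], fun P U _ => ?_⟩
    · simp at hg
    · have h : P.IsCorrect none := Finset.eq_empty_of_isEmpty P.good
      simp only [beq_self_eq_true, if_true]
      rw [prob_nil U h]
      norm_num
  · have hb : ¬ (n == 0) = true := by simp; omega
    simp only [if_neg hb]
    have hs : 1 ≤ √(n : ℝ) := Real.one_le_sqrt.mpr (by exact_mod_cast hn)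
    have hl : 0 ≤ Real.log n := Real.log_natCast_nonneg n
    refine ⟨wellFormed_searchCircuit n w 2, ?_, ?_, fun P U hU => ?_⟩
    · refine (queries_searchCircuit one_le_two n w).trans ?_
      push_cast
      linarith
    · refine (time_searchCircuit one_le_two n w).trans ?_
      have h : √(n : ℝ) * (2 : ℕ) + ((2 : ℕ) : ℝ) ^ 3 ≤ 10 * √(n : ℝ) := by push_cast; linarith
      refine (mul_le_mul_of_nonneg_left h (by positivity)).trans (le_of_eq ?_)
      rw [pow_one]; ring
    · refine le_trans ?_ (le_prob_searchCircuit one_le_two P hU)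
      norm_num

theorem exists_search_precise :
    ∃ B : ℕ → ℕ → ℕ → Circuit, Computable (fun x : ℕ × ℕ × ℕ => B x.1 x.2.1 x.2.2) ∧
      ∃ (C : ℝ) (c : ℕ), ∀ (n w : ℕ) (δ : ℝ), 0 < δ → δ < 1 / 3 →
        ∀ d : ℕ, d = ⌈Real.logb 2 δ⁻¹⌉₊ →
        (B n w d).WellFormed (Instance.indexBits n) w ∧
        ((B n w d).queries : ℝ) ≤ C * (√(n : ℝ) * Real.log δ⁻¹ + Real.log δ⁻¹ ^ 3) ∧
        ((B n w d).time : ℝ) ≤ C * (w + 1) * (1 + Real.log n) ^ c *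
          (√(n : ℝ) * Real.log δ⁻¹ + Real.log δ⁻¹ ^ 3) ∧
        ∀ (P : Instance n) (U : OracleUnitary (Instance.indexBits n) w),
          P.IsOracle U → 1 - δ ≤ (B n w d).prob U P.IsCorrect := by
  refine ⟨searchCircuit, ?_, 30000000000, 1, fun n w δ hδ hδ' d hd => ?_⟩
  · exact (primrec_searchCircuit Primrec.fst (primrec_fst Primrec.snd)
      (primrec_snd Primrec.snd)).to_comp
  set L := Real.log δ⁻¹ with hL
  have hδ3 : 3 < δ⁻¹ := by
    rw [lt_inv_comm₀ (by norm_num) hδ]; linarith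
  -- From δ⁻¹ > 3 > e. This lets L absorb the rounding of d.
  have hL1 : 1 < L := by
    rw [hL, Real.lt_log_iff_exp_lt (by positivity)]
    exact Real.exp_one_lt_three.trans hδ3
  have hlog := Real.log_two_gt_d9
  have hlogb : Real.logb 2 δ⁻¹ = L / Real.log 2 := rfl
  have hd1 : 1 ≤ d := by
    rw [hd, Nat.one_le_ceil_iff, hlogb]
    positivity
  -- Since log 2 > 1/2, d ≤ L / log 2 + 1 ≤ 2L + L; cubing yields the factor 27 below.
  have hdL : (d : ℝ) ≤ 3 * L := by
    have h := (Nat.ceil_lt_add_one (a := Real.logb 2 δ⁻¹) (by rw [hlogb]; positivity)).le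
    rw [← hd, hlogb] at h
    have h2 : L / Real.log 2 ≤ 2 * L := by
      rw [div_le_iff₀ (by linarith)]; nlinarith
    linarith
  have hl : 0 ≤ Real.log n := Real.log_natCast_nonneg n
  have hX : √(n : ℝ) * d + (d : ℝ) ^ 3 ≤ 27 * (√(n : ℝ) * L + L ^ 3) := by
    have h1 := pow_le_pow_left₀ (Nat.cast_nonneg d) hdL 3
    have h2 := mul_le_mul_of_nonneg_left hdL (Real.sqrt_nonneg n)
    have h3 : 0 ≤ √(n : ℝ) * L := by positivity
    rw [mul_pow] at h1
    linarith
  have hY : 0 ≤ √(n : ℝ) * L + L ^ 3 := by positivity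
  refine ⟨wellFormed_searchCircuit n w d, ?_, ?_, fun P U hU => ?_⟩
  · refine (queries_searchCircuit hd1 n w).trans ?_
    linarith
  · refine (time_searchCircuit hd1 n w).trans ?_
    rw [pow_one]
    refine (mul_le_mul_of_nonneg_left hX (by positivity)).trans ?_
    have h : 0 ≤ (w + 1) * (1 + Real.log n) * (√(n : ℝ) * L + L ^ 3) := by positivity
    linarith
  · refine le_trans ?_ (le_prob_searchCircuit hd1 P hU)
    have h : δ⁻¹ ≤ 2 ^ d := by
      rw [← Real.rpow_natCast, ← Real.logb_le_iff_le_rpow one_lt_two (by positivity), hd]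
      exact Nat.le_ceil _
    have h2 := inv_anti₀ (inv_pos.mpr hδ) h
    rw [inv_inv] at h2
    rw [one_div, inv_pow]
    linarith

end QSearch

theorem mainTheorem6 :
    (∃ A : ℕ → ℕ → QSearch.Circuit,
      Computable (fun x : ℕ × ℕ => A x.1 x.2) ∧
      ∃ (C : ℝ) (c : ℕ), ∀ n w : ℕ,
        (A n w).WellFormed (QSearch.Instance.indexBits n) w ∧
        ((A n w).queries : ℝ) ≤ C * √(n : ℝ) ∧
        ((A n w).time : ℝ) ≤ C * (w + 1) * (1 + Real.log n) ^ c * √(n : ℝ) ∧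
        ∀ (P : QSearch.Instance n)
          (U : QSearch.OracleUnitary (QSearch.Instance.indexBits n) w),
          P.IsOracle U → 2 / 3 ≤ (A n w).prob U P.IsCorrect) ∧
    (∃ B : ℕ → ℕ → ℕ → QSearch.Circuit,
      Computable (fun x : ℕ × ℕ × ℕ => B x.1 x.2.1 x.2.2) ∧
      ∃ (C : ℝ) (c : ℕ), ∀ (n w : ℕ) (δ : ℝ), 0 < δ → δ < 1 / 3 →
        ∀ d : ℕ, d = ⌈Real.logb 2 δ⁻¹⌉₊ →
        (B n w d).WellFormed (QSearch.Instance.indexBits n) w ∧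
        ((B n w d).queries : ℝ) ≤
          C * (√(n : ℝ) * Real.log δ⁻¹ + Real.log δ⁻¹ ^ 3) ∧
        ((B n w d).time : ℝ) ≤
          C * (w + 1) * (1 + Real.log n) ^ c *
            (√(n : ℝ) * Real.log δ⁻¹ + Real.log δ⁻¹ ^ 3) ∧
        ∀ (P : QSearch.Instance n)
          (U : QSearch.OracleUnitary (QSearch.Instance.indexBits n) w),
          P.IsOracle U → 1 - δ ≤ (B n w d).prob U P.IsCorrect) :=
  ⟨QSearch.exists_search_two_thirds, QSearch.exists_search_precise⟩
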